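/- For a group $G$ of isometries of Euclidean space $\mathbb{R}^3$ and a point $P\in\mathbb{R}^3$, the Dirichlet stereohedron of $G$ with base point $P$ is the closed Voronoi region of $P$ with respect to the orbit $GP$, that is, the set of all $x$ with $|x-P|\le|x-Q|$ for every $Q\in GP$. Its facets are its two-dimensional faces. Consider the following three groups of affine maps of $\mathbb{R}^3$. Each consists of all maps $p\mapsto f(p)+t$, where $t$ runs over the indicated lattice and $f$ over the indicated maps; here $\mathbb{Z}^3_I=\mathbb{Z}^3\cup\left(\left(\tfrac12,\tfrac12,\tfrac12\right)+\mathbb{Z}^3\right)$. * $I\overline{4}c2$ (No. 120): $t\in\mathbb{Z}^3_I$ and $f(x,y,z)$ is one of $(x,y,z)$, $(-x,-y,z)$, $(y,-x,-z)$, $(-y,x,-z)$, $(x,-y,z+\tfrac12)$, $(-x,y,z+\tfrac12)$, $(y,x,-z+\tfrac12)$, $(-y,-x,-z+\tfrac12)$. * $P\frac{4_2}{n}\frac{2}{g}\frac{2}{c}$ (that is, $P4_2/nbc$, No. 133): $t\in\mathbb{Z}^3$ and $f(x,y,z)$ is plus or minus one of $(x,y,z)$, $(-x+\tfrac12,-y+\tfrac12,z)$,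 $(-y+\tfrac12,x,z+\tfrac12)$, $(y,-x+\tfrac12,z+\tfrac12)$, $(-x+\tfrac12,y,-z)$, $(x,-y+\tfrac12,-z)$, $(y,x,-z+\tfrac12)$, $(-y+\tfrac12,-x+\tfrac12,-z+\tfrac12)$. * $I\frac{4_1}{g}\frac{2}{c}\frac{2}{d}$ (that is, $I4_1/acd$, No. 142): $t\in\mathbb{Z}^3_I$ and $f(x,y,z)$ is plus or minus one of $(x,y,z)$, $(-x+\tfrac12,-y,z+\tfrac12)$, $(-y+\tfrac14,x+\tfrac34,z+\tfrac14)$, $(y+\tfrac14,-x+\tfrac14,z+\tfrac34)$, $(-x+\tfrac12,y,-z)$, $(x,-y,-z+\tfrac12)$, $(y+\tfrac14,x+\tfrac34,-z+\tfrac34)$, $(-y+\tfrac14,-x+\tfrac14,-z+\tfrac14)$. A group $G$ of isometries of $\mathbb{R}^3$ is said to be of one of these types if it is conjugate to the corresponding group by a bijective affine map of $\mathbb{R}^3$. Let $P\in\mathbb{R}^3$ be any point. 1. If $G$ is of type $I\overline{4}c2$ or of type $P\frac{4_2}{n}\frac{2}{g}\frac{2}{c}$, then the Dirichlet stereohedron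 of $G$ with base point $P$ has at most $40$ facets. 2. If $G$ is of type $I\frac{4_1}{g}\frac{2}{c}\frac{2}{d}$, then the Dirichlet stereohedron of $G$ with base point $P$ has at most $80$ facets. -/

import Mathlib

/-- Euclidean three-dimensional space. -/
abbrev E3 : Type := EuclideanSpace ℝ (Fin 3)

/-- Triples of coordinates with respect to some affine frame of space (no metric is used here). -/
abbrev Coord3 : Type := Fin 3 → ℝ

/-! ### Dirichlet stereohedra and their facets -/

/-- The orbit `G P` of a point `P` under a group `G` of isometries of Euclidean space. -/
def pointOrbit (G : Subgroup (E3 ≃ᵃⁱ[ℝ] E3)) (P : E3) : Set E3 :=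
  {Q | ∃ g ∈ G, g P = Q}

/-- The closed Voronoi region of the point `P` with respect to the set of sites `S`. -/
def voronoiRegion (S : Set E3) (P : E3) : Set E3 :=
  {x | ∀ Q ∈ S, dist x P ≤ dist x Q}

/-- The Dirichlet stereohedron of `G` with base point `P`: the Voronoi region of `P` in the
Voronoi diagram of the orbit `G P`. -/
def dirichletStereohedron (G : Subgroup (E3 ≃ᵃⁱ[ℝ] E3)) (P : E3) : Set E3 :=
  voronoiRegion (pointOrbit G P) P

/-- The facets of a three-dimensional convex polytope `K`: its two-dimensional (exposed) faces. -/
def facets (K : Set E3) : Set (Set E3) :=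
  {F | IsExposed ℝ K F ∧ Module.finrank ℝ (vectorSpan ℝ F) = 2}

/-! ### The space groups, in crystallographic coordinates -/

/-- The primitive lattice `ℤ³` of translations. -/
def latticeP : Set Coord3 :=
  {t | ∃ n : Fin 3 → ℤ, ∀ i, t i = n i}

/-- The body-centered lattice `ℤ³ ∪ ((1/2, 1/2, 1/2) + ℤ³)` of translations. -/
def latticeI : Set Coord3 :=
  {t | ∃ n : Fin 3 → ℤ, (∀ i, t i = n i) ∨ (∀ i, t i = n i + 1 / 2)}

/-- The affine maps `p ↦ f p + t`, where `f` runs over a list of representatives (the "general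
position") and `t` runs over a translation lattice. -/
def spaceGroup (reps : Set (Coord3 → Coord3)) (lattice : Set Coord3) :
    Set (Coord3 ≃ᵃ[ℝ] Coord3) :=
  {h | ∃ f ∈ reps, ∃ t ∈ lattice, ∀ p, h p = f p + t}

/-- Adjoins to a set of maps their compositions with the inversion `p ↦ -p`. -/
def withInversion (reps : Set (Coord3 → Coord3)) : Set (Coord3 → Coord3) :=
  reps ∪ {f | ∃ r ∈ reps, ∀ p, f p = -r p}

/-- The group `I -4 c 2` (No. 120). -/
def groupI4bar_c2 : Set (Coord3 ≃ᵃ[ℝ] Coord3) :=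
  spaceGroup
    {fun p => ![p 0, p 1, p 2],
     fun p => ![-p 0, -p 1, p 2],
     fun p => ![p 1, -p 0, -p 2],
     fun p => ![-p 1, p 0, -p 2],
     fun p => ![p 0, -p 1, p 2 + 1 / 2],
     fun p => ![-p 0, p 1, p 2 + 1 / 2],
     fun p => ![p 1, p 0, -p 2 + 1 / 2],
     fun p => ![-p 1, -p 0, -p 2 + 1 / 2]}
    latticeI

/-- The group `P 4₂/n 2/g 2/c` (also written `P 4₂/n b c`, No. 133), with the origin at a center
of inversion. -/
def groupP42_nbc : Set (Coord3 ≃ᵃ[ℝ] Coord3) :=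
  spaceGroup
    (withInversion
      {fun p => ![p 0, p 1, p 2],
       fun p => ![-p 0 + 1 / 2, -p 1 + 1 / 2, p 2],
       fun p => ![-p 1 + 1 / 2, p 0, p 2 + 1 / 2],
       fun p => ![p 1, -p 0 + 1 / 2, p 2 + 1 / 2],
       fun p => ![-p 0 + 1 / 2, p 1, -p 2],
       fun p => ![p 0, -p 1 + 1 / 2, -p 2],
       fun p => ![p 1, p 0, -p 2 + 1 / 2],
       fun p => ![-p 1 + 1 / 2, -p 0 + 1 / 2, -p 2 + 1 / 2]})
    latticeP

/-- The group `I 4₁/g 2/c 2/d` (also written `I 4₁/a c d`, No. 142), with the origin at a center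
of inversion. -/
def groupI41_acd : Set (Coord3 ≃ᵃ[ℝ] Coord3) :=
  spaceGroup
    (withInversion
      {fun p => ![p 0, p 1, p 2],
       fun p => ![-p 0 + 1 / 2, -p 1, p 2 + 1 / 2],
       fun p => ![-p 1 + 1 / 4, p 0 + 3 / 4, p 2 + 1 / 4],
       fun p => ![p 1 + 1 / 4, -p 0 + 1 / 4, p 2 + 3 / 4],
       fun p => ![-p 0 + 1 / 2, p 1, -p 2],
       fun p => ![p 0, -p 1, -p 2 + 1 / 2],
       fun p => ![p 1 + 1 / 4, p 0 + 3 / 4, -p 2 + 3 / 4],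
       fun p => ![-p 1 + 1 / 4, -p 0 + 1 / 4, -p 2 + 1 / 4]})
    latticeI

/-- The group `G` of isometries belongs to the affine conjugacy class of the group `S` of affine
maps: in suitable affine coordinates `φ`, the elements of `G` are exactly the elements of `S`. -/
def IsOfType (G : Subgroup (E3 ≃ᵃⁱ[ℝ] E3)) (S : Set (Coord3 ≃ᵃ[ℝ] Coord3)) : Prop :=
  ∃ φ : E3 ≃ᵃ[ℝ] Coord3, ∀ h : Coord3 ≃ᵃ[ℝ] Coord3,
    h ∈ S ↔ ∃ g ∈ G, ∀ x, h (φ x) = φ (g x)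

/-! Each of the three groups contains a plane group `pgg` of translations, half-turns and glides
that act at constant height, together with the unit vertical translations. The orbit of `P` is
therefore a union of layers: planar `pgg` orbits in horizontal planes, each repeated at unit
distance along the third axis. Besides the class of `P` there are at most three classes of layers
for the first two groups and at most seven for the third. In these coordinates the symmetries force
the metric to have the form A(dx² + dy²) + C dz² (`exists_metric`).

Every facet lies on the bisector of `P` and a site Q such that P and Q are the only nearest sites of
some point w (`exists_neighbor_of_mem_facets`). Unless Q is P shifted vertically by one, comparing w
with P shifted towards Q and Q shifted towards P shows that the heights of P and Q differ by less
than 1. If Q is in the class of P, it has the same height and the planar Dirichlet domains of the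
two share an edge; there are at most 6 such Q. Otherwise, comparing w only with sites of the layer
of P and only with sites of the layer of Q puts the projection of w in the interior of both planar
domains, so these overlap. A class has at most two heights in the allowed window. This gives at most
2 + 6 + 2 ∑ N facets, where N bounds the planar overlaps with each class (`encard_neighbors_le`).

The planar bounds (`planarBounds`) depend only on how the other orbit arises from that of p: N = 4
for the displacement (1/2, 1/2), N = 7 for half displacements along one axis, and N = 4 or 5 for
quarter turns, according to parity. The normalizer of `pgg` reduces p to the triangle 0 ≤ y ≤ x ≤
1/4. There, displacement bounds leave finitely many motions, and explicit certificates exclude all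
but those in `axialLabels` and `diagonalLabels`. The totals are 8 + 2(4 + 4 + 4) = 32 and 8 + 2(4 +
5 + 5 + 7 + 7 + 4 + 4) = 80. -/

/-! ### Planar inequalities: which Dirichlet domains can overlap. -/

/-- The difference of the squared distances from `(w₁, w₂)` to `(u, v)` and to `(x, y)`. -/
def excess (w₁ w₂ x y u v : ℝ) : ℝ :=
  (w₁ - u) ^ 2 + (w₂ - v) ^ 2 - ((w₁ - x) ^ 2 + (w₂ - y) ^ 2)

/-- The point `(x, y)` is strictly closer to `(w₁, w₂)` than all its images under the other
elements of the plane group `pgg` with lattice `ℤ²` and a rotation center at the origin. -/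
structure Near (w₁ w₂ x y : ℝ) : Prop where
  tr : ∀ a b : ℤ, (a ≠ 0 ∨ b ≠ 0) → 0 < excess w₁ w₂ x y (x + a) (y + b)
  rot : ∀ a b : ℤ, 0 < excess w₁ w₂ x y (-x + a) (-y + b)
  gl₁ : ∀ a b : ℤ, 0 < excess w₁ w₂ x y (x + 1 / 2 + a) (-y + 1 / 2 + b)
  gl₂ : ∀ a b : ℤ, 0 < excess w₁ w₂ x y (-x + 1 / 2 + a) (y + 1 / 2 + b)

/-- For a unit lattice vector e, w is closer to p than to p + e and closer to q than to q - e.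
Adding the two inequalities eliminates w and leaves ⟨q - p, e⟩ < 1. -/
theorem Near.displacement_lt {w₁ w₂ x y u v : ℝ} (P : Near w₁ w₂ x y) (Q : Near w₁ w₂ u v) :
    u - x < 1 ∧ x - u < 1 ∧ v - y < 1 ∧ y - v < 1 := by
  have e₁ := P.tr 1 0 (by decide); have e₂ := Q.tr (-1) 0 (by decide)
  have e₃ := P.tr (-1) 0 (by decide); have e₄ := Q.tr 1 0 (by decide)
  have e₅ := P.tr 0 1 (by decide); have e₆ := Q.tr 0 (-1) (by decide)
  have e₇ := P.tr 0 (-1) (by decide); have e₈ := Q.tr 0 1 (by decide)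
  push_cast [excess] at *
  refine ⟨?_, ?_, ?_, ?_⟩ <;> linarith

/-- This lemma and the next seven treat one element of the point group each. The displacement bound
leaves finitely many offsets, and every offset outside the list is refuted by a certificate. An
`excess` is affine in w, because the squares of w cancel, so suitable combinations of excesses, with
multipliers built from the nonnegative quantities y, x - y and 1/4 - x, eliminate w. The excesses
that occur unmultiplied make the contradiction strict. -/
theorem near_near_id {w₁ w₂ x y : ℝ} (h₁ : 0 ≤ y) (h₂ : 0 ≤ x - y) (h₃ : 0 ≤ 1 / 4 - x)
    {a b : ℤ} (P : Near w₁ w₂ x y) (Q : Near w₁ w₂ (x + a / 2) (y + b / 2)) :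
    (a, b) ∈ ([(0, 0), (1, 0), (-1, 0), (0, 1), (0, -1)] : List (ℤ × ℤ)) := by
  obtain ⟨k₁, k₂, k₃, k₄⟩ := P.displacement_lt Q
  have l₁ : -2 < a := by
    have : (-2 : ℝ) < a := by linarith
    exact_mod_cast this
  have l₂ : a < 2 := by
    have : (a : ℝ) < 2 := by linarith
    exact_mod_cast this
  have m₁ : -2 < b := by
    have : (-2 : ℝ) < b := by linarith
    exact_mod_cast this
  have m₂ : b < 2 := by
    have : (b : ℝ) < 2 := by linarith
    exact_mod_cast this
  clear k₁ k₂ k₃ k₄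
  interval_cases a <;> interval_cases b <;> first | decide | (exfalso; push_cast at Q)
  · have e₀ := P.rot 0 0; have e₁ := P.gl₂ 0 (-1); have e₂ := Q.rot 0 0; have e₃ := Q.gl₁ 0 (-1)
    push_cast [excess] at e₀ e₁ e₂ e₃
    linarith only [e₀, mul_nonneg h₃ e₀.le, mul_nonneg h₂ e₁.le, mul_nonneg h₁ e₂.le,
      mul_nonneg h₂ e₃.le]
  · have e₀ := P.gl₁ (-1) 0; have e₁ := P.gl₂ 0 0; have e₂ := Q.rot 0 1; have e₃ := Q.gl₁ 0 1
    have e₄ := Q.gl₂ (-1) (-1); push_cast [excess] at e₀ e₁ e₂ e₃ e₄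
    linarith only [e₀, mul_nonneg h₃ e₀.le, mul_nonneg h₁ e₁.le, mul_nonneg h₂ e₂.le,
      mul_nonneg h₁ e₃.le, e₄, mul_nonneg h₃ e₄.le]
  · have e₀ := P.rot 1 0; have e₁ := P.gl₁ 0 0; have e₂ := P.gl₂ 0 (-1)
    have e₃ := Q.gl₁ (-1) (-1); have e₄ := Q.gl₂ 1 0; push_cast [excess] at e₀ e₁ e₂ e₃ e₄
    linarith only [mul_nonneg h₂ e₀.le, mul_nonneg h₁ e₁.le, e₂, mul_nonneg h₃ e₂.le, e₃,
      mul_nonneg h₃ e₃.le, mul_nonneg h₁ e₄.le]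
  · have e₀ := P.rot 1 0; have e₁ := P.rot 1 1; have e₂ := P.gl₁ 0 0; have e₃ := P.gl₂ 0 0
    have e₄ := Q.rot 1 1; have e₅ := Q.gl₁ (-1) 0; have e₆ := Q.gl₂ 1 (-1)
    push_cast [excess] at e₀ e₁ e₂ e₃ e₄ e₅ e₆
    linarith only [mul_nonneg h₂ e₀.le, mul_nonneg h₁ e₁.le, mul_nonneg h₁ e₂.le,
      mul_nonneg h₂ e₂.le, mul_nonneg h₁ e₃.le, mul_nonneg h₃ e₃.le, e₄, mul_nonneg h₃ e₅.le,
      mul_nonneg h₂ e₆.le]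

/-- If a and b are both even, the two points belong to the same `pgg` orbit and w would have to be
strictly closer to each than to the other. -/
theorem near_near_neg {w₁ w₂ x y : ℝ} (h₁ : 0 ≤ y) (h₂ : 0 ≤ x - y) (h₃ : 0 ≤ 1 / 4 - x)
    {a b : ℤ} (P : Near w₁ w₂ x y) (Q : Near w₁ w₂ (-x + a / 2) (-y + b / 2)) :
    (a, b) ∈ ([(1, 0), (0, 1), (1, 1)] : List (ℤ × ℤ)) := by
  obtain ⟨k₁, k₂, k₃, k₄⟩ := P.displacement_lt Q
  have l₁ : -2 < a := by
    have : (-2 : ℝ) < a := by linarith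
    exact_mod_cast this
  have l₂ : a < 3 := by
    have : (a : ℝ) < 3 := by linarith
    exact_mod_cast this
  have m₁ : -2 < b := by
    have : (-2 : ℝ) < b := by linarith
    exact_mod_cast this
  have m₂ : b < 3 := by
    have : (b : ℝ) < 3 := by linarith
    exact_mod_cast this
  clear k₁ k₂ k₃ k₄
  interval_cases a <;> interval_cases b <;> first | decide | (exfalso; push_cast at Q)
  · have e₀ := P.gl₂ (-1) (-1); have e₁ := Q.gl₂ (-1) 0; push_cast [excess] at e₀ e₁
    linarith only [e₀, e₁, h₁]
  · have e₀ := P.rot 0 0; have e₁ := Q.rot (-1) 0; push_cast [excess] at e₀ e₁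
    linarith only [e₀, e₁, h₁, h₂]
  · have e₀ := P.gl₁ (-1) 0; have e₁ := P.gl₂ (-1) 0; have e₂ := Q.gl₁ 0 0
    have e₃ := Q.gl₂ (-1) (-1); push_cast [excess] at e₀ e₁ e₂ e₃
    linarith only [e₀, e₁, e₂, e₃, h₂]
  · have e₀ := P.tr (-1) 0 (by decide); have e₁ := P.rot 0 1; have e₂ := P.gl₂ (-1) (-1)
    have e₃ := P.gl₂ (-1) 0; have e₄ := Q.rot (-2) 2; have e₅ := Q.gl₁ 0 1
    have e₆ := Q.gl₂ (-1) (-1); push_cast [excess] at e₀ e₁ e₂ e₃ e₄ e₅ e₆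
    linarith only [e₀, e₁, e₂, e₃, e₄, e₅, e₆, h₂]
  · have e₀ := P.rot 0 0; have e₁ := Q.rot 0 (-1); push_cast [excess] at e₀ e₁
    linarith only [e₀, e₁, h₁]
  · have e₀ := P.rot 0 0; have e₁ := Q.rot 0 0; push_cast [excess] at e₀ e₁
    linarith only [e₀, e₁]
  · have e₀ := P.rot 0 1; have e₁ := Q.rot 0 1; push_cast [excess] at e₀ e₁
    linarith only [e₀, e₁]
  · have e₀ := P.gl₂ 0 (-1); have e₁ := Q.gl₂ 0 0; push_cast [excess] at e₀ e₁
    linarith only [e₀, e₁, h₁]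
  · have e₀ := P.gl₂ 0 0; have e₁ := Q.gl₂ 0 (-1); push_cast [excess] at e₀ e₁
    linarith only [e₀, e₁, h₂, h₃]
  · have e₀ := P.rot 1 0; have e₁ := Q.rot 1 (-1); push_cast [excess] at e₀ e₁
    linarith only [e₀, e₁, h₁]
  · have e₀ := P.rot 1 0; have e₁ := Q.rot 1 0; push_cast [excess] at e₀ e₁
    linarith only [e₀, e₁]
  · have e₀ := P.gl₁ 0 0; have e₁ := Q.gl₁ (-1) 0; push_cast [excess] at e₀ e₁
    linarith only [e₀, e₁, h₃]
  · have e₀ := P.rot 1 1; have e₁ := Q.rot 1 1; push_cast [excess] at e₀ e₁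
    linarith only [e₀, e₁]

/-- If a and b are both odd, the motion is a glide of `pgg` itself, and the two points compete for w
directly. The other offsets need the triangle inequalities. -/
theorem near_near_flip_snd {w₁ w₂ x y : ℝ} (h₁ : 0 ≤ y) (h₂ : 0 ≤ x - y) (h₃ : 0 ≤ 1 / 4 - x)
    {a b : ℤ} (P : Near w₁ w₂ x y) (Q : Near w₁ w₂ (x + a / 2) (-y + b / 2)) :
    (a, b) ∈ ([(1, 0), (-1, 0), (0, 0), (0, 1), (0, -1)] : List (ℤ × ℤ)) := by
  obtain ⟨k₁, k₂, k₃, k₄⟩ := P.displacement_lt Q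
  have l₁ : -2 < a := by
    have : (-2 : ℝ) < a := by linarith
    exact_mod_cast this
  have l₂ : a < 2 := by
    have : (a : ℝ) < 2 := by linarith
    exact_mod_cast this
  have m₁ : -2 < b := by
    have : (-2 : ℝ) < b := by linarith
    exact_mod_cast this
  have m₂ : b < 3 := by
    have : (b : ℝ) < 3 := by linarith
    exact_mod_cast this
  clear k₁ k₂ k₃ k₄
  interval_cases a <;> interval_cases b <;> first | decide | (exfalso; push_cast at Q)
  · have e₀ := P.gl₁ (-1) (-1); have e₁ := Q.gl₁ 0 (-1); push_cast [excess] at e₀ e₁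
    linarith only [e₀, e₁]
  · have e₀ := P.gl₁ (-1) 0; have e₁ := Q.gl₁ 0 0; push_cast [excess] at e₀ e₁
    linarith only [e₀, e₁]
  · have e₀ := P.gl₁ (-1) 0; have e₁ := Q.gl₁ 0 1; push_cast [excess] at e₀ e₁
    linarith only [e₀, e₁, h₂, h₃]
  · have e₀ := P.tr 0 1 (by decide); have e₁ := P.rot 0 1; have e₂ := P.gl₂ 0 0
    have e₃ := Q.rot 1 1; have e₄ := Q.gl₁ (-1) 1; have e₅ := Q.gl₂ 0 (-1)
    push_cast [excess] at e₀ e₁ e₂ e₃ e₄ e₅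
    linarith only [mul_nonneg h₂ e₀.le, mul_nonneg h₂ e₁.le, mul_nonneg h₃ e₁.le,
      mul_nonneg h₁ e₂.le, mul_nonneg h₂ e₃.le, mul_nonneg h₃ e₄.le, e₅]
  · have e₀ := P.gl₁ 0 (-1); have e₁ := Q.gl₁ (-1) (-1); push_cast [excess] at e₀ e₁
    linarith only [e₀, e₁]
  · have e₀ := P.gl₁ 0 0; have e₁ := Q.gl₁ (-1) 0; push_cast [excess] at e₀ e₁
    linarith only [e₀, e₁]
  · have e₀ := P.gl₁ 0 0; have e₁ := Q.gl₁ (-1) 1; push_cast [excess] at e₀ e₁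
    linarith only [e₀, e₁, h₂, h₃]

theorem near_near_flip_fst {w₁ w₂ x y : ℝ} (h₁ : 0 ≤ y) (h₂ : 0 ≤ x - y) (h₃ : 0 ≤ 1 / 4 - x)
    {a b : ℤ} (P : Near w₁ w₂ x y) (Q : Near w₁ w₂ (-x + a / 2) (y + b / 2)) :
    (a, b) ∈ ([(0, 1), (0, -1), (0, 0), (1, 0), (2, 0)] : List (ℤ × ℤ)) := by
  obtain ⟨k₁, k₂, k₃, k₄⟩ := P.displacement_lt Q
  have l₁ : -2 < a := by
    have : (-2 : ℝ) < a := by linarith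
    exact_mod_cast this
  have l₂ : a < 3 := by
    have : (a : ℝ) < 3 := by linarith
    exact_mod_cast this
  have m₁ : -2 < b := by
    have : (-2 : ℝ) < b := by linarith
    exact_mod_cast this
  have m₂ : b < 2 := by
    have : (b : ℝ) < 2 := by linarith
    exact_mod_cast this
  clear k₁ k₂ k₃ k₄
  interval_cases a <;> interval_cases b <;> first | decide | (exfalso; push_cast at Q)
  · have e₀ := P.gl₂ (-1) (-1); have e₁ := Q.gl₂ (-1) 0; push_cast [excess] at e₀ e₁
    linarith only [e₀, e₁]
  · have e₀ := P.tr 0 (-1) (by decide); have e₁ := P.tr 0 1 (by decide); have e₂ := P.rot 0 0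
    have e₃ := P.gl₂ (-1) 0; have e₄ := Q.rot (-1) 0; have e₅ := Q.gl₁ 0 0
    push_cast [excess] at e₀ e₁ e₂ e₃ e₄ e₅
    linarith only [mul_nonneg h₂ e₀.le, mul_nonneg h₂ e₁.le, mul_nonneg h₂ e₂.le,
      mul_nonneg h₃ e₂.le, mul_nonneg h₁ e₃.le, e₄, mul_nonneg h₁ e₅.le]
  · have e₀ := P.gl₂ (-1) 0; have e₁ := Q.gl₂ (-1) (-1); push_cast [excess] at e₀ e₁
    linarith only [e₀, e₁]
  · have e₀ := P.gl₂ 0 (-1); have e₁ := Q.gl₂ 0 0; push_cast [excess] at e₀ e₁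
    linarith only [e₀, e₁]
  · have e₀ := P.gl₂ 0 0; have e₁ := Q.gl₂ 0 (-1); push_cast [excess] at e₀ e₁
    linarith only [e₀, e₁]
  · have e₀ := P.gl₂ 0 (-1); have e₁ := Q.gl₂ 1 0; push_cast [excess] at e₀ e₁
    linarith only [e₀, e₁, h₃]
  · have e₀ := P.gl₂ 0 0; have e₁ := Q.gl₂ 1 (-1); push_cast [excess] at e₀ e₁
    linarith only [e₀, e₁, h₃]

/-- The quarter turn normalizes `pgg` without belonging to it, so the two orbits are different in
general and there is no direct competition between the points. All exclusions rest on certificates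
that mix inequalities from both orbits. -/
theorem near_near_rotate {w₁ w₂ x y : ℝ} (h₁ : 0 ≤ y) (h₂ : 0 ≤ x - y) (h₃ : 0 ≤ 1 / 4 - x)
    {a b : ℤ} (P : Near w₁ w₂ x y) (Q : Near w₁ w₂ (y + a / 2) (-x + b / 2)) :
    (a, b) ∈ ([(0, 0), (1, 1), (0, 1), (1, 0)] : List (ℤ × ℤ)) := by
  obtain ⟨k₁, k₂, k₃, k₄⟩ := P.displacement_lt Q
  have l₁ : -2 < a := by
    have : (-2 : ℝ) < a := by linarith
    exact_mod_cast this
  have l₂ : a < 3 := by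
    have : (a : ℝ) < 3 := by linarith
    exact_mod_cast this
  have m₁ : -2 < b := by
    have : (-2 : ℝ) < b := by linarith
    exact_mod_cast this
  have m₂ : b < 3 := by
    have : (b : ℝ) < 3 := by linarith
    exact_mod_cast this
  clear k₁ k₂ k₃ k₄
  interval_cases a <;> interval_cases b <;> first | decide | (exfalso; push_cast at Q)
  · have e₀ := P.tr 0 (-1) (by decide); have e₁ := Q.gl₁ 0 (-1); have e₂ := P.gl₁ (-1) (-1)
    push_cast [excess] at e₀ e₁ e₂
    linarith only [mul_nonneg h₂ e₀.le, mul_nonneg h₁ h₂, e₁, e₂]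
  · have e₀ := P.rot 0 0; have e₁ := P.gl₁ (-1) (-1); have e₂ := P.gl₂ (-1) (-1)
    have e₃ := Q.tr 1 0 (by decide); have e₄ := Q.rot (-1) 0; have e₅ := Q.rot 0 0
    have e₆ := Q.gl₁ 0 (-1); have e₇ := Q.gl₁ 0 0; have e₈ := Q.gl₂ (-1) (-1)
    have e₉ := Q.gl₂ (-1) 0; push_cast [excess] at e₀ e₁ e₂ e₃ e₄ e₅ e₆ e₇ e₈ e₉
    -- This certificate also uses multipliers of degree two in x and y.
    linarith only [e₀, mul_nonneg h₃ e₀.le, mul_nonneg (mul_nonneg h₁ h₁) e₀.le,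
      mul_nonneg (mul_nonneg h₂ h₂) e₀.le, mul_nonneg (mul_nonneg h₂ h₃) e₀.le,
      mul_nonneg (mul_nonneg h₃ h₃) e₀.le, mul_nonneg (mul_nonneg h₁ h₂) e₁.le,
      mul_nonneg (mul_nonneg h₂ h₂) e₂.le, mul_nonneg (mul_nonneg h₁ h₂) e₃.le,
      mul_nonneg (mul_nonneg h₂ h₃) e₃.le, mul_nonneg (mul_nonneg h₁ h₂) e₄.le,
      mul_nonneg (mul_nonneg h₁ h₂) e₅.le, mul_nonneg (mul_nonneg h₂ h₃) e₅.le,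
      mul_nonneg h₂ e₆.le, mul_nonneg (mul_nonneg h₁ h₁) e₆.le,
      mul_nonneg (mul_nonneg h₁ h₂) e₆.le, mul_nonneg (mul_nonneg h₂ h₂) e₆.le,
      mul_nonneg (mul_nonneg h₂ h₂) e₇.le, mul_nonneg (mul_nonneg h₂ h₂) e₈.le,
      mul_nonneg h₁ e₉.le, mul_nonneg h₂ e₉.le, mul_nonneg (mul_nonneg h₁ h₃) e₉.le]
  · have e₀ := P.tr (-1) 0 (by decide); have e₁ := P.tr 0 (-1) (by decide)
    have e₂ := P.tr 0 1 (by decide); have e₃ := P.rot 0 0; have e₄ := P.rot 1 0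
    have e₅ := P.gl₁ (-1) (-1); have e₆ := P.gl₁ (-1) 0; have e₇ := P.gl₂ (-1) 0
    have e₈ := Q.gl₁ 0 0; push_cast [excess] at e₀ e₁ e₂ e₃ e₄ e₅ e₆ e₇ e₈
    linarith only [mul_nonneg (mul_nonneg h₂ h₂) e₀.le, mul_nonneg (mul_nonneg h₂ h₃) e₀.le,
      mul_nonneg (mul_nonneg h₂ h₂) e₁.le, mul_nonneg (mul_nonneg h₂ h₂) e₂.le,
      mul_nonneg h₂ e₃.le, mul_nonneg (mul_nonneg h₁ h₂) e₃.le,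
      mul_nonneg (mul_nonneg h₂ h₂) e₃.le, mul_nonneg (mul_nonneg h₂ h₂) e₄.le,
      mul_nonneg (mul_nonneg h₂ h₃) e₅.le, mul_nonneg h₁ e₆.le, mul_nonneg h₃ e₆.le,
      mul_nonneg (mul_nonneg h₂ h₃) e₇.le, e₈]
  · have e₀ := P.tr (-1) 0 (by decide); have e₁ := Q.gl₁ 0 1; have e₂ := P.rot 0 1
    have e₃ := Q.gl₂ (-1) (-1); have e₄ := Q.gl₁ (-1) 1; have e₅ := Q.tr 0 (-1) (by decide)
    have e₆ := P.tr 0 1 (by decide); push_cast [excess] at e₀ e₁ e₂ e₃ e₄ e₅ e₆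
    linarith only [mul_nonneg h₃ e₀.le, mul_nonneg h₂ e₀.le, mul_nonneg h₁ e₁.le, e₂, e₃,
      mul_nonneg h₂ e₁.le, mul_nonneg h₃ e₄.le, e₁, mul_nonneg h₂ e₅.le, mul_nonneg h₃ e₅.le,
      mul_nonneg h₃ e₆.le]
  · have e₀ := P.rot 0 0; have e₁ := P.gl₁ (-1) (-1); have e₂ := P.gl₁ 0 (-1)
    have e₃ := P.gl₂ (-1) (-1); have e₄ := P.gl₂ 0 (-1); have e₅ := Q.rot 0 (-1)
    have e₆ := Q.gl₁ 0 (-1); have e₇ := Q.gl₂ 0 0; push_cast [excess] at e₀ e₁ e₂ e₃ e₄ e₅ e₆ e₇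
    linarith only [mul_nonneg h₃ e₀.le, mul_nonneg h₂ e₁.le, mul_nonneg h₁ e₂.le,
      mul_nonneg h₂ e₂.le, mul_nonneg h₂ e₃.le, mul_nonneg h₁ e₄.le, mul_nonneg h₂ e₄.le, e₅,
      mul_nonneg h₂ e₅.le, mul_nonneg h₃ e₅.le, mul_nonneg h₁ e₆.le, mul_nonneg h₁ e₇.le]
  · have e₀ := P.rot 0 1; have e₁ := P.gl₁ (-1) 0; have e₂ := P.gl₂ 0 0; have e₃ := Q.rot 0 1
    have e₄ := Q.gl₁ (-1) 1; have e₅ := Q.gl₂ 0 (-1); push_cast [excess] at e₀ e₁ e₂ e₃ e₄ e₅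
    linarith only [mul_nonneg h₃ e₀.le, mul_nonneg h₃ e₁.le, e₂, mul_nonneg h₁ e₂.le,
      mul_nonneg h₂ e₂.le, mul_nonneg h₂ e₃.le, mul_nonneg h₃ e₃.le, mul_nonneg h₂ e₄.le,
      mul_nonneg h₃ e₄.le, e₅, mul_nonneg h₁ e₅.le]
  · have e₀ := P.tr 0 (-1) (by decide); have e₁ := P.tr 1 0 (by decide); have e₂ := Q.rot 1 (-1)
    push_cast [excess] at e₀ e₁ e₂
    linarith only [mul_nonneg h₁ e₀.le, mul_nonneg h₂ e₀.le, mul_nonneg h₁ e₁.le, e₂]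
  · have e₀ := P.tr 0 1 (by decide); have e₁ := P.rot 0 0; have e₂ := P.rot 1 0
    have e₃ := P.gl₁ (-1) 0; have e₄ := P.gl₁ 0 0; have e₅ := P.gl₂ 0 0; have e₆ := Q.rot 1 1
    push_cast [excess] at e₀ e₁ e₂ e₃ e₄ e₅ e₆
    linarith only [mul_nonneg h₃ e₀.le, mul_nonneg h₂ e₁.le, mul_nonneg h₃ e₁.le,
      mul_nonneg h₂ e₂.le, mul_nonneg h₂ e₃.le, mul_nonneg h₃ e₃.le, mul_nonneg h₁ e₄.le,
      mul_nonneg h₂ e₄.le, e₅, mul_nonneg h₁ e₅.le, e₆]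
  · have e₀ := P.tr 0 1 (by decide); have e₁ := Q.rot 2 (-1); have e₂ := P.tr 1 0 (by decide)
    have e₃ := P.tr 0 (-1) (by decide); push_cast [excess] at e₀ e₁ e₂ e₃
    linarith only [mul_nonneg h₁ e₀.le, e₁, mul_nonneg h₁ e₂.le, mul_nonneg h₂ e₃.le,
      mul_nonneg h₁ e₃.le]
  · have e₀ := Q.gl₂ 1 0; have e₁ := P.rot 1 0; have e₂ := P.gl₂ 0 0; have e₃ := P.rot 0 0
    have e₄ := P.gl₁ 0 0; have e₅ := Q.gl₁ (-1) (-1); have e₆ := P.rot 1 1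
    have e₇ := P.gl₁ 0 (-1); have e₈ := P.tr 0 1 (by decide)
    push_cast [excess] at e₀ e₁ e₂ e₃ e₄ e₅ e₆ e₇ e₈
    linarith only [mul_nonneg h₃ e₀.le, mul_nonneg h₁ e₁.le, e₂, mul_nonneg h₂ h₂, e₁,
      mul_nonneg h₃ e₃.le, mul_nonneg h₃ e₄.le, e₅, mul_nonneg h₁ e₆.le, mul_nonneg h₂ e₇.le,
      mul_nonneg h₂ e₁.le, mul_nonneg h₁ e₈.le]
  · have e₀ := Q.gl₁ (-1) 0; have e₁ := Q.gl₁ 0 0; have e₂ := P.rot 1 0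
    have e₃ := P.tr 1 0 (by decide); have e₄ := P.tr 0 1 (by decide)
    push_cast [excess] at e₀ e₁ e₂ e₃ e₄
    linarith only [mul_nonneg h₃ e₀.le, mul_nonneg h₂ e₁.le, e₂, mul_nonneg h₁ e₃.le,
      mul_nonneg h₃ e₄.le, mul_nonneg h₁ e₀.le, e₀, mul_nonneg h₁ e₄.le]
  · have e₀ := Q.gl₂ 1 (-1); have e₁ := P.tr 0 1 (by decide); have e₂ := P.rot 1 1
    have e₃ := P.tr 1 0 (by decide); have e₄ := P.tr (-1) 0 (by decide); have e₅ := P.rot 0 0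
    have e₆ := Q.gl₂ 2 0; have e₇ := P.gl₁ 0 0; push_cast [excess] at e₀ e₁ e₂ e₃ e₄ e₅ e₆ e₇
    linarith only [mul_nonneg h₂ e₀.le, mul_nonneg h₁ e₁.le, mul_nonneg h₁ e₂.le,
      mul_nonneg h₁ e₃.le, e₃, mul_nonneg h₂ e₂.le, mul_nonneg h₃ e₁.le, mul_nonneg h₃ e₄.le,
      mul_nonneg h₂ e₃.le, mul_nonneg h₃ e₅.le, mul_nonneg h₂ e₄.le, e₀, mul_nonneg h₁ e₆.le, e₇,
      mul_nonneg h₃ e₆.le]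

theorem near_near_rotate_inv {w₁ w₂ x y : ℝ} (h₁ : 0 ≤ y) (h₂ : 0 ≤ x - y) (h₃ : 0 ≤ 1 / 4 - x)
    {a b : ℤ} (P : Near w₁ w₂ x y) (Q : Near w₁ w₂ (-y + a / 2) (x + b / 2)) :
    (a, b) ∈ ([(0, 0), (1, -1), (0, -1), (1, 0)] : List (ℤ × ℤ)) := by
  obtain ⟨k₁, k₂, k₃, k₄⟩ := P.displacement_lt Q
  have l₁ : -2 < a := by
    have : (-2 : ℝ) < a := by linarith
    exact_mod_cast this
  have l₂ : a < 3 := by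
    have : (a : ℝ) < 3 := by linarith
    exact_mod_cast this
  have m₁ : -3 < b := by
    have : (-3 : ℝ) < b := by linarith
    exact_mod_cast this
  have m₂ : b < 2 := by
    have : (b : ℝ) < 2 := by linarith
    exact_mod_cast this
  clear k₁ k₂ k₃ k₄
  interval_cases a <;> interval_cases b <;> first | decide | (exfalso; push_cast at Q)
  · have e₀ := P.tr (-1) 0 (by decide); have e₁ := P.tr 0 (-1) (by decide); have e₂ := P.rot 0 0
    have e₃ := P.rot 0 1; have e₄ := P.rot 1 0; have e₅ := Q.tr (-1) 0 (by decide)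
    have e₆ := Q.gl₂ (-1) 0; push_cast [excess] at e₀ e₁ e₂ e₃ e₄ e₅ e₆
    linarith only [e₀, mul_nonneg h₁ e₀.le, mul_nonneg h₃ e₀.le, e₁, mul_nonneg h₂ e₁.le,
      mul_nonneg h₃ e₁.le, e₂, mul_nonneg h₂ e₂.le, mul_nonneg h₃ e₂.le, mul_nonneg h₁ e₃.le,
      mul_nonneg h₂ e₄.le, mul_nonneg h₁ e₅.le, e₆]
  · have e₀ := P.tr (-1) 0 (by decide); have e₁ := P.tr 0 1 (by decide); have e₂ := P.rot 0 0
    have e₃ := P.rot 1 0; have e₄ := P.gl₁ (-1) (-1); have e₅ := P.gl₁ (-1) 0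
    have e₆ := P.gl₁ 0 (-1); have e₇ := P.gl₂ (-1) (-1); have e₈ := Q.gl₁ 0 (-1)
    have e₉ := Q.gl₂ (-1) 0; push_cast [excess] at e₀ e₁ e₂ e₃ e₄ e₅ e₆ e₇ e₈ e₉
    linarith only [mul_nonneg h₂ e₀.le, mul_nonneg h₁ e₁.le, e₂, mul_nonneg h₁ e₂.le,
      mul_nonneg h₂ e₂.le, mul_nonneg h₂ e₃.le, mul_nonneg h₂ e₄.le, mul_nonneg h₃ e₄.le,
      mul_nonneg h₁ e₅.le, mul_nonneg h₂ e₆.le, mul_nonneg h₃ e₇.le, e₈, e₉]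
  · have e₀ := P.rot 0 0; have e₁ := P.gl₁ (-1) 0; have e₂ := P.gl₂ (-1) 0
    have e₃ := Q.rot (-1) 0; have e₄ := Q.gl₁ 0 0; have e₅ := Q.gl₂ (-1) 0
    push_cast [excess] at e₀ e₁ e₂ e₃ e₄ e₅
    linarith only [e₀, mul_nonneg h₂ e₀.le, mul_nonneg h₃ e₀.le, mul_nonneg h₁ e₁.le,
      mul_nonneg h₁ e₂.le, e₃, mul_nonneg h₃ e₃.le, mul_nonneg h₁ e₄.le, mul_nonneg h₂ e₄.le,
      mul_nonneg h₁ e₅.le, mul_nonneg h₂ e₅.le]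
  · have e₀ := P.tr 0 1 (by decide); have e₁ := P.tr 1 0 (by decide); have e₂ := P.rot 0 0
    have e₃ := P.rot 0 1; have e₄ := P.rot 1 0; have e₅ := P.gl₁ (-1) 0
    have e₆ := Q.gl₂ (-1) (-1); push_cast [excess] at e₀ e₁ e₂ e₃ e₄ e₅ e₆
    linarith only [mul_nonneg h₁ e₀.le, mul_nonneg h₂ e₁.le, e₂, mul_nonneg h₂ e₂.le,
      mul_nonneg h₃ e₂.le, mul_nonneg h₁ e₃.le, mul_nonneg h₂ e₄.le, e₅, e₆]
  · have e₀ := P.tr (-1) 0 (by decide); have e₁ := P.tr 0 (-1) (by decide)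
    have e₂ := Q.rot 0 (-1); push_cast [excess] at e₀ e₁ e₂
    linarith only [mul_nonneg h₁ e₀.le, e₁, mul_nonneg h₃ e₁.le, e₂]
  · have e₀ := P.tr 0 (-1) (by decide); have e₁ := P.tr 0 1 (by decide); have e₂ := P.rot 0 0
    have e₃ := P.rot 0 1; have e₄ := P.gl₁ (-1) 0; have e₅ := P.gl₂ 0 0; have e₆ := Q.rot 0 1
    push_cast [excess] at e₀ e₁ e₂ e₃ e₄ e₅ e₆
    linarith only [mul_nonneg (mul_nonneg h₂ h₂) e₀.le, mul_nonneg h₂ e₁.le,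
      mul_nonneg (mul_nonneg h₁ h₂) e₁.le, mul_nonneg (mul_nonneg h₂ h₃) e₁.le,
      mul_nonneg (mul_nonneg h₁ h₂) e₂.le, mul_nonneg (mul_nonneg h₂ h₃) e₂.le,
      mul_nonneg (mul_nonneg h₁ h₁) e₃.le, mul_nonneg (mul_nonneg h₁ h₂) e₃.le,
      mul_nonneg h₁ e₄.le, mul_nonneg (mul_nonneg h₁ h₃) e₄.le,
      mul_nonneg (mul_nonneg h₂ h₃) e₄.le, mul_nonneg h₂ e₅.le,
      mul_nonneg (mul_nonneg h₁ h₁) e₅.le, mul_nonneg (mul_nonneg h₂ h₂) e₅.le, e₆,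
      mul_nonneg (mul_nonneg h₂ h₃) e₆.le, mul_nonneg (mul_nonneg h₃ h₃) e₆.le]
  · have e₀ := P.gl₂ 0 (-1); have e₁ := Q.tr (-1) 0 (by decide); have e₂ := Q.rot 1 (-1)
    have e₃ := Q.tr 0 1 (by decide); have e₄ := P.gl₂ 0 0; push_cast [excess] at e₀ e₁ e₂ e₃ e₄
    linarith only [mul_nonneg h₁ e₀.le, mul_nonneg h₃ e₀.le, mul_nonneg h₁ e₁.le,
      mul_nonneg h₃ e₁.le, e₂, mul_nonneg h₁ e₃.le, mul_nonneg h₂ e₄.le, e₀]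
  · have e₀ := P.tr 1 0 (by decide); have e₁ := P.rot 0 0; have e₂ := P.rot 1 0
    have e₃ := P.gl₁ 0 (-1); have e₄ := P.gl₁ 0 0; have e₅ := P.gl₂ 0 0; have e₆ := Q.rot 1 1
    have e₇ := Q.gl₂ 0 (-1); push_cast [excess] at e₀ e₁ e₂ e₃ e₄ e₅ e₆ e₇
    linarith only [mul_nonneg (mul_nonneg h₂ h₂) e₀.le, mul_nonneg (mul_nonneg h₂ h₃) e₀.le,
      mul_nonneg (mul_nonneg h₂ h₃) e₁.le, mul_nonneg (mul_nonneg h₂ h₂) e₂.le,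
      mul_nonneg (mul_nonneg h₂ h₃) e₂.le, mul_nonneg (mul_nonneg h₂ h₃) e₃.le,
      mul_nonneg h₂ e₄.le, mul_nonneg (mul_nonneg h₁ h₂) e₄.le,
      mul_nonneg (mul_nonneg h₂ h₂) e₄.le, e₅, mul_nonneg (mul_nonneg h₁ h₂) e₅.le,
      mul_nonneg h₂ e₆.le, e₇]
  · have e₀ := Q.tr 0 1 (by decide); have e₁ := P.gl₂ 0 (-1); have e₂ := Q.tr (-1) 0 (by decide)
    have e₃ := P.gl₂ 0 0; have e₄ := Q.rot 2 (-1); have e₅ := Q.tr 0 (-1) (by decide)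
    have e₆ := P.gl₂ (-1) 0; push_cast [excess] at e₀ e₁ e₂ e₃ e₄ e₅ e₆
    linarith only [mul_nonneg h₁ e₀.le, mul_nonneg h₁ e₁.le, mul_nonneg h₁ e₂.le,
      mul_nonneg h₂ e₃.le, e₁, mul_nonneg h₃ e₁.le, e₄, mul_nonneg h₃ e₂.le, mul_nonneg h₃ e₅.le,
      mul_nonneg h₃ e₆.le]
  · have e₀ := P.rot 1 0; have e₁ := P.gl₁ 0 0; have e₂ := P.gl₂ 0 (-1); have e₃ := Q.rot 1 (-1)
    have e₄ := Q.gl₁ (-1) (-1); have e₅ := Q.gl₂ 1 (-1); push_cast [excess] at e₀ e₁ e₂ e₃ e₄ e₅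
    linarith only [mul_nonneg h₂ e₀.le, mul_nonneg h₃ e₀.le, e₁, mul_nonneg h₁ e₁.le,
      mul_nonneg h₂ e₂.le, mul_nonneg h₃ e₂.le, mul_nonneg h₃ e₃.le, e₄, mul_nonneg h₁ e₄.le,
      mul_nonneg h₂ e₄.le, mul_nonneg h₃ e₅.le]
  · have e₀ := P.rot 1 0; have e₁ := P.gl₁ 0 0; have e₂ := P.gl₂ 0 (-1); have e₃ := Q.rot 1 0
    have e₄ := Q.gl₁ (-1) 0; have e₅ := Q.gl₂ 1 (-1); push_cast [excess] at e₀ e₁ e₂ e₃ e₄ e₅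
    linarith only [mul_nonneg h₂ e₀.le, mul_nonneg h₃ e₀.le, e₁, mul_nonneg h₁ e₁.le,
      mul_nonneg h₂ e₂.le, mul_nonneg h₃ e₂.le, mul_nonneg h₃ e₃.le, e₄, mul_nonneg h₁ e₄.le,
      mul_nonneg h₂ e₄.le, mul_nonneg h₃ e₅.le]
  · have e₀ := P.gl₁ 0 0; have e₁ := Q.rot 2 1; have e₂ := Q.tr (-1) 0 (by decide)
    have e₃ := Q.gl₁ (-1) 1; have e₄ := Q.rot 2 2; have e₅ := Q.rot 1 1
    have e₆ := Q.tr 0 (-1) (by decide); have e₇ := P.gl₂ 0 0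
    push_cast [excess] at e₀ e₁ e₂ e₃ e₄ e₅ e₆ e₇
    linarith only [mul_nonneg h₃ e₀.le, e₀, mul_nonneg h₃ e₁.le, mul_nonneg h₃ e₂.le,
      mul_nonneg h₁ e₃.le, mul_nonneg h₂ e₄.le, e₅, mul_nonneg h₁ e₅.le, mul_nonneg h₂ e₆.le,
      mul_nonneg h₃ e₆.le, e₇]

theorem near_near_swap {w₁ w₂ x y : ℝ} (h₁ : 0 ≤ y) (h₂ : 0 ≤ x - y) (h₃ : 0 ≤ 1 / 4 - x)
    {a b : ℤ} (P : Near w₁ w₂ x y) (Q : Near w₁ w₂ (y + a / 2) (x + b / 2)) :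
    (a, b) ∈ ([(1, -1), (0, 0), (1, 0), (-1, 0), (0, 1), (0, -1)] : List (ℤ × ℤ)) := by
  obtain ⟨k₁, k₂, k₃, k₄⟩ := P.displacement_lt Q
  have l₁ : -2 < a := by
    have : (-2 : ℝ) < a := by linarith
    exact_mod_cast this
  have l₂ : a < 3 := by
    have : (a : ℝ) < 3 := by linarith
    exact_mod_cast this
  have m₁ : -3 < b := by
    have : (-3 : ℝ) < b := by linarith
    exact_mod_cast this
  have m₂ : b < 2 := by
    have : (b : ℝ) < 2 := by linarith
    exact_mod_cast this
  clear k₁ k₂ k₃ k₄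
  interval_cases a <;> interval_cases b <;> first | decide | (exfalso; push_cast at Q)
  · have e₀ := Q.gl₁ 0 (-2); have e₁ := P.tr 0 (-1) (by decide); have e₂ := P.gl₂ 0 (-1)
    have e₃ := P.tr (-1) 0 (by decide); have e₄ := P.gl₁ (-1) (-1)
    have e₅ := Q.tr 0 1 (by decide); have e₆ := Q.gl₂ (-2) 0
    push_cast [excess] at e₀ e₁ e₂ e₃ e₄ e₅ e₆
    linarith only [e₀, mul_nonneg h₁ e₁.le, mul_nonneg h₁ e₂.le, e₂, mul_nonneg h₂ e₃.le,
      mul_nonneg h₃ e₄.le, mul_nonneg h₁ e₀.le, e₅, mul_nonneg h₁ e₅.le, mul_nonneg h₁ e₃.le,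
      mul_nonneg h₃ e₆.le]
  · have e₀ := P.rot 0 0; have e₁ := P.gl₁ (-1) (-1); have e₂ := P.gl₂ (-1) (-1)
    have e₃ := Q.gl₁ 0 (-1); have e₄ := Q.gl₂ (-1) 0; push_cast [excess] at e₀ e₁ e₂ e₃ e₄
    linarith only [mul_nonneg h₁ e₀.le, mul_nonneg h₂ e₀.le, mul_nonneg h₂ e₁.le,
      mul_nonneg h₃ e₁.le, mul_nonneg h₂ e₂.le, mul_nonneg h₃ e₂.le, e₃, e₄]
  · have e₀ := P.tr 0 1 (by decide); have e₁ := P.gl₁ (-1) 0; have e₂ := P.gl₂ 0 0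
    have e₃ := Q.tr 0 (-1) (by decide); have e₄ := Q.gl₁ 0 1; have e₅ := Q.gl₂ (-1) (-1)
    push_cast [excess] at e₀ e₁ e₂ e₃ e₄ e₅
    linarith only [mul_nonneg h₂ e₀.le, e₁, mul_nonneg h₃ e₁.le, mul_nonneg h₁ e₂.le,
      mul_nonneg h₂ e₃.le, mul_nonneg h₁ e₄.le, e₅, mul_nonneg h₃ e₅.le]
  · have e₀ := P.gl₁ (-1) (-1); have e₁ := P.gl₂ 0 (-1); have e₂ := Q.tr 0 1 (by decide)
    have e₃ := Q.gl₂ (-1) 0; have e₄ := Q.gl₁ 0 (-2); have e₅ := P.tr (-1) 0 (by decide)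
    push_cast [excess] at e₀ e₁ e₂ e₃ e₄ e₅
    linarith only [mul_nonneg h₃ e₀.le, e₁, e₂, mul_nonneg h₁ e₂.le, mul_nonneg h₃ e₃.le,
      mul_nonneg h₁ e₄.le, mul_nonneg h₁ e₁.le, mul_nonneg h₁ e₅.le]
  · have e₀ := P.tr 0 1 (by decide); have e₁ := P.rot 0 0; have e₂ := P.rot 1 1
    have e₃ := P.gl₁ (-1) (-1); have e₄ := P.gl₁ 0 (-1); have e₅ := P.gl₂ (-1) (-1)
    have e₆ := P.gl₂ 0 (-1); have e₇ := P.gl₂ 0 0; have e₈ := Q.tr (-1) 0 (by decide)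
    have e₉ := Q.tr 0 1 (by decide); have e10 := Q.rot 1 (-1)
    push_cast [excess] at e₀ e₁ e₂ e₃ e₄ e₅ e₆ e₇ e₈ e₉ e10
    linarith only [mul_nonneg h₁ e₀.le, mul_nonneg h₂ e₁.le, mul_nonneg h₃ e₁.le,
      mul_nonneg h₁ e₂.le, mul_nonneg h₃ e₃.le, mul_nonneg h₂ e₄.le, mul_nonneg h₃ e₅.le, e₆,
      mul_nonneg h₂ e₆.le, mul_nonneg h₁ e₇.le, mul_nonneg h₃ e₈.le, e₉, mul_nonneg h₂ e₉.le,
      mul_nonneg h₃ e₉.le, e10]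
  · have e₀ := P.rot 0 0; have e₁ := P.gl₁ 0 0; have e₂ := P.gl₂ 0 0; have e₃ := Q.rot 1 1
    push_cast [excess] at e₀ e₁ e₂ e₃
    linarith only [mul_nonneg h₂ e₀.le, mul_nonneg h₃ e₀.le, mul_nonneg h₁ e₁.le,
      mul_nonneg h₂ e₁.le, mul_nonneg h₁ e₂.le, mul_nonneg h₂ e₂.le, e₃]
  · have e₀ := Q.gl₂ 2 0; have e₁ := Q.gl₂ 2 (-1); have e₂ := Q.gl₂ 1 0
    have e₃ := P.tr 0 1 (by decide); have e₄ := P.gl₂ 0 (-1); have e₅ := P.tr 1 0 (by decide)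
    have e₆ := Q.tr 0 1 (by decide); have e₇ := Q.tr 0 (-1) (by decide)
    push_cast [excess] at e₀ e₁ e₂ e₃ e₄ e₅ e₆ e₇
    linarith only [mul_nonneg h₂ e₀.le, mul_nonneg h₁ e₁.le, mul_nonneg h₂ h₃, e₂,
      mul_nonneg h₃ e₃.le, e₄, mul_nonneg h₁ e₅.le, mul_nonneg h₁ e₆.le, mul_nonneg h₃ e₂.le,
      mul_nonneg h₃ e₇.le]
  · have e₀ := P.tr 0 (-1) (by decide); have e₁ := P.tr 0 1 (by decide)
    have e₂ := P.tr 1 0 (by decide); have e₃ := P.rot 0 0; have e₄ := P.rot 1 0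
    have e₅ := P.rot 1 1; have e₆ := Q.gl₁ (-1) (-1); push_cast [excess] at e₀ e₁ e₂ e₃ e₄ e₅ e₆
    linarith only [mul_nonneg h₃ e₀.le, mul_nonneg h₁ e₁.le, mul_nonneg h₂ e₂.le,
      mul_nonneg h₂ e₃.le, mul_nonneg h₃ e₃.le, e₄, mul_nonneg h₁ e₄.le, mul_nonneg h₂ e₄.le,
      mul_nonneg h₁ e₅.le, e₆]
  · have e₀ := P.gl₁ 0 0; have e₁ := Q.rot 2 0; have e₂ := P.tr 1 0 (by decide)
    have e₃ := Q.gl₁ (-1) 0; have e₄ := Q.gl₂ 1 (-1); have e₅ := P.gl₁ 0 (-1)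
    have e₆ := P.tr 0 1 (by decide); push_cast [excess] at e₀ e₁ e₂ e₃ e₄ e₅ e₆
    linarith only [e₀, mul_nonneg h₁ e₁.le, mul_nonneg h₂ e₂.le, mul_nonneg h₁ e₂.le, e₃,
      mul_nonneg h₃ e₄.le, mul_nonneg h₃ e₅.le, mul_nonneg h₂ e₄.le, mul_nonneg h₁ e₆.le]
  · have e₀ := P.gl₂ 0 0; have e₁ := P.rot 1 1; have e₂ := Q.tr 0 (-1) (by decide)
    have e₃ := P.tr (-1) 0 (by decide); have e₄ := P.tr 0 1 (by decide); have e₅ := Q.gl₂ 1 (-1)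
    have e₆ := P.tr 1 0 (by decide); have e₇ := P.rot 0 0; have e₈ := P.rot 1 0
    push_cast [excess] at e₀ e₁ e₂ e₃ e₄ e₅ e₆ e₇ e₈
    linarith only [e₀, mul_nonneg h₂ e₁.le, mul_nonneg h₂ e₂.le, mul_nonneg h₃ e₃.le,
      mul_nonneg h₁ e₁.le, mul_nonneg h₃ e₄.le, mul_nonneg h₃ e₅.le, mul_nonneg h₂ e₅.le,
      mul_nonneg h₁ e₆.le, mul_nonneg h₁ e₅.le, mul_nonneg h₃ e₇.le, mul_nonneg h₃ e₈.le,
      mul_nonneg h₂ e₆.le, e₃]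

theorem near_near_neg_swap {w₁ w₂ x y : ℝ} (h₁ : 0 ≤ y) (h₂ : 0 ≤ x - y) (h₃ : 0 ≤ 1 / 4 - x)
    {a b : ℤ} (P : Near w₁ w₂ x y) (Q : Near w₁ w₂ (-y + a / 2) (-x + b / 2)) :
    (a, b) ∈ ([(1, 1), (0, 0), (1, 0), (0, 1)] : List (ℤ × ℤ)) := by
  obtain ⟨k₁, k₂, k₃, k₄⟩ := P.displacement_lt Q
  have l₁ : -2 < a := by
    have : (-2 : ℝ) < a := by linarith
    exact_mod_cast this
  have l₂ : a < 3 := by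
    have : (a : ℝ) < 3 := by linarith
    exact_mod_cast this
  have m₁ : -2 < b := by
    have : (-2 : ℝ) < b := by linarith
    exact_mod_cast this
  have m₂ : b < 3 := by
    have : (b : ℝ) < 3 := by linarith
    exact_mod_cast this
  clear k₁ k₂ k₃ k₄
  interval_cases a <;> interval_cases b <;> first | decide | (exfalso; push_cast at Q)
  · have e₀ := P.tr 0 (-1) (by decide); have e₁ := Q.gl₁ 0 (-2); have e₂ := Q.gl₂ (-1) 0
    have e₃ := P.rot 0 0; have e₄ := Q.gl₂ (-2) 0; have e₅ := P.gl₂ (-1) (-1)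
    have e₆ := Q.rot (-1) (-1); have e₇ := Q.gl₂ (-1) (-1); have e₈ := Q.gl₁ (-1) (-2)
    have e₉ := Q.tr (-1) 0 (by decide); push_cast [excess] at e₀ e₁ e₂ e₃ e₄ e₅ e₆ e₇ e₈ e₉
    linarith only [mul_nonneg h₁ e₀.le, mul_nonneg h₂ e₁.le, e₂, mul_nonneg h₃ e₃.le,
      mul_nonneg h₁ e₄.le, mul_nonneg h₂ e₅.le, mul_nonneg h₃ e₆.le, mul_nonneg h₂ e₇.le,
      mul_nonneg h₁ e₈.le, mul_nonneg h₁ e₉.le, e₆, e₅]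
  · have e₀ := Q.gl₁ 0 (-1); have e₁ := P.rot 0 0; have e₂ := Q.rot (-1) 0
    have e₃ := Q.rot (-2) 0; have e₄ := Q.gl₂ (-1) (-1); have e₅ := P.tr 1 0 (by decide)
    push_cast [excess] at e₀ e₁ e₂ e₃ e₄ e₅
    linarith only [mul_nonneg h₁ h₃, mul_nonneg h₂ e₀.le, e₁, e₂, mul_nonneg h₁ e₃.le,
      mul_nonneg h₂ e₄.le, mul_nonneg h₁ h₁, mul_nonneg h₃ e₂.le, mul_nonneg h₁ e₂.le,
      mul_nonneg h₁ e₅.le]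
  · have e₀ := P.tr 0 1 (by decide); have e₁ := P.rot 0 0; have e₂ := P.rot 1 0
    have e₃ := P.gl₁ (-1) (-1); have e₄ := P.gl₁ (-1) 0; have e₅ := Q.tr 1 0 (by decide)
    have e₆ := Q.gl₁ 0 0; push_cast [excess] at e₀ e₁ e₂ e₃ e₄ e₅ e₆
    linarith only [mul_nonneg h₁ e₀.le, e₁, mul_nonneg h₂ e₁.le, mul_nonneg h₃ e₁.le,
      mul_nonneg h₁ e₂.le, mul_nonneg h₂ e₃.le, e₄, mul_nonneg h₁ e₄.le, mul_nonneg h₃ e₄.le,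
      mul_nonneg h₂ e₅.le, e₆]
  · have e₀ := Q.gl₂ (-1) (-1); have e₁ := P.rot 0 0; have e₂ := Q.gl₂ (-2) (-1)
    have e₃ := Q.tr (-1) 0 (by decide); have e₄ := P.rot 0 1; have e₅ := P.tr (-1) 0 (by decide)
    have e₆ := Q.rot (-1) 2; have e₇ := Q.gl₁ 0 1; have e₈ := Q.rot (-1) 1
    push_cast [excess] at e₀ e₁ e₂ e₃ e₄ e₅ e₆ e₇ e₈
    linarith only [mul_nonneg h₂ e₀.le, mul_nonneg h₃ e₁.le, e₂, mul_nonneg h₁ e₃.le,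
      mul_nonneg h₁ e₄.le, mul_nonneg h₃ e₄.le, mul_nonneg h₃ e₅.le, mul_nonneg h₃ e₆.le, e₄,
      mul_nonneg h₁ h₁, e₇, mul_nonneg h₂ e₁.le, mul_nonneg h₁ e₈.le, mul_nonneg h₂ e₇.le,
      mul_nonneg h₂ e₅.le]
  · have e₀ := P.tr 0 (-1) (by decide); have e₁ := P.rot 0 0; have e₂ := P.gl₁ (-1) 0
    have e₃ := P.gl₁ 0 (-1); have e₄ := P.gl₂ (-1) 0; have e₅ := P.gl₂ 0 (-1)
    have e₆ := Q.rot 0 (-1); push_cast [excess] at e₀ e₁ e₂ e₃ e₄ e₅ e₆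
    linarith only [mul_nonneg h₁ e₀.le, mul_nonneg h₂ e₀.le, e₁, mul_nonneg h₁ e₁.le,
      mul_nonneg h₃ e₁.le, mul_nonneg h₁ e₂.le, mul_nonneg h₁ e₃.le, mul_nonneg h₂ e₃.le,
      mul_nonneg h₁ e₄.le, mul_nonneg h₂ e₅.le, e₆]
  · have e₀ := P.rot 0 0; have e₁ := P.rot 0 1; have e₂ := P.rot 1 0; have e₃ := P.gl₁ (-1) 0
    have e₄ := P.gl₁ 0 0; have e₅ := P.gl₂ 0 0; have e₆ := Q.rot 0 1
    push_cast [excess] at e₀ e₁ e₂ e₃ e₄ e₅ e₆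
    linarith only [mul_nonneg h₂ e₀.le, mul_nonneg h₃ e₁.le, mul_nonneg h₂ e₂.le, e₃,
      mul_nonneg h₁ e₃.le, mul_nonneg h₃ e₃.le, mul_nonneg h₂ e₄.le, e₅, mul_nonneg h₁ e₅.le, e₆]
  · have e₀ := P.tr 1 0 (by decide); have e₁ := P.rot 0 0; have e₂ := P.rot 1 0
    have e₃ := P.gl₁ 0 (-1); have e₄ := P.gl₂ 0 (-1); have e₅ := P.gl₂ 0 0
    have e₆ := Q.tr (-1) 0 (by decide); have e₇ := Q.tr 0 1 (by decide); have e₈ := Q.rot 0 (-1)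
    have e₉ := Q.rot 1 (-1); have e10 := Q.gl₂ 0 0; have e11 := Q.gl₂ 1 0
    push_cast [excess] at e₀ e₁ e₂ e₃ e₄ e₅ e₆ e₇ e₈ e₉ e10 e11
    linarith only [mul_nonneg h₂ e₀.le, mul_nonneg h₁ e₁.le, mul_nonneg h₃ e₁.le,
      mul_nonneg h₂ e₂.le, e₃, mul_nonneg h₂ e₃.le, mul_nonneg h₃ e₃.le, mul_nonneg h₂ e₄.le,
      mul_nonneg h₃ e₄.le, mul_nonneg h₁ e₅.le, mul_nonneg h₁ e₆.le, mul_nonneg h₁ e₇.le,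
      mul_nonneg h₁ e₈.le, e₉, e10, mul_nonneg h₂ e11.le]
  · have e₀ := P.rot 1 1; have e₁ := P.gl₁ 0 0; have e₂ := P.gl₂ 0 0; have e₃ := Q.rot 0 1
    have e₄ := Q.rot 1 1; have e₅ := Q.gl₁ (-1) 1; have e₆ := Q.gl₁ 0 1; have e₇ := Q.gl₂ 0 (-1)
    push_cast [excess] at e₀ e₁ e₂ e₃ e₄ e₅ e₆ e₇
    linarith only [mul_nonneg h₃ e₀.le, mul_nonneg h₃ e₁.le, e₂, mul_nonneg h₁ e₂.le,
      mul_nonneg h₂ e₂.le, mul_nonneg h₃ e₃.le, mul_nonneg h₂ e₄.le, mul_nonneg h₃ e₅.le,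
      mul_nonneg h₂ e₆.le, e₇, mul_nonneg h₁ e₇.le]
  · have e₀ := P.tr 0 (-1) (by decide); have e₁ := P.tr 1 0 (by decide); have e₂ := P.rot 0 0
    have e₃ := P.rot 0 1; have e₄ := P.rot 1 0; have e₅ := Q.gl₂ 1 0
    push_cast [excess] at e₀ e₁ e₂ e₃ e₄ e₅
    linarith only [e₀, mul_nonneg h₂ e₀.le, mul_nonneg h₃ e₀.le, mul_nonneg h₂ e₁.le, e₂,
      mul_nonneg h₃ e₂.le, mul_nonneg h₁ e₃.le, e₄, mul_nonneg h₂ e₄.le, e₅]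
  · have e₀ := P.tr 1 0 (by decide); have e₁ := P.rot 1 0; have e₂ := P.gl₁ 0 0
    have e₃ := P.gl₂ 0 (-1); have e₄ := Q.rot 1 0; have e₅ := Q.gl₁ (-1) (-1)
    have e₆ := Q.gl₂ 1 0; push_cast [excess] at e₀ e₁ e₂ e₃ e₄ e₅ e₆
    linarith only [mul_nonneg h₂ e₀.le, e₁, mul_nonneg h₂ e₁.le, mul_nonneg h₃ e₁.le, e₂,
      mul_nonneg h₁ e₂.le, mul_nonneg h₂ e₃.le, mul_nonneg h₃ e₃.le, mul_nonneg h₃ e₄.le, e₅,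
      mul_nonneg h₁ e₅.le, mul_nonneg h₂ e₅.le, e₆]
  · have e₀ := P.rot 1 0; have e₁ := P.gl₁ 0 0; have e₂ := P.gl₂ 0 (-1); have e₃ := P.gl₂ 0 0
    have e₄ := Q.rot 1 0; have e₅ := Q.rot 1 1; have e₆ := Q.gl₁ (-1) 0
    push_cast [excess] at e₀ e₁ e₂ e₃ e₄ e₅ e₆
    linarith only [mul_nonneg h₂ e₀.le, mul_nonneg h₃ e₀.le, e₁, mul_nonneg h₁ e₁.le,
      mul_nonneg h₂ e₂.le, mul_nonneg h₃ e₃.le, mul_nonneg h₃ e₄.le, mul_nonneg h₃ e₅.le,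
      mul_nonneg h₁ e₆.le, mul_nonneg h₂ e₆.le]
  · have e₀ := P.tr 0 (-1) (by decide); have e₁ := P.tr 0 1 (by decide)
    have e₂ := P.tr 1 0 (by decide); have e₃ := P.rot 1 1; have e₄ := P.gl₁ (-1) (-1)
    have e₅ := P.gl₁ 0 0; have e₆ := P.gl₂ (-1) (-1); have e₇ := P.gl₂ 0 0
    have e₈ := Q.gl₁ (-1) 1; have e₉ := Q.gl₂ 1 (-1)
    push_cast [excess] at e₀ e₁ e₂ e₃ e₄ e₅ e₆ e₇ e₈ e₉
    linarith only [mul_nonneg h₃ e₀.le, mul_nonneg h₃ e₁.le, mul_nonneg h₂ e₂.le,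
      mul_nonneg h₃ e₂.le, mul_nonneg h₁ e₃.le, mul_nonneg h₂ e₃.le, mul_nonneg h₂ e₄.le,
      mul_nonneg h₁ e₅.le, mul_nonneg h₃ e₆.le, e₇, mul_nonneg h₁ e₈.le, e₉]

/-! ### Planar inequalities: which Dirichlet domains of one orbit share an edge. -/

/-- The bisector of p and a lattice translate misses the Dirichlet domain of p, since bisectors with
half-turn and glide images, together with those of other translates, cut it off. Here w is a point
equidistant from p and the translate and farther from all other images. -/
theorem not_adjacent_translate {w₁ w₂ x y : ℝ} (h₁ : 0 ≤ y) (h₂ : 0 ≤ x - y) (h₃ : 0 ≤ 1 / 4 - x)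
    {a b : ℤ} (hab : a ≠ 0 ∨ b ≠ 0)
    (E : excess w₁ w₂ x y (x + a) (y + b) = 0)
    (T : ∀ c d : ℤ, (c ≠ 0 ∨ d ≠ 0) → (c ≠ a ∨ d ≠ b) → 0 < excess w₁ w₂ x y (x + c) (y + d))
    (R : ∀ c d : ℤ, 0 < excess w₁ w₂ x y (-x + c) (-y + d))
    (G : ∀ c d : ℤ, 0 < excess w₁ w₂ x y (x + 1 / 2 + c) (-y + 1 / 2 + d))
    (K : ∀ c d : ℤ, 0 < excess w₁ w₂ x y (-x + 1 / 2 + c) (y + 1 / 2 + d)) :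
    False := by
  have f := E.ge
  -- The equality is kept as two inequalities, so that it can be multiplied by nonnegative factors
  -- with either sign.
  have g := (neg_eq_zero.2 E).ge
  -- If q - p is not a unit vector, then for every unit vector e both p + e and q - e differ from p
  -- and from q. The argument of `Near.displacement_lt` then gives |a|, |b| < 1, which is
  -- impossible.
  have hab' : (a = -1 ∧ b = 0) ∨ (a = 1 ∧ b = 0) ∨ (a = 0 ∧ b = -1) ∨ (a = 0 ∧ b = 1) := by
    by_contra! hc
    have k₁ := T 1 0 (by decide) (by omega); have k₂ := T (a - 1) b (by omega) (by omega)
    have k₃ := T (-1) 0 (by decide) (by omega); have k₄ := T (a + 1) b (by omega) (by omega)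
    have k₅ := T 0 1 (by decide) (by omega); have k₆ := T a (b - 1) (by omega) (by omega)
    have k₇ := T 0 (-1) (by decide) (by omega); have k₈ := T a (b + 1) (by omega) (by omega)
    push_cast [excess] at f g k₁ k₂ k₃ k₄ k₅ k₆ k₇ k₈
    have l₁ : a < 1 := by
      have : (a : ℝ) < 1 := by linarith
      exact_mod_cast this
    have l₂ : -1 < a := by
      have : (-1 : ℝ) < a := by linarith
      exact_mod_cast this
    have l₃ : b < 1 := by
      have : (b : ℝ) < 1 := by linarith
      exact_mod_cast this
    have l₄ : -1 < b := by
      have : (-1 : ℝ) < b := by linarith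
      exact_mod_cast this
    omega
  rcases hab' with ⟨rfl, rfl⟩ | ⟨rfl, rfl⟩ | ⟨rfl, rfl⟩ | ⟨rfl, rfl⟩
  · have e₀ := T 0 1 (by decide) (by decide); have e₁ := R 0 0; have e₂ := G (-1) (-1);
      have e₃ := G (-1) 0; have e₄ := K 0 (-1)
    push_cast [excess] at e₀ e₁ e₂ e₃ e₄ f g
    linarith only [mul_nonneg h₁ e₀.le, e₁, mul_nonneg h₁ e₁.le, mul_nonneg h₃ e₁.le,
      mul_nonneg h₂ e₂.le, mul_nonneg h₃ e₂.le, e₃, mul_nonneg h₁ e₃.le, mul_nonneg h₂ e₃.le,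
      mul_nonneg h₂ e₄.le, g, mul_nonneg h₁ g, mul_nonneg h₂ g]
  · have e₀ := T 0 (-1) (by decide) (by decide); have e₁ := R 0 0; have e₂ := R 1 0;
      have e₃ := R 1 1; have e₄ := G 0 0; have e₅ := K 0 0
    push_cast [excess] at e₀ e₁ e₂ e₃ e₄ e₅ f g
    linarith only [mul_nonneg h₂ e₀.le, mul_nonneg h₃ e₁.le, e₂, mul_nonneg h₂ e₂.le,
      mul_nonneg h₃ e₂.le, mul_nonneg h₁ e₃.le, mul_nonneg h₂ e₃.le, mul_nonneg h₁ e₄.le,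
      mul_nonneg h₁ e₅.le, g, mul_nonneg h₃ g]
  · have e₀ := T 1 0 (by decide) (by decide); have e₁ := R 0 0; have e₂ := R 1 0;
      have e₃ := G (-1) (-1); have e₄ := G 0 (-1); have e₅ := G 0 0; have e₆ := K 0 (-1)
    push_cast [excess] at e₀ e₁ e₂ e₃ e₄ e₅ e₆ f g
    linarith only [mul_nonneg h₂ e₀.le, mul_nonneg h₃ e₁.le, mul_nonneg h₁ e₂.le,
      mul_nonneg h₂ e₂.le, e₃, mul_nonneg h₂ e₃.le, mul_nonneg h₃ e₃.le, mul_nonneg h₂ e₄.le,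
      mul_nonneg h₁ e₅.le, e₆, g, mul_nonneg h₁ g]
  · have e₀ := T (-1) 0 (by decide) (by decide); have e₁ := T 1 0 (by decide) (by decide);
      have e₂ := R 0 0; have e₃ := R 1 0; have e₄ := R 1 1; have e₅ := G (-1) 0;
      have e₆ := G 0 0; have e₇ := K 0 0
    push_cast [excess] at e₀ e₁ e₂ e₃ e₄ e₅ e₆ e₇ f g
    linarith only [mul_nonneg h₂ e₀.le, mul_nonneg h₂ e₁.le, mul_nonneg h₃ e₂.le,
      mul_nonneg h₂ e₃.le, mul_nonneg h₁ e₄.le, e₅, mul_nonneg h₃ e₅.le, mul_nonneg h₁ e₆.le,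
      mul_nonneg h₂ e₆.le, e₇, g, mul_nonneg h₁ f]

/-- This lemma and the next two leave two candidates each for half-turns and for the two kinds of
glides; hence the six edges. -/
theorem adjacent_rotate {w₁ w₂ x y : ℝ} (h₁ : 0 ≤ y) (h₂ : 0 ≤ x - y) (h₃ : 0 ≤ 1 / 4 - x)
    {a b : ℤ} (E : excess w₁ w₂ x y (-x + a) (-y + b) = 0)
    (T : ∀ c d : ℤ, (c ≠ 0 ∨ d ≠ 0) → 0 < excess w₁ w₂ x y (x + c) (y + d))
    (R : ∀ c d : ℤ, (c ≠ a ∨ d ≠ b) → 0 < excess w₁ w₂ x y (-x + c) (-y + d))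
    (G : ∀ c d : ℤ, 0 < excess w₁ w₂ x y (x + 1 / 2 + c) (-y + 1 / 2 + d))
    (K : ∀ c d : ℤ, 0 < excess w₁ w₂ x y (-x + 1 / 2 + c) (y + 1 / 2 + d)) :
    (a, b) ∈ ([(0, 0), (1, 0)] : List (ℤ × ℤ)) := by
  have f := E.ge
  have g := (neg_eq_zero.2 E).ge
  have k₁ := T 1 0 (by decide); have k₂ := R (a - 1) b (by omega)
  have k₃ := T (-1) 0 (by decide); have k₄ := R (a + 1) b (by omega)
  have k₅ := T 0 1 (by decide); have k₆ := R a (b - 1) (by omega)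
  have k₇ := T 0 (-1) (by decide); have k₈ := R a (b + 1) (by omega)
  push_cast [excess] at f g k₁ k₂ k₃ k₄ k₅ k₆ k₇ k₈
  have l₁ : a < 2 := by
    have : (a : ℝ) < 2 := by linarith
    exact_mod_cast this
  have l₂ : -1 < a := by
    have : (-1 : ℝ) < a := by linarith
    exact_mod_cast this
  have l₃ : b < 2 := by
    have : (b : ℝ) < 2 := by linarith
    exact_mod_cast this
  have l₄ : -1 < b := by
    have : (-1 : ℝ) < b := by linarith
    exact_mod_cast this
  clear k₁ k₂ k₃ k₄ k₅ k₆ k₇ k₈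
  interval_cases a <;> interval_cases b <;> first | decide | (exfalso; push_cast [excess] at f g)
  · have e₀ := G (-1) 0; have e₁ := K 0 0
    push_cast [excess] at e₀ e₁
    linarith only [e₀, e₁, g, h₂]
  · have e₀ := G 0 0; have e₁ := K 0 0
    push_cast [excess] at e₀ e₁
    linarith only [e₀, e₁, g, h₂, h₃]

theorem adjacent_glide_fst {w₁ w₂ x y : ℝ} (h₁ : 0 ≤ y) (h₂ : 0 ≤ x - y) (h₃ : 0 ≤ 1 / 4 - x)
    {a b : ℤ} (E : excess w₁ w₂ x y (x + 1 / 2 + a) (-y + 1 / 2 + b) = 0)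
    (T : ∀ c d : ℤ, (c ≠ 0 ∨ d ≠ 0) → 0 < excess w₁ w₂ x y (x + c) (y + d))
    (R : ∀ c d : ℤ, 0 < excess w₁ w₂ x y (-x + c) (-y + d))
    (G : ∀ c d : ℤ, (c ≠ a ∨ d ≠ b) → 0 < excess w₁ w₂ x y (x + 1 / 2 + c) (-y + 1 / 2 + d))
    (K : ∀ c d : ℤ, 0 < excess w₁ w₂ x y (-x + 1 / 2 + c) (y + 1 / 2 + d)) :
    (a, b) ∈ ([(0, 0), (-1, 0)] : List (ℤ × ℤ)) := by
  have f := E.ge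
  have g := (neg_eq_zero.2 E).ge
  have k₁ := T 1 0 (by decide); have k₂ := G (a - 1) b (by omega)
  have k₃ := T (-1) 0 (by decide); have k₄ := G (a + 1) b (by omega)
  have k₅ := T 0 1 (by decide); have k₆ := G a (b - 1) (by omega)
  have k₇ := T 0 (-1) (by decide); have k₈ := G a (b + 1) (by omega)
  push_cast [excess] at f g k₁ k₂ k₃ k₄ k₅ k₆ k₇ k₈
  have l₁ : a < 1 := by
    have : (a : ℝ) < 1 := by linarith
    exact_mod_cast this
  have l₂ : -2 < a := by
    have : (-2 : ℝ) < a := by linarith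
    exact_mod_cast this
  have l₃ : b < 1 := by
    have : (b : ℝ) < 1 := by linarith
    exact_mod_cast this
  have l₄ : -2 < b := by
    have : (-2 : ℝ) < b := by linarith
    exact_mod_cast this
  clear k₁ k₂ k₃ k₄ k₅ k₆ k₇ k₈
  interval_cases a <;> interval_cases b <;> first | decide | (exfalso; push_cast [excess] at f g)
  · have e₀ := T (-1) 0 (by decide); have e₁ := T 0 (-1) (by decide);
      have e₂ := T 0 1 (by decide); have e₃ := T 1 0 (by decide); have e₄ := R 0 0;
      have e₅ := R 1 0; have e₆ := G 0 (-1) (by decide); have e₇ := G 0 0 (by decide);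
      have e₈ := K 0 (-1)
    push_cast [excess] at e₀ e₁ e₂ e₃ e₄ e₅ e₆ e₇ e₈
    linarith only [mul_nonneg (mul_nonneg h₁ h₃) e₀.le, mul_nonneg (mul_nonneg h₁ h₁) e₁.le,
      mul_nonneg (mul_nonneg h₁ h₂) e₁.le, mul_nonneg (mul_nonneg h₁ h₁) e₂.le,
      mul_nonneg (mul_nonneg h₁ h₃) e₂.le, mul_nonneg (mul_nonneg h₁ h₁) e₃.le, e₄,
      mul_nonneg h₁ e₄.le, mul_nonneg h₃ e₄.le, mul_nonneg (mul_nonneg h₁ h₁) e₄.le,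
      mul_nonneg (mul_nonneg h₁ h₂) e₄.le, mul_nonneg (mul_nonneg h₁ h₂) e₅.le,
      mul_nonneg (mul_nonneg h₁ h₂) e₆.le, mul_nonneg (mul_nonneg h₁ h₁) e₇.le,
      mul_nonneg (mul_nonneg h₁ h₃) e₇.le, mul_nonneg h₂ e₈.le,
      mul_nonneg (mul_nonneg h₁ h₃) e₈.le, mul_nonneg h₁ g, mul_nonneg h₂ g]
  · have e₀ := T (-1) 0 (by decide); have e₁ := T 0 (-1) (by decide);
      have e₂ := T 1 0 (by decide); have e₃ := R 0 0; have e₄ := R 1 0; have e₅ := K 0 (-1)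
    push_cast [excess] at e₀ e₁ e₂ e₃ e₄ e₅
    linarith only [mul_nonneg (mul_nonneg h₁ h₁) e₀.le, mul_nonneg (mul_nonneg h₁ h₃) e₁.le,
      mul_nonneg (mul_nonneg h₁ h₁) e₂.le, mul_nonneg (mul_nonneg h₁ h₂) e₂.le,
      mul_nonneg (mul_nonneg h₁ h₂) e₃.le, mul_nonneg (mul_nonneg h₁ h₃) e₃.le,
      mul_nonneg h₁ e₄.le, mul_nonneg h₂ e₄.le, mul_nonneg (mul_nonneg h₁ h₁) e₄.le,
      mul_nonneg (mul_nonneg h₁ h₂) e₄.le, e₅, mul_nonneg h₁ e₅.le, mul_nonneg h₃ e₅.le, g,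
      mul_nonneg h₂ f]

theorem adjacent_glide_snd {w₁ w₂ x y : ℝ} (h₁ : 0 ≤ y) (h₂ : 0 ≤ x - y) (h₃ : 0 ≤ 1 / 4 - x)
    {a b : ℤ} (E : excess w₁ w₂ x y (-x + 1 / 2 + a) (y + 1 / 2 + b) = 0)
    (T : ∀ c d : ℤ, (c ≠ 0 ∨ d ≠ 0) → 0 < excess w₁ w₂ x y (x + c) (y + d))
    (R : ∀ c d : ℤ, 0 < excess w₁ w₂ x y (-x + c) (-y + d))
    (G : ∀ c d : ℤ, 0 < excess w₁ w₂ x y (x + 1 / 2 + c) (-y + 1 / 2 + d))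
    (K : ∀ c d : ℤ, (c ≠ a ∨ d ≠ b) → 0 < excess w₁ w₂ x y (-x + 1 / 2 + c) (y + 1 / 2 + d)) :
    (a, b) ∈ ([(0, 0), (0, -1)] : List (ℤ × ℤ)) := by
  have f := E.ge
  have g := (neg_eq_zero.2 E).ge
  have k₁ := T 1 0 (by decide); have k₂ := K (a - 1) b (by omega)
  have k₃ := T (-1) 0 (by decide); have k₄ := K (a + 1) b (by omega)
  have k₅ := T 0 1 (by decide); have k₆ := K a (b - 1) (by omega)
  have k₇ := T 0 (-1) (by decide); have k₈ := K a (b + 1) (by omega)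
  push_cast [excess] at f g k₁ k₂ k₃ k₄ k₅ k₆ k₇ k₈
  have l₁ : a < 1 := by
    have : (a : ℝ) < 1 := by linarith
    exact_mod_cast this
  have l₂ : -2 < a := by
    have : (-2 : ℝ) < a := by linarith
    exact_mod_cast this
  have l₃ : b < 1 := by
    have : (b : ℝ) < 1 := by linarith
    exact_mod_cast this
  have l₄ : -2 < b := by
    have : (-2 : ℝ) < b := by linarith
    exact_mod_cast this
  clear k₁ k₂ k₃ k₄ k₅ k₆ k₇ k₈
  interval_cases a <;> interval_cases b <;> first | decide | (exfalso; push_cast [excess] at f g)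
  · have e₀ := T 0 1 (by decide); have e₁ := T 1 0 (by decide); have e₂ := R 0 0;
      have e₃ := R 1 0; have e₄ := G (-1) (-1); have e₅ := G (-1) 0
    push_cast [excess] at e₀ e₁ e₂ e₃ e₄ e₅
    linarith only [mul_nonneg h₁ e₀.le, mul_nonneg h₂ e₁.le, e₂, mul_nonneg h₁ e₂.le,
      mul_nonneg h₃ e₂.le, mul_nonneg h₂ e₃.le, mul_nonneg h₂ e₄.le, mul_nonneg h₃ e₄.le,
      mul_nonneg h₁ e₅.le, g, mul_nonneg h₁ g]
  · have e₀ := T (-1) 0 (by decide); have e₁ := T 0 1 (by decide); have e₂ := T 1 0 (by decide);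
      have e₃ := R 0 0; have e₄ := R 0 1; have e₅ := G (-1) 0
    push_cast [excess] at e₀ e₁ e₂ e₃ e₄ e₅
    linarith only [mul_nonneg h₂ e₀.le, mul_nonneg h₁ e₁.le, mul_nonneg h₂ e₂.le, e₃,
      mul_nonneg h₂ e₃.le, mul_nonneg h₃ e₃.le, mul_nonneg h₁ e₄.le, e₅, g]

/-! ### Orbits of `pgg` and its normalizer. -/

/-- The orbit of a point of the plane under the plane group `pgg`, with lattice `ℤ²`, rotation
centers at the half-integer points and glide axes at odd multiples of `1 / 4`. -/
def pgg (p : ℝ × ℝ) : Set (ℝ × ℝ) :=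
  {q | ∃ a b : ℤ, q = (p.1 + a, p.2 + b) ∨ q = (-p.1 + a, -p.2 + b) ∨
    q = (p.1 + 1 / 2 + a, -p.2 + 1 / 2 + b) ∨ q = (-p.1 + 1 / 2 + a, p.2 + 1 / 2 + b)}

/-- The squared Euclidean distance in the plane. -/
def sqd (w p : ℝ × ℝ) : ℝ := (w.1 - p.1) ^ 2 + (w.2 - p.2) ^ 2

/-- The point `w` is in the interior of the Dirichlet domain of `p` under `pgg`. -/
def Closest (w p : ℝ × ℝ) : Prop := ∀ r ∈ pgg p, r ≠ p → sqd w p < sqd w r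

/-- The interiors of the Dirichlet domains of `p` and `q`, in their respective orbits, meet. -/
def Overlap (p q : ℝ × ℝ) : Prop := ∃ w, Closest w p ∧ Closest w q

/-- The points of the orbit of `c` whose Dirichlet domains overlap that of `p`. -/
def overlaps (p c : ℝ × ℝ) : Set (ℝ × ℝ) := {q ∈ pgg c | Overlap p q}

/-- The points of the orbit of `p` whose Dirichlet domains share an edge with that of `p`. -/
def adjacents (p : ℝ × ℝ) : Set (ℝ × ℝ) :=
  {q ∈ pgg p | q ≠ p ∧ ∃ w, sqd w p = sqd w q ∧
    ∀ r ∈ pgg p, r ≠ p → r ≠ q → sqd w p < sqd w r}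

theorem mem_pgg_self (p : ℝ × ℝ) : p ∈ pgg p := ⟨0, 0, by simp⟩

theorem mem_pgg_symm {p q : ℝ × ℝ} (h : q ∈ pgg p) : p ∈ pgg q := by
  obtain ⟨x, y⟩ := p
  obtain ⟨a, b, rfl | rfl | rfl | rfl⟩ := h
  · refine ⟨-a, -b, Or.inl ?_⟩
    ext <;> push_cast <;> ring
  · refine ⟨a, b, Or.inr (Or.inl ?_)⟩
    ext <;> push_cast <;> ring
  · refine ⟨-a - 1, b, Or.inr (Or.inr (Or.inl ?_))⟩
    ext <;> push_cast <;> ring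
  · refine ⟨a, -b - 1, Or.inr (Or.inr (Or.inr ?_))⟩
    ext <;> push_cast <;> ring

theorem mem_pgg_trans {p q r : ℝ × ℝ} (h : q ∈ pgg p) (h' : r ∈ pgg q) : r ∈ pgg p := by
  obtain ⟨x, y⟩ := p
  obtain ⟨a, b, rfl | rfl | rfl | rfl⟩ := h <;> obtain ⟨c, d, rfl | rfl | rfl | rfl⟩ := h'
  · exact ⟨a + c, b + d, Or.inl (by ext <;> push_cast <;> ring)⟩
  · exact ⟨-a + c, -b + d, Or.inr (Or.inl (by ext <;> push_cast <;> ring))⟩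
  · exact ⟨a + c, -b + d, Or.inr (Or.inr (Or.inl (by ext <;> push_cast <;> ring)))⟩
  · exact ⟨-a + c, b + d, Or.inr (Or.inr (Or.inr (by ext <;> push_cast <;> ring)))⟩
  · exact ⟨a + c, b + d, Or.inr (Or.inl (by ext <;> push_cast <;> ring))⟩
  · exact ⟨-a + c, -b + d, Or.inl (by ext <;> push_cast <;> ring)⟩
  · exact ⟨a + c, -b + d, Or.inr (Or.inr (Or.inr (by ext <;> push_cast <;> ring)))⟩
  · exact ⟨-a + c, b + d, Or.inr (Or.inr (Or.inl (by ext <;> push_cast <;> ring)))⟩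
  · exact ⟨a + c, b + d, Or.inr (Or.inr (Or.inl (by ext <;> push_cast <;> ring)))⟩
  · exact ⟨-a + c - 1, -b + d - 1, Or.inr (Or.inr (Or.inr (by ext <;> push_cast <;> ring)))⟩
  · exact ⟨a + c + 1, -b + d, Or.inl (by ext <;> push_cast <;> ring)⟩
  · exact ⟨-a + c, b + d + 1, Or.inr (Or.inl (by ext <;> push_cast <;> ring))⟩
  · exact ⟨a + c, b + d, Or.inr (Or.inr (Or.inr (by ext <;> push_cast <;> ring)))⟩
  · exact ⟨-a + c - 1, -b + d - 1, Or.inr (Or.inr (Or.inl (by ext <;> push_cast <;> ring)))⟩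
  · exact ⟨a + c + 1, -b + d, Or.inr (Or.inl (by ext <;> push_cast <;> ring))⟩
  · exact ⟨-a + c, b + d + 1, Or.inl (by ext <;> push_cast <;> ring)⟩

theorem pgg_eq_of_mem {p q : ℝ × ℝ} (h : q ∈ pgg p) : pgg q = pgg p :=
  Set.ext fun _ => ⟨mem_pgg_trans h, mem_pgg_trans (mem_pgg_symm h)⟩

/-- The map `n` is an isometry of the plane that normalizes `pgg`. -/
structure Normalizes (n : ℝ × ℝ ≃ ℝ × ℝ) : Prop where
  sqd_eq : ∀ a b, sqd (n a) (n b) = sqd a b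
  mem_iff : ∀ p q, n q ∈ pgg (n p) ↔ q ∈ pgg p

namespace Normalizes

variable {n : ℝ × ℝ ≃ ℝ × ℝ}

theorem closest_iff (hn : Normalizes n) (w p : ℝ × ℝ) : Closest (n w) (n p) ↔ Closest w p := by
  refine ⟨fun h r hr hne => ?_, fun h r hr hne => ?_⟩
  · have := h (n r) ((hn.mem_iff _ _).2 hr) (n.injective.ne hne)
    rwa [hn.sqd_eq, hn.sqd_eq] at this
  · obtain ⟨s, rfl⟩ := n.surjective r
    rw [hn.sqd_eq, hn.sqd_eq]
    exact h s ((hn.mem_iff _ _).1 hr) fun e => hne (by rw [e])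

theorem overlap_iff (hn : Normalizes n) (p q : ℝ × ℝ) : Overlap (n p) (n q) ↔ Overlap p q := by
  constructor
  · rintro ⟨w, h, h'⟩
    obtain ⟨v, rfl⟩ := n.surjective w
    exact ⟨v, (hn.closest_iff _ _).1 h, (hn.closest_iff _ _).1 h'⟩
  · rintro ⟨w, h, h'⟩
    exact ⟨n w, (hn.closest_iff _ _).2 h, (hn.closest_iff _ _).2 h'⟩

/-- Overlaps depend on c only through its orbit, so any representative c' of the orbit of the image
may be used. This absorbs the discrepancies by elements of `pgg` in the reductions below. -/
theorem encard_overlaps (hn : Normalizes n) {p c c' : ℝ × ℝ} (h : n c ∈ pgg c') :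
    (overlaps p c).encard = (overlaps (n p) c').encard := by
  have : overlaps (n p) c' = n '' overlaps p c := by
    ext r
    obtain ⟨s, rfl⟩ := n.surjective r
    rw [n.injective.mem_set_image]
    simp only [overlaps, Set.mem_ofPred_eq, hn.overlap_iff, ← pgg_eq_of_mem h, hn.mem_iff]
  rw [this, n.injective.encard_image]

theorem encard_adjacents (hn : Normalizes n) (p : ℝ × ℝ) :
    (adjacents p).encard = (adjacents (n p)).encard := by
  have : adjacents (n p) = n '' adjacents p := by
    ext r
    obtain ⟨s, rfl⟩ := n.surjective r
    rw [n.injective.mem_set_image]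
    simp only [adjacents, Set.mem_ofPred_eq, hn.mem_iff, n.injective.ne_iff]
    refine and_congr_right fun _ => and_congr_right fun _ => ?_
    rw [← n.exists_congr_right]
    simp only [hn.sqd_eq, ← n.forall_congr_right (q := fun r => r ∈ pgg (n p) → _), hn.mem_iff,
      n.injective.ne_iff]
  rw [this, n.injective.encard_image]

end Normalizes

/-- The translation by `k / 2` along the first axis. -/
noncomputable def shiftHalf (k : ℤ) : ℝ × ℝ ≃ ℝ × ℝ where
  toFun p := (p.1 + k / 2, p.2)
  invFun p := (p.1 - k / 2, p.2)
  left_inv p := by simp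
  right_inv p := by simp

/-- The reflection in the second axis. -/
def flipFst : ℝ × ℝ ≃ ℝ × ℝ where
  toFun p := (-p.1, p.2)
  invFun p := (-p.1, p.2)
  left_inv p := by simp
  right_inv p := by simp

theorem normalizes_of_maps {n : ℝ × ℝ ≃ ℝ × ℝ} (h : ∀ a b, sqd (n a) (n b) = sqd a b)
    (h₁ : ∀ p q, q ∈ pgg p → n q ∈ pgg (n p))
    (h₂ : ∀ p q, q ∈ pgg p → n.symm q ∈ pgg (n.symm p)) : Normalizes n :=
  ⟨h, fun p q => ⟨fun hq => by simpa using h₂ _ _ hq, h₁ p q⟩⟩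

theorem shiftHalf_mem_pgg (k : ℤ) {p q : ℝ × ℝ} (h : q ∈ pgg p) :
    (q.1 + k / 2, q.2) ∈ pgg (p.1 + k / 2, p.2) := by
  obtain ⟨a, b, rfl | rfl | rfl | rfl⟩ := h
  · exact ⟨a, b, Or.inl (by ext <;> push_cast <;> ring)⟩
  · exact ⟨a + k, b, Or.inr (Or.inl (by ext <;> push_cast <;> ring))⟩
  · exact ⟨a, b, Or.inr (Or.inr (Or.inl (by ext <;> push_cast <;> ring)))⟩
  · exact ⟨a + k, b, Or.inr (Or.inr (Or.inr (by ext <;> push_cast <;> ring)))⟩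

theorem normalizes_shiftHalf (k : ℤ) : Normalizes (shiftHalf k) := by
  refine normalizes_of_maps (fun a b => ?_) (fun p q h => shiftHalf_mem_pgg k h) fun p q h => ?_
  · simp [shiftHalf, sqd]
  · have := shiftHalf_mem_pgg (-k) h
    simpa [shiftHalf, neg_div, ← sub_eq_add_neg] using this

theorem flipFst_mem_pgg {p q : ℝ × ℝ} (h : q ∈ pgg p) : (-q.1, q.2) ∈ pgg (-p.1, p.2) := by
  obtain ⟨a, b, rfl | rfl | rfl | rfl⟩ := h
  · exact ⟨-a, b, Or.inl (by ext <;> push_cast <;> ring)⟩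
  · exact ⟨-a, b, Or.inr (Or.inl (by ext <;> push_cast <;> ring))⟩
  · exact ⟨-a - 1, b, Or.inr (Or.inr (Or.inl (by ext <;> push_cast <;> ring)))⟩
  · exact ⟨-a - 1, b, Or.inr (Or.inr (Or.inr (by ext <;> push_cast <;> ring)))⟩

theorem normalizes_flipFst : Normalizes flipFst :=
  normalizes_of_maps (fun a b => by simp only [flipFst, sqd, Equiv.coe_fn_mk]; ring)
    (fun _ _ h => flipFst_mem_pgg h) fun _ _ h => flipFst_mem_pgg h

theorem swap_mem_pgg {p q : ℝ × ℝ} (h : q ∈ pgg p) : q.swap ∈ pgg p.swap := by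
  obtain ⟨a, b, rfl | rfl | rfl | rfl⟩ := h
  · exact ⟨b, a, Or.inl rfl⟩
  · exact ⟨b, a, Or.inr (Or.inl rfl)⟩
  · exact ⟨b, a, Or.inr (Or.inr (Or.inr rfl))⟩
  · exact ⟨b, a, Or.inr (Or.inr (Or.inl rfl))⟩

theorem normalizes_swap : Normalizes (Equiv.prodComm ℝ ℝ) :=
  normalizes_of_maps (fun a b => by simp [sqd, add_comm])
    (fun _ _ h => swap_mem_pgg h) fun _ _ h => swap_mem_pgg h

/-! ### The planar bounds and their reduction to a triangle. -/

/-- The bounds on the numbers of neighbors of the Dirichlet domain of `p` in its own orbit and of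
overlaps with Dirichlet domains in the other orbits of the normalizer of `pgg`. -/
structure PlanarBounds (p : ℝ × ℝ) : Prop where
  adjacents_le : (adjacents p).encard ≤ 6
  centered_le : ∀ i j : ℤ, Odd i → Odd j →
    (overlaps p (p.1 + i / 2, p.2 + j / 2)).encard ≤ 4
  shifted_le : ∀ i j : ℤ, Odd (i + j) → (overlaps p (p.1 + i / 2, p.2 + j / 2)).encard ≤ 7
  rotated_le : ∀ i j : ℤ, Even (i + j) → (overlaps p (p.2 + i / 2, -p.1 + j / 2)).encard ≤ 4
  rotated_shifted_le : ∀ i j : ℤ, Odd (i + j) →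
    (overlaps p (p.2 + i / 2, -p.1 + j / 2)).encard ≤ 5

theorem PlanarBounds.of_shiftHalf (k : ℤ) {p : ℝ × ℝ} (h : PlanarBounds (p.1 + k / 2, p.2)) :
    PlanarBounds p := by
  have hn := normalizes_shiftHalf k
  have e₀ : ∀ i j : ℤ, (overlaps p (p.1 + i / 2, p.2 + j / 2)).encard =
      (overlaps (p.1 + k / 2, p.2) (p.1 + k / 2 + i / 2, p.2 + j / 2)).encard := fun i j =>
    hn.encard_overlaps ⟨0, 0, Or.inl (by ext <;> simp [shiftHalf]; ring)⟩
  -- Conjugating the quarter turn by the shift changes (i, j) to (i + k, j + k). The parity of i + j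
  -- survives, which is why the bounds for quarter turns are stated in terms of this parity alone.
  have e₁ : ∀ i j : ℤ, (overlaps p (p.2 + i / 2, -p.1 + j / 2)).encard = (overlaps
      (p.1 + k / 2, p.2) (p.2 + (i + k : ℤ) / 2, -(p.1 + k / 2) + (j + k : ℤ) / 2)).encard :=
    fun i j => hn.encard_overlaps ⟨0, 0, Or.inl (by ext <;> simp [shiftHalf] <;> ring)⟩
  refine ⟨?_, fun i j hi hj => ?_, fun i j hij => ?_, fun i j hij => ?_, fun i j hij => ?_⟩
  · rw [hn.encard_adjacents]
    exact h.adjacents_le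
  · rw [e₀]
    exact h.centered_le i j hi hj
  · rw [e₀]
    exact h.shifted_le i j hij
  · rw [e₁]
    exact h.rotated_le _ _ (by rw [Int.even_iff] at *; omega)
  · rw [e₁]
    exact h.rotated_shifted_le _ _ (by rw [Int.odd_iff] at *; omega)

theorem PlanarBounds.of_flipFst {p : ℝ × ℝ} (h : PlanarBounds (-p.1, p.2)) : PlanarBounds p := by
  have hn := normalizes_flipFst
  have e₀ : ∀ i j : ℤ, (overlaps p (p.1 + i / 2, p.2 + j / 2)).encard =
      (overlaps (-p.1, p.2) (-p.1 + i / 2, p.2 + j / 2)).encard := fun i j =>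
    hn.encard_overlaps ⟨-i, 0, Or.inl (by ext <;> simp [flipFst]; ring)⟩
  have e₁ : ∀ i j : ℤ, (overlaps p (p.2 + i / 2, -p.1 + j / 2)).encard = (overlaps
      (-p.1, p.2) (p.2 + i / 2, -(-p.1) + j / 2)).encard :=
    -- The reflection turns the quarter turn into its inverse up to translation; a half-turn of
    -- `pgg` brings the representative back to the required form.
    fun i j => hn.encard_overlaps ⟨0, j, Or.inr (Or.inl (by ext <;> simp [flipFst] <;> ring))⟩
  refine ⟨?_, fun i j hi hj => ?_, fun i j hij => ?_, fun i j hij => ?_, fun i j hij => ?_⟩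
  · rw [hn.encard_adjacents]
    exact h.adjacents_le
  · rw [e₀]
    exact h.centered_le i j hi hj
  · rw [e₀]
    exact h.shifted_le i j hij
  · rw [e₁]
    exact h.rotated_le i j hij
  · rw [e₁]
    exact h.rotated_shifted_le i j hij

theorem PlanarBounds.of_swap {p : ℝ × ℝ} (h : PlanarBounds (p.2, p.1)) : PlanarBounds p := by
  have hn := normalizes_swap
  have e₀ : ∀ i j : ℤ, (overlaps p (p.1 + i / 2, p.2 + j / 2)).encard =
      (overlaps (p.2, p.1) (p.2 + j / 2, p.1 + i / 2)).encard := fun i j =>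
    hn.encard_overlaps (mem_pgg_self _)
  have e₁ : ∀ i j : ℤ, (overlaps p (p.2 + i / 2, -p.1 + j / 2)).encard = (overlaps
      (p.2, p.1) (p.1 + j / 2, -p.2 + i / 2)).encard :=
    fun i j => hn.encard_overlaps ⟨j, i, Or.inr (Or.inl (by ext <;> simp <;> ring))⟩
  refine ⟨?_, fun i j hi hj => ?_, fun i j hij => ?_, fun i j hij => ?_, fun i j hij => ?_⟩
  · rw [hn.encard_adjacents]
    exact h.adjacents_le
  · rw [e₀]
    exact h.centered_le j i hj hi
  · rw [e₀]
    exact h.shifted_le j i (by rwa [add_comm])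
  · rw [e₁]
    exact h.rotated_le j i (by rwa [add_comm])
  · rw [e₁]
    exact h.rotated_shifted_le j i (by rwa [add_comm])

/-- It suffices to prove the bounds in a fundamental triangle of the normalizer of `pgg`. -/
theorem PlanarBounds.of_triangle
    (h : ∀ x y : ℝ, 0 ≤ y → 0 ≤ x - y → 0 ≤ 1 / 4 - x → PlanarBounds (x, y)) (p : ℝ × ℝ) :
    PlanarBounds p := by
  -- Half translations and a reflection fold one coordinate into [0, 1/4]. Exchanging the axes
  -- allows the same for the other coordinate and finally puts the two in order.
  have fold : ∀ x : ℝ, ∃ k : ℤ, |x + k / 2| ≤ 1 / 4 := fun x => by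
    refine ⟨-round (2 * x), ?_⟩
    have := abs_sub_round (2 * x)
    rw [abs_le] at *
    push_cast
    constructor <;> linarith
  have step : ∀ x y : ℝ, (∀ x' : ℝ, 0 ≤ x' → x' ≤ 1 / 4 → PlanarBounds (x', y)) →
      PlanarBounds (x, y) := fun x y hx => by
    obtain ⟨k, hk⟩ := fold x
    apply PlanarBounds.of_shiftHalf k
    rw [abs_le] at hk
    rcases le_total 0 (x + k / 2) with h0 | h0
    · exact hx _ h0 hk.2
    · exact PlanarBounds.of_flipFst (hx _ (by linarith) (by linarith [hk.1]))
  obtain ⟨x, y⟩ := p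
  refine step x y fun x' h₁ h₂ => PlanarBounds.of_swap (step y x' fun y' h₃ h₄ => ?_)
  rcases le_total y' x' with h₅ | h₅
  · exact PlanarBounds.of_swap (h _ _ h₃ (by linarith) (by linarith))
  · exact h _ _ h₁ (by linarith) (by linarith)

/-! ### Counting the motions that allow overlaps. -/

/-- `Closest` ignores images that coincide with p, whereas `Near` requires strict inequality for
every other group element. Nontrivial translations and glides fix no point, so the two notions
differ only at rotation centers, which `hp` excludes. -/
theorem Closest.near {w₁ w₂ x y : ℝ} (h : Closest (w₁, w₂) (x, y))
    (hp : ∀ a b : ℤ, 2 * x = a → 2 * y = b → False) : Near w₁ w₂ x y := by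
  have key : ∀ u v : ℝ, (u, v) ∈ pgg (x, y) → (u, v) ≠ (x, y) → 0 < excess w₁ w₂ x y u v :=
    fun u v hr hne => sub_pos.2 (h (u, v) hr hne)
  refine ⟨fun a b hab => key _ _ ⟨a, b, Or.inl rfl⟩ fun e => ?_,
    fun a b => key _ _ ⟨a, b, Or.inr (Or.inl rfl)⟩ fun e => ?_,
    fun a b => key _ _ ⟨a, b, Or.inr (Or.inr (Or.inl rfl))⟩ fun e => ?_,
    fun a b => key _ _ ⟨a, b, Or.inr (Or.inr (Or.inr rfl))⟩ fun e => ?_⟩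
  · simp at e
    omega
  · rw [Prod.mk.injEq] at e
    exact hp a b (by linarith) (by linarith)
  · rw [Prod.mk.injEq] at e
    have : (2 * a + 1 : ℝ) = 0 := by linarith
    have : 2 * a + 1 = 0 := by exact_mod_cast this
    omega
  · rw [Prod.mk.injEq] at e
    have : (2 * b + 1 : ℝ) = 0 := by linarith
    have : 2 * b + 1 = 0 := by exact_mod_cast this
    omega

/-- A point of the triangle other than the rotation center is not a rotation center. -/
theorem not_rotation_center {x y : ℝ} (h₁ : 0 ≤ y) (h₂ : 0 ≤ x - y) (h₃ : 0 ≤ 1 / 4 - x)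
    (h₀ : x ≠ 0) (a b : ℤ) (ha : 2 * x = a) (_ : 2 * y = b) : False := by
  have l₁ : (-1 : ℝ) < a := by linarith
  have l₂ : (a : ℝ) < 1 := by linarith
  have : a = 0 := by
    have : -1 < a := by exact_mod_cast l₁
    have : a < 1 := by exact_mod_cast l₂
    omega
  apply h₀
  rw [this] at ha
  simpa using ha

/-- The points of the orbit of `p` under the translations by `(a / 2, b / 2)` composed with the
`k`-th of the axial symmetries. -/
noncomputable def axialImage (p : ℝ × ℝ) (l : Fin 4 × ℤ × ℤ) : ℝ × ℝ :=
  (![p.1, -p.1, p.1, -p.1] l.1 + l.2.1 / 2, ![p.2, -p.2, -p.2, p.2] l.1 + l.2.2 / 2)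

/-- The points of the orbit of `p` under the translations by `(a / 2, b / 2)` composed with the
`k`-th of the symmetries that exchange the axes. -/
noncomputable def diagonalImage (p : ℝ × ℝ) (l : Fin 4 × ℤ × ℤ) : ℝ × ℝ :=
  (![p.2, -p.2, p.2, -p.2] l.1 + l.2.1 / 2, ![-p.1, p.1, p.1, -p.1] l.1 + l.2.2 / 2)

/-- The motions in `axialImage` for which Dirichlet domains may overlap. -/
def axialLabels : Finset (Fin 4 × ℤ × ℤ) :=
  {(0, 0, 0), (0, 1, 0), (0, -1, 0), (0, 0, 1), (0, 0, -1), (1, 1, 0), (1, 0, 1), (1, 1, 1),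
    (2, 1, 0), (2, -1, 0), (2, 0, 0), (2, 0, 1), (2, 0, -1),
    (3, 0, 1), (3, 0, -1), (3, 0, 0), (3, 1, 0), (3, 2, 0)}

/-- The motions in `diagonalImage` for which Dirichlet domains may overlap. -/
def diagonalLabels : Finset (Fin 4 × ℤ × ℤ) :=
  {(0, 0, 0), (0, 1, 1), (0, 0, 1), (0, 1, 0), (1, 0, 0), (1, 1, -1), (1, 0, -1), (1, 1, 0),
    (2, 1, -1), (2, 0, 0), (2, 1, 0), (2, -1, 0), (2, 0, 1), (2, 0, -1),
    (3, 1, 1), (3, 0, 0), (3, 1, 0), (3, 0, 1)}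

/-- The motion `l` maps the orbit of `p` under `pgg` to the one translated by `(i / 2, j / 2)`. -/
abbrev InClass (i j : ℤ) (l : Fin 4 × ℤ × ℤ) : Prop :=
  2 ∣ l.2.1 - i - ![0, 0, 1, 1] l.1 ∧ 2 ∣ l.2.2 - j - ![0, 0, 1, 1] l.1

/-- Only the parities of i and j matter, so each count reduces to a few classes that can be decided.
-/
theorem filter_inClass_congr (s : Finset (Fin 4 × ℤ × ℤ)) {i j i' j' : ℤ} (hi : 2 ∣ i - i')
    (hj : 2 ∣ j - j') : s.filter (InClass i j) = s.filter (InClass i' j') :=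
  Finset.filter_congr fun l _ => by
    unfold InClass
    generalize (![0, 0, 1, 1] : Fin 4 → ℤ) l.1 = t
    omega

theorem encard_le_of_subset_image {S : Set (ℝ × ℝ)} {f : Fin 4 × ℤ × ℤ → ℝ × ℝ}
    {s : Finset (Fin 4 × ℤ × ℤ)} {N : ℕ} (h : S ⊆ f '' s) (hs : s.card ≤ N) : S.encard ≤ N :=
  (Set.encard_le_encard h).trans <| (Set.encard_image_le _ _).trans <| by
    rw [Set.encard_coe_eq_coe_finsetCard]
    exact_mod_cast hs

theorem overlaps_subset_axialImage {x y : ℝ} (h₁ : 0 ≤ y) (h₂ : 0 ≤ x - y) (h₃ : 0 ≤ 1 / 4 - x)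
    (h₀ : x ≠ 0) (i j : ℤ) : overlaps (x, y) (x + i / 2, y + j / 2) ⊆
      axialImage (x, y) '' (axialLabels.filter (InClass i j)) := by
  rintro q ⟨⟨a, b, hq⟩, ⟨w₁, w₂⟩, hp, hw⟩
  have hc := not_rotation_center h₁ h₂ h₃ h₀
  have P := hp.near hc
  -- The axial motions permute the rotation centers, so the image q is not a center either and
  -- `Near` applies to it.
  have near : ∀ (k : Fin 4) (c d : ℤ), q = axialImage (x, y) (k, c, d) →
      Near w₁ w₂ (axialImage (x, y) (k, c, d)).1 (axialImage (x, y) (k, c, d)).2 := by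
    intro k c d e
    rw [e] at hw
    refine Closest.near hw fun a' b' ha hb => ?_
    fin_cases k <;> simp [axialImage] at ha hb
    · exact hc (a' - c) (b' - d) (by push_cast; linarith) (by push_cast; linarith)
    · exact hc (c - a') (d - b') (by push_cast; linarith) (by push_cast; linarith)
    · exact hc (a' - c) (d - b') (by push_cast; linarith) (by push_cast; linarith)
    · exact hc (c - a') (b' - d) (by push_cast; linarith) (by push_cast; linarith)
  have fin : ∀ (k : Fin 4) (c d : ℤ), q = axialImage (x, y) (k, c, d) →
      (k, c, d) ∈ axialLabels → InClass i j (k, c, d) →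
      q ∈ axialImage (x, y) '' (axialLabels.filter (InClass i j)) := fun k c d e hl hm =>
    ⟨(k, c, d), by simpa using ⟨hl, hm⟩, e.symm⟩
  rcases hq with e | e | e | e
  · have e' : q = axialImage (x, y) (0, i + 2 * a, j + 2 * b) := by
      rw [e]; ext <;> simp [axialImage] <;> ring
    refine fin _ _ _ e' ?_ (by simp [InClass])
    have := near_near_id h₁ h₂ h₃ P (near _ _ _ e')
    simp at this
    simp [axialLabels]
    omega
  · have e' : q = axialImage (x, y) (1, -i + 2 * a, -j + 2 * b) := by
      rw [e]; ext <;> simp [axialImage] <;> ring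
    refine fin _ _ _ e' ?_ (by simp [InClass]; omega)
    have := near_near_neg h₁ h₂ h₃ P (near _ _ _ e')
    simp at this
    simp [axialLabels]
    omega
  · have e' : q = axialImage (x, y) (2, i + 1 + 2 * a, -j + 1 + 2 * b) := by
      rw [e]; ext <;> simp [axialImage] <;> ring
    refine fin _ _ _ e' ?_ (by simp [InClass]; omega)
    have := near_near_flip_snd h₁ h₂ h₃ P (near _ _ _ e')
    simp at this
    simp [axialLabels]
    omega
  · have e' : q = axialImage (x, y) (3, -i + 1 + 2 * a, j + 1 + 2 * b) := by
      rw [e]; ext <;> simp [axialImage] <;> ring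
    refine fin _ _ _ e' ?_ (by simp [InClass]; omega)
    have := near_near_flip_fst h₁ h₂ h₃ P (near _ _ _ e')
    simp at this
    simp [axialLabels]
    omega

theorem overlaps_subset_diagonalImage {x y : ℝ} (h₁ : 0 ≤ y) (h₂ : 0 ≤ x - y)
    (h₃ : 0 ≤ 1 / 4 - x) (h₀ : x ≠ 0) (i j : ℤ) : overlaps (x, y) (y + i / 2, -x + j / 2) ⊆
      diagonalImage (x, y) '' (diagonalLabels.filter (InClass i j)) := by
  rintro q ⟨⟨a, b, hq⟩, ⟨w₁, w₂⟩, hp, hw⟩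
  have hc := not_rotation_center h₁ h₂ h₃ h₀
  have P := hp.near hc
  have near : ∀ (k : Fin 4) (c d : ℤ), q = diagonalImage (x, y) (k, c, d) →
      Near w₁ w₂ (diagonalImage (x, y) (k, c, d)).1 (diagonalImage (x, y) (k, c, d)).2 := by
    intro k c d e
    rw [e] at hw
    refine Closest.near hw fun a' b' ha hb => ?_
    fin_cases k <;> simp [diagonalImage] at ha hb
    · exact hc (d - b') (a' - c) (by push_cast; linarith) (by push_cast; linarith)
    · exact hc (b' - d) (c - a') (by push_cast; linarith) (by push_cast; linarith)
    · exact hc (b' - d) (a' - c) (by push_cast; linarith) (by push_cast; linarith)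
    · exact hc (d - b') (c - a') (by push_cast; linarith) (by push_cast; linarith)
  have fin : ∀ (k : Fin 4) (c d : ℤ), q = diagonalImage (x, y) (k, c, d) →
      (k, c, d) ∈ diagonalLabels → InClass i j (k, c, d) →
      q ∈ diagonalImage (x, y) '' (diagonalLabels.filter (InClass i j)) := fun k c d e hl hm =>
    ⟨(k, c, d), by simpa using ⟨hl, hm⟩, e.symm⟩
  rcases hq with e | e | e | e
  · have e' : q = diagonalImage (x, y) (0, i + 2 * a, j + 2 * b) := by
      rw [e]; ext <;> simp [diagonalImage] <;> ring
    refine fin _ _ _ e' ?_ (by simp [InClass])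
    have := near_near_rotate h₁ h₂ h₃ P (near _ _ _ e')
    simp at this
    simp [diagonalLabels]
    omega
  · have e' : q = diagonalImage (x, y) (1, -i + 2 * a, -j + 2 * b) := by
      rw [e]; ext <;> simp [diagonalImage] <;> ring
    refine fin _ _ _ e' ?_ (by simp [InClass]; omega)
    have := near_near_rotate_inv h₁ h₂ h₃ P (near _ _ _ e')
    simp at this
    simp [diagonalLabels]
    omega
  · have e' : q = diagonalImage (x, y) (2, i + 1 + 2 * a, -j + 1 + 2 * b) := by
      rw [e]; ext <;> simp [diagonalImage] <;> ring
    refine fin _ _ _ e' ?_ (by simp [InClass]; omega)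
    have := near_near_swap h₁ h₂ h₃ P (near _ _ _ e')
    simp at this
    simp [diagonalLabels]
    omega
  · have e' : q = diagonalImage (x, y) (3, -i + 1 + 2 * a, j + 1 + 2 * b) := by
      rw [e]; ext <;> simp [diagonalImage] <;> ring
    refine fin _ _ _ e' ?_ (by simp [InClass]; omega)
    have := near_near_neg_swap h₁ h₂ h₃ P (near _ _ _ e')
    simp at this
    simp [diagonalLabels]
    omega

theorem card_axialLabels_centered {i j : ℤ} (hi : Odd i) (hj : Odd j) :
    (axialLabels.filter (InClass i j)).card ≤ 4 := by
  rw [Int.odd_iff] at hi hj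
  rw [filter_inClass_congr (i' := 1) (j' := 1) _ (by omega) (by omega)]
  decide

theorem card_axialLabels_shifted {i j : ℤ} (h : Odd (i + j)) :
    (axialLabels.filter (InClass i j)).card ≤ 7 := by
  rw [Int.odd_iff] at h
  -- The classes (0, 1) and (1, 0) contain six and seven labels; the condition y ≤ x makes them
  -- unequal.
  rcases Int.emod_two_eq_zero_or_one i with hi | hi
  · rw [filter_inClass_congr (i' := 0) (j' := 1) _ (by omega) (by omega)]
    decide
  · rw [filter_inClass_congr (i' := 1) (j' := 0) _ (by omega) (by omega)]
    decide

theorem card_diagonalLabels_even {i j : ℤ} (h : Even (i + j)) :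
    (diagonalLabels.filter (InClass i j)).card ≤ 4 := by
  rw [Int.even_iff] at h
  rcases Int.emod_two_eq_zero_or_one i with hi | hi
  · rw [filter_inClass_congr (i' := 0) (j' := 0) _ (by omega) (by omega)]
    decide
  · rw [filter_inClass_congr (i' := 1) (j' := 1) _ (by omega) (by omega)]
    decide

theorem card_diagonalLabels_odd {i j : ℤ} (h : Odd (i + j)) :
    (diagonalLabels.filter (InClass i j)).card ≤ 5 := by
  rw [Int.odd_iff] at h
  rcases Int.emod_two_eq_zero_or_one i with hi | hi
  · rw [filter_inClass_congr (i' := 0) (j' := 1) _ (by omega) (by omega)]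
    decide
  · rw [filter_inClass_congr (i' := 1) (j' := 0) _ (by omega) (by omega)]
    decide

/-! ### Base points on a rotation axis -/

/-- The point with coordinates `c / 2` and `d / 2`. -/
noncomputable def halfPoint (c d : ℤ) : ℝ × ℝ := (c / 2, d / 2)

/-- The orbit of a rotation center is a checkerboard in the grid of half-integer points: lattice
translations change c and d by even numbers, and glides can change both by odd ones. -/
theorem half_mem_pgg_half {c d c' d' : ℤ} (h : 2 ∣ c + d - c' - d') :
    halfPoint c d ∈ pgg (halfPoint c' d') := by
  rcases Int.even_or_odd' (c - c') with ⟨k, hk | hk⟩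
  · obtain ⟨l, hl⟩ : ∃ l, d - d' = 2 * l := ⟨(d - d') / 2, by omega⟩
    obtain rfl : c = c' + 2 * k := by omega
    obtain rfl : d = d' + 2 * l := by omega
    exact ⟨k, l, Or.inl (by ext <;> simp only [halfPoint] <;> push_cast <;> ring)⟩
  · obtain ⟨l, hl⟩ : ∃ l, d - d' = 2 * l + 1 := ⟨(d - d' - 1) / 2, by omega⟩
    obtain rfl : c = c' + (2 * k + 1) := by omega
    obtain rfl : d = d' + (2 * l + 1) := by omega
    exact ⟨k, d' + l, Or.inr (Or.inr (Or.inl (by ext <;> simp only [halfPoint] <;> push_cast <;> ring)))⟩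

theorem exists_half_of_mem_pgg_half {i j : ℤ} {q : ℝ × ℝ} (h : q ∈ pgg (halfPoint i j)) :
    ∃ c d : ℤ, q = halfPoint c d ∧ 2 ∣ c + d - i - j := by
  obtain ⟨a, b, rfl | rfl | rfl | rfl⟩ := h
  · exact ⟨i + 2 * a, j + 2 * b, by ext <;> simp only [halfPoint] <;> push_cast <;> ring, by omega⟩
  · exact ⟨-i + 2 * a, -j + 2 * b, by ext <;> simp only [halfPoint] <;> push_cast <;> ring, by omega⟩
  · exact ⟨i + 1 + 2 * a, -j + 1 + 2 * b, by ext <;> simp only [halfPoint] <;> push_cast <;> ring, by omega⟩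
  · exact ⟨-i + 1 + 2 * a, j + 1 + 2 * b, by ext <;> simp only [halfPoint] <;> push_cast <;> ring, by omega⟩

theorem half_ne_half {c d c' d' : ℤ} (h : c ≠ c' ∨ d ≠ d') :
    halfPoint c d ≠ halfPoint c' d' := by
  intro e
  rw [halfPoint, halfPoint, Prod.mk.injEq] at e
  have e₁ : (c : ℝ) = c' := by linarith [e.1]
  have e₂ : (d : ℝ) = d' := by linarith [e.2]
  norm_cast at e₁ e₂
  omega

/-- This is the argument of `Near.displacement_lt` with e = (s/2, t/2), the shortest vectors between
centers in one orbit. Since |e|² = 1/2, the inequality ⟨q, e⟩ < |e|² becomes sc + td < 2. -/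
theorem displacement_lt_of_half {w : ℝ × ℝ} {c d s t : ℤ} (ht : s ^ 2 = 1) (hs : t ^ 2 = 1)
    (h : sqd w (halfPoint 0 0) + sqd w (halfPoint c d) <
      sqd w (halfPoint s t) + sqd w (halfPoint (c - s) (d - t))) :
    s * c + t * d < 2 := by
  have ht' : (s : ℝ) ^ 2 = 1 := by exact_mod_cast ht
  have hs' : (t : ℝ) ^ 2 = 1 := by exact_mod_cast hs
  have : (s * c + t * d : ℝ) < 2 := by
    simp only [sqd, halfPoint] at h
    push_cast at h
    nlinarith
  exact_mod_cast this

theorem encard_overlaps_center (i j : ℤ) :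
    (overlaps (halfPoint 0 0) (halfPoint i j)).encard ≤ 4 := by
  have sub : overlaps (halfPoint 0 0) (halfPoint i j) ⊆ axialImage (0, 0) ''
      (({(0, 0, 0), (0, 1, 0), (0, -1, 0), (0, 0, 1), (0, 0, -1)} :
        Finset (Fin 4 × ℤ × ℤ)).filter fun l => 2 ∣ l.2.1 + l.2.2 - (i + j)) := by
    rintro q ⟨hq, w, hw, hw'⟩
    obtain ⟨c, d, rfl, hcd⟩ := exists_half_of_mem_pgg_half hq
    have lt : ∀ s t : ℤ, s ^ 2 = 1 → t ^ 2 = 1 → 2 ∣ s + t → s ≠ 0 → s * c + t * d < 2 := by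
      intro s t hs ht hst h0
      refine displacement_lt_of_half (w := w) hs ht (add_lt_add ?_ ?_)
      · exact hw _ (half_mem_pgg_half (by omega)) (half_ne_half (by omega))
      · exact hw' _ (half_mem_pgg_half (by omega)) (half_ne_half (by omega))
    -- The four sign choices give |c| + |d| < 2, which leaves five points: one with c + d even and
    -- four with c + d odd.
    have k₁ := lt 1 1 (by decide) (by decide) (by decide) (by decide)
    have k₂ := lt 1 (-1) (by decide) (by decide) (by decide) (by decide)
    have k₃ := lt (-1) 1 (by decide) (by decide) (by decide) (by decide)
    have k₄ := lt (-1) (-1) (by decide) (by decide) (by decide) (by decide)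
    refine ⟨(0, c, d), ?_, by simp [axialImage, halfPoint]⟩
    simp
    omega
  refine encard_le_of_subset_image sub ?_
  rcases Int.even_or_odd' (i + j) with ⟨k, hk | hk⟩
  · rw [Finset.filter_congr (q := fun l => 2 ∣ l.2.1 + l.2.2) fun l _ => by omega]
    decide
  · rw [Finset.filter_congr (q := fun l => 2 ∣ l.2.1 + l.2.2 - 1) fun l _ => by omega]
    decide

theorem encard_adjacents_center : (adjacents (halfPoint 0 0)).encard ≤ 6 := by
  -- The domain of a center is a square with edges towards the four diagonal neighbors. For any
  -- other q, the inequalities force |c| + |d| < 2 with c + d even, that is, q = p.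
  have sub : adjacents (halfPoint 0 0) ⊆ axialImage (0, 0) ''
      ({(0, 1, 1), (0, 1, -1), (0, -1, 1), (0, -1, -1)} : Finset (Fin 4 × ℤ × ℤ)) := by
    rintro q ⟨hq, hne, w, he, hw⟩
    obtain ⟨c, d, rfl, hcd⟩ := exists_half_of_mem_pgg_half hq
    refine ⟨(0, c, d), ?_, by simp [axialImage, halfPoint]⟩
    by_contra hn
    simp at hn
    have lt : ∀ s t : ℤ, s ^ 2 = 1 → t ^ 2 = 1 → 2 ∣ s + t → s ≠ 0 → (c ≠ s ∨ d ≠ t) →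
        s * c + t * d < 2 := by
      intro s t hs ht hst h0 h1
      refine displacement_lt_of_half (w := w) hs ht (add_lt_add ?_ (he ▸ ?_))
      · exact hw _ (half_mem_pgg_half (by omega)) (half_ne_half (by omega))
          (half_ne_half (by omega))
      · exact hw _ (half_mem_pgg_half (by omega)) (half_ne_half (by omega))
          (half_ne_half (by omega))
    have k₁ := lt 1 1 (by decide) (by decide) (by decide) (by decide) (by omega)
    have k₂ := lt 1 (-1) (by decide) (by decide) (by decide) (by decide) (by omega)
    have k₃ := lt (-1) 1 (by decide) (by decide) (by decide) (by decide) (by omega)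
    have k₄ := lt (-1) (-1) (by decide) (by decide) (by decide) (by decide) (by omega)
    obtain ⟨rfl, rfl⟩ : c = 0 ∧ d = 0 := by omega
    exact hne rfl
  exact encard_le_of_subset_image sub (by decide)

/-! ### Base points in the fundamental triangle -/

/-- The points of the orbit of `(x, y)` under `pgg`. -/
noncomputable def pggPoint (x y : ℝ) (k : Fin 4) (a b : ℤ) : ℝ × ℝ :=
  ![(x + a, y + b), (-x + a, -y + b), (x + 1 / 2 + a, -y + 1 / 2 + b),
    (-x + 1 / 2 + a, y + 1 / 2 + b)] k

theorem pggPoint_mem_pgg (x y : ℝ) (k : Fin 4) (a b : ℤ) : pggPoint x y k a b ∈ pgg (x, y) := by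
  refine ⟨a, b, ?_⟩
  fin_cases k <;> simp [pggPoint]

/-- Away from rotation centers `pgg` acts freely. Coincidences between different kinds of motion
make either p a center or an integer equal to a half-integer. -/
theorem pggPoint_injective {x y : ℝ} (hc : ∀ a b : ℤ, 2 * x = a → 2 * y = b → False)
    {k k' : Fin 4} {a b a' b' : ℤ} (h : pggPoint x y k a b = pggPoint x y k' a' b') :
    k = k' ∧ a = a' ∧ b = b' := by
  have par : ∀ m n : ℤ, (m : ℝ) = 1 / 2 + n → False := fun m n e => by
    have : (2 * m : ℝ) = 1 + 2 * n := by linarith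
    have : 2 * m = 1 + 2 * n := by exact_mod_cast this
    omega
  have eq : ∀ m n : ℤ, (m : ℝ) = n → m = n := fun m n e => by exact_mod_cast e
  fin_cases k <;> fin_cases k' <;> simp [pggPoint] at h <;> simp
  · exact h
  · exact hc (a' - a) (b' - b) (by push_cast; linarith) (by push_cast; linarith)
  · exact par a a' (by linarith)
  · exact par b b' (by linarith)
  · exact hc (a - a') (b - b') (by push_cast; linarith) (by push_cast; linarith)
  · exact h
  · exact par b b' (by linarith)
  · exact par a a' (by linarith)
  · exact par a' a (by linarith)
  · exact par b' b (by linarith)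
  · exact h
  · exact hc (a' - a) (b - b') (by push_cast; linarith) (by push_cast; linarith)
  · exact par b' b (by linarith)
  · exact par a' a (by linarith)
  · exact hc (a - a') (b' - b) (by push_cast; linarith) (by push_cast; linarith)
  · exact h

theorem encard_adjacents_triangle {x y : ℝ} (h₁ : 0 ≤ y) (h₂ : 0 ≤ x - y) (h₃ : 0 ≤ 1 / 4 - x)
    (h₀ : x ≠ 0) : (adjacents (x, y)).encard ≤ 6 := by
  have sub : adjacents (x, y) ⊆ axialImage (x, y) '' ({(1, 0, 0), (1, 2, 0), (2, 1, 1),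
      (2, -1, 1), (3, 1, 1), (3, 1, -1)} : Finset (Fin 4 × ℤ × ℤ)) := by
    rintro q ⟨⟨a, b, hq⟩, hne, ⟨w₁, w₂⟩, he, hw⟩
    have inj := @pggPoint_injective x y (not_rotation_center h₁ h₂ h₃ h₀)
    have hp : (x, y) = pggPoint x y 0 0 0 := by simp [pggPoint]
    have E : ∀ k a b, q = pggPoint x y k a b →
        excess w₁ w₂ x y (pggPoint x y k a b).1 (pggPoint x y k a b).2 = 0 :=
      fun k a b e => by
        rw [← e]
        exact sub_eq_zero.2 he.symm
    have F : ∀ k a b, q = pggPoint x y k a b → ∀ k' c d, (k' ≠ 0 ∨ c ≠ 0 ∨ d ≠ 0) →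
        (k' ≠ k ∨ c ≠ a ∨ d ≠ b) →
        0 < excess w₁ w₂ x y (pggPoint x y k' c d).1 (pggPoint x y k' c d).2 :=
      fun k a b e k' c d n n' => sub_pos.2 <| hw _ (pggPoint_mem_pgg x y k' c d)
        (fun e' => by
          obtain ⟨r₁, r₂, r₃⟩ := inj (e'.trans hp)
          simp [r₁, r₂, r₃] at n)
        (fun e' => by
          obtain ⟨r₁, r₂, r₃⟩ := inj (e'.trans e)
          simp [r₁, r₂, r₃] at n')
    rcases hq with e | e | e | e
    · have e' : q = pggPoint x y 0 a b := e
      refine (not_adjacent_translate h₁ h₂ h₃ (a := a) (b := b) ?_ (E _ _ _ e')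
        (fun c d n n' => F _ _ _ e' 0 c d (Or.inr n) (Or.inr n'))
        (fun c d => F _ _ _ e' 1 c d (by simp) (by simp))
        (fun c d => F _ _ _ e' 2 c d (by simp) (by simp))
        (fun c d => F _ _ _ e' 3 c d (by simp) (by simp))).elim
      by_contra! hn
      exact hne (by rw [e', hp, hn.1, hn.2])
    · have e' : q = pggPoint x y 1 a b := e
      have := adjacent_rotate h₁ h₂ h₃ (E _ _ _ e')
        (fun c d n => F _ _ _ e' 0 c d (Or.inr n) (by simp))
        (fun c d n => F _ _ _ e' 1 c d (by simp) (Or.inr n))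
        (fun c d => F _ _ _ e' 2 c d (by simp) (by simp))
        (fun c d => F _ _ _ e' 3 c d (by simp) (by simp))
      refine ⟨(1, 2 * a, 2 * b), ?_, by rw [e]; ext <;> simp [axialImage]⟩
      simp at this ⊢
      omega
    · have e' : q = pggPoint x y 2 a b := e
      have := adjacent_glide_fst h₁ h₂ h₃ (E _ _ _ e')
        (fun c d n => F _ _ _ e' 0 c d (Or.inr n) (by simp))
        (fun c d => F _ _ _ e' 1 c d (by simp) (by simp))
        (fun c d n => F _ _ _ e' 2 c d (by simp) (Or.inr n))
        (fun c d => F _ _ _ e' 3 c d (by simp) (by simp))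
      refine ⟨(2, 1 + 2 * a, 1 + 2 * b), ?_, by rw [e]; ext <;> simp [axialImage] <;> ring⟩
      simp at this ⊢
      omega
    · have e' : q = pggPoint x y 3 a b := e
      have := adjacent_glide_snd h₁ h₂ h₃ (E _ _ _ e')
        (fun c d n => F _ _ _ e' 0 c d (Or.inr n) (by simp))
        (fun c d => F _ _ _ e' 1 c d (by simp) (by simp))
        (fun c d => F _ _ _ e' 2 c d (by simp) (by simp))
        (fun c d n => F _ _ _ e' 3 c d (by simp) (Or.inr n))
      refine ⟨(3, 1 + 2 * a, 1 + 2 * b), ?_, by rw [e]; ext <;> simp [axialImage] <;> ring⟩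
      simp at this ⊢
      omega
  exact encard_le_of_subset_image sub (by decide)

theorem planarBounds (p : ℝ × ℝ) : PlanarBounds p := by
  refine PlanarBounds.of_triangle (fun x y h₁ h₂ h₃ => ?_) p
  -- The vertex at the origin is the only rotation center in the triangle, and the `Near`
  -- inequalities are not available there.
  rcases eq_or_ne x 0 with rfl | h₀
  · obtain rfl : y = 0 := by linarith
    have e : halfPoint 0 0 = (0, 0) := by simp [halfPoint]
    have four : ∀ i j : ℤ, (overlaps (0, 0) (i / 2, j / 2)).encard ≤ 4 := fun i j =>
      e ▸ encard_overlaps_center i j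
    refine ⟨e ▸ encard_adjacents_center, fun i j _ _ => ?_, fun i j _ => ?_,
      fun i j _ => ?_, fun i j _ => ?_⟩
    · simpa using four i j
    · simpa using (four i j).trans (by norm_num)
    · simpa using four i j
    · simpa using (four i j).trans (by norm_num)
  · exact ⟨encard_adjacents_triangle h₁ h₂ h₃ h₀,
      fun i j hi hj => encard_le_of_subset_image (overlaps_subset_axialImage h₁ h₂ h₃ h₀ i j)
        (card_axialLabels_centered hi hj),
      fun i j hij => encard_le_of_subset_image (overlaps_subset_axialImage h₁ h₂ h₃ h₀ i j)
        (card_axialLabels_shifted hij),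
      fun i j hij => encard_le_of_subset_image (overlaps_subset_diagonalImage h₁ h₂ h₃ h₀ i j)
        (card_diagonalLabels_even hij),
      fun i j hij => encard_le_of_subset_image (overlaps_subset_diagonalImage h₁ h₂ h₃ h₀ i j)
        (card_diagonalLabels_odd hij)⟩

/-! ### Neighbors in a union of layers. -/

/-- The sites `Q` of `O` whose Voronoi region meets that of `P` at a point that is farther from all
the other sites. -/
def neighbors (O : Set E3) (P : E3) : Set E3 :=
  {Q ∈ O | Q ≠ P ∧ ∃ w, dist w P = dist w Q ∧ ∀ R ∈ O, R ≠ P → R ≠ Q → dist w P < dist w R}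

theorem encard_pair_le_two {α : Type*} (a b : α) : ({a, b} : Set α).encard ≤ 2 :=
  (Set.encard_insert_le _ _).trans (by rw [Set.encard_singleton]; norm_num)

theorem encard_prod_pair_le {S : Set (ℝ × ℝ)} {N : ℕ} (h : S.encard ≤ N) (a b : ℝ) :
    (S ×ˢ ({a, b} : Set ℝ)).encard ≤ ((2 * N : ℕ) : ℕ∞) := by
  rw [Set.encard_prod, mul_comm]
  push_cast
  exact mul_le_mul' (encard_pair_le_two a b) h

/-- A bound on the number of neighbors of `P` when the set of sites is a union of layers, each of
which consists of copies of a `pgg` orbit at unit distances along the third axis. -/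
theorem encard_neighbors_le {O : Set E3} {P : E3} (hP : P ∈ O) (ψ : E3 ≃ (ℝ × ℝ) × ℝ) {A C : ℝ}
    (hA : 0 < A) (hC : 0 < C)
    (hdist : ∀ a b, dist a b ^ 2 = A * sqd (ψ a).1 (ψ b).1 + C * ((ψ a).2 - (ψ b).2) ^ 2)
    (hO : ∀ Q ∈ O, ∀ r ∈ pgg (ψ Q).1, ∀ k : ℤ, ψ.symm (r, (ψ Q).2 + k) ∈ O)
    {ι : Type*} (s : Finset ι) (c : ι → ℝ × ℝ) (ζ : ι → ℝ) (N : ι → ℕ)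
    (hs : ∀ Q ∈ O, ((ψ Q).1 ∈ pgg (ψ P).1 ∧ ∃ k : ℤ, (ψ Q).2 = (ψ P).2 + k) ∨
      ∃ i ∈ s, (ψ Q).1 ∈ pgg (c i) ∧ ∃ k : ℤ, (ψ Q).2 = ζ i + k)
    (hN : ∀ i ∈ s, (overlaps (ψ P).1 (c i)).encard ≤ N i) :
    (neighbors O P).encard ≤ ((8 + ∑ i ∈ s, 2 * N i : ℕ) : ℕ∞) := by
  -- The three parts are the two vertical translates of P, the planar neighbors at the height of P,
  -- and for each class of layers the overlapping points at its two admissible heights.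
  have sub : ψ '' neighbors O P ⊆
      (({((ψ P).1, (ψ P).2 + 1), ((ψ P).1, (ψ P).2 - 1)} : Set ((ℝ × ℝ) × ℝ)) ∪
        adjacents (ψ P).1 ×ˢ ({(ψ P).2} : Set ℝ)) ∪
      ⋃ i ∈ s, overlaps (ψ P).1 (c i) ×ˢ
        ({ζ i + ⌊(ψ P).2 - ζ i⌋, ζ i + ⌊(ψ P).2 - ζ i⌋ + 1} : Set ℝ) := by
    rintro _ ⟨Q, ⟨hQ, hQP, w, he, hw⟩, rfl⟩
    have hlayer := hs Q hQ
    have hOP := hO P hP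
    have hOQ := hO Q hQ
    have key : ∀ R : (ℝ × ℝ) × ℝ, ψ.symm R ∈ O → R ≠ ψ P → R ≠ ψ Q →
        A * sqd (ψ w).1 (ψ P).1 + C * ((ψ w).2 - (ψ P).2) ^ 2 <
          A * sqd (ψ w).1 R.1 + C * ((ψ w).2 - R.2) ^ 2 := fun R hR h₁ h₂ => by
      have := hw _ hR (fun e => h₁ (by rw [← e, ψ.apply_symm_apply]))
        (fun e => h₂ (by rw [← e, ψ.apply_symm_apply]))
      rw [← sq_lt_sq₀ dist_nonneg dist_nonneg, hdist, hdist, ψ.apply_symm_apply] at this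
      exact this
    have he' := congrArg (· ^ 2) he
    simp only [hdist] at he'
    have hne : ψ Q ≠ ψ P := ψ.injective.ne hQP
    generalize ψ w = W at *
    generalize ψ Q = Q' at *
    generalize ψ P = P' at *
    obtain ⟨v, t⟩ := W
    obtain ⟨q, z'⟩ := Q'
    obtain ⟨p, z⟩ := P'
    simp only at *
    by_cases hspec : (q, z') = (p, z + 1) ∨ (q, z') = (p, z - 1)
    · exact Or.inl (Or.inl hspec)
    rw [not_or] at hspec
    -- Raising P by one and lowering Q by one gives two sites, distinct from P and Q because Q is
    -- not P raised by one. Adding the comparisons of w with them eliminates w.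
    have hlt₁ : z' - z < 1 := by
      have k₁ := key (p, z + 1) (by simpa using hOP p (mem_pgg_self p) 1) (by simp)
        (Ne.symm hspec.1)
      have k₂ := key (q, z' - 1) (by simpa [← sub_eq_add_neg] using hOQ q (mem_pgg_self q) (-1))
        (fun e => hspec.1 (by rw [Prod.mk.injEq] at e ⊢; exact ⟨e.1, by linarith [e.2]⟩)) (by simp)
      simp only at k₁ k₂
      nlinarith
    have hlt₂ : z - z' < 1 := by
      have k₁ := key (p, z - 1) (by simpa [← sub_eq_add_neg] using hOP p (mem_pgg_self p) (-1))
        (by simp) (Ne.symm hspec.2)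
      have k₂ := key (q, z' + 1) (by simpa using hOQ q (mem_pgg_self q) 1)
        (fun e => hspec.2 (by rw [Prod.mk.injEq] at e ⊢; exact ⟨e.1, by linarith [e.2]⟩)) (by simp)
      simp only at k₁ k₂
      nlinarith
    -- The cases are separated by class and not by height alone: for special base points a different
    -- class can lie in the plane of P.
    by_cases hown : q ∈ pgg p ∧ ∃ k : ℤ, z' = z + k
    · obtain ⟨hq, k, hk⟩ := hown
      have l₁ : (k : ℝ) < 1 := by linarith
      have l₂ : (-1 : ℝ) < k := by linarith
      have l₁' : k < 1 := by exact_mod_cast l₁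
      have l₂' : -1 < k := by exact_mod_cast l₂
      obtain rfl : k = 0 := by omega
      obtain rfl : z' = z := by simpa using hk
      have hqp : q ≠ p := fun e => hne (by rw [e])
      refine Or.inl (Or.inr ⟨⟨hq, hqp, v, ?_, fun r hr h₁ h₂ => ?_⟩, rfl⟩)
      · exact mul_left_cancel₀ hA.ne' (by linarith)
      · have := key (r, z') (by simpa using hOP r hr 0) (by simpa using h₁) (by simpa using h₂)
        exact lt_of_mul_lt_mul_left (by simpa using this) hA.le
    · obtain ⟨i, hi, hq, k, hk⟩ := hlayer.resolve_left hown
      -- Sites at the height of P have the same vertical term as P, so comparison with them is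
      -- purely planar; likewise for Q. As Q is not in the class of P, the competing sites in the
      -- layer of P cannot be Q, and conversely.
      refine Or.inr (Set.mem_biUnion hi ⟨⟨hq, v, fun r hr h₁ => ?_, fun r hr h₁ => ?_⟩, ?_⟩)
      · have := key (r, z) (by simpa using hOP r hr 0) (by simpa using h₁) fun e => by
          rw [Prod.mk.injEq] at e
          exact hown ⟨e.1 ▸ hr, 0, by simp [e.2]⟩
        exact lt_of_mul_lt_mul_left (by simpa using this) hA.le
      · have := key (r, z') (by simpa using hOQ r hr 0) (fun e => by
          rw [Prod.mk.injEq] at e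
          exact hown ⟨mem_pgg_symm (e.1 ▸ hr), 0, by simp [e.2]⟩) (by simpa using h₁)
        exact lt_of_mul_lt_mul_left (by linarith : A * sqd v q < A * sqd v r) hA.le
      · have f₁ := Int.floor_le (z - ζ i)
        have f₂ := Int.lt_floor_add_one (z - ζ i)
        have l₁ : (⌊z - ζ i⌋ : ℝ) < k + 1 := by linarith
        have l₂ : (k : ℝ) < ⌊z - ζ i⌋ + 2 := by linarith
        have l₁' : ⌊z - ζ i⌋ < k + 1 := by exact_mod_cast l₁
        have l₂' : k < ⌊z - ζ i⌋ + 2 := by exact_mod_cast l₂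
        obtain h | h : k = ⌊z - ζ i⌋ ∨ k = ⌊z - ζ i⌋ + 1 := by omega
        · left
          simp only [hk, ← h]
        · right
          simp only [hk, h, Set.mem_singleton_iff]
          push_cast
          ring
  rw [← ψ.injective.encard_image]
  refine (Set.encard_le_encard sub).trans ((Set.encard_union_le _ _).trans ?_)
  rw [Nat.cast_add]
  refine add_le_add ((Set.encard_union_le _ _).trans ?_) ?_
  · rw [Set.encard_prod, Set.encard_singleton, mul_one]
    exact (add_le_add (encard_pair_le_two _ _) (planarBounds _).adjacents_le).trans
      (by norm_num)
  · refine (Finset.set_encard_biUnion_le _ _).trans ?_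
    rw [Nat.cast_sum]
    exact Finset.sum_le_sum fun i hi => encard_prod_pair_le (hN i hi) _ _

/-! ### Facets of Voronoi regions. -/

open Topology in
/-- A point that is strictly closer to `P` than to all the other sites is an interior point of the
Voronoi region of `P`. -/
theorem voronoiRegion_mem_nhds {O : Set E3} {P x : E3}
    (hfin : ∀ r, (O ∩ Metric.closedBall x r).Finite)
    (hx : ∀ Q ∈ O, Q ≠ P → dist x P < dist x Q) : voronoiRegion O P ∈ 𝓝 x := by
  have h₁ : ∀ᶠ y in 𝓝 x, ∀ Q ∈ O ∩ Metric.closedBall x (dist x P + 1), dist y P ≤ dist y Q := by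
    refine (Filter.eventually_all_finite (hfin _)).2 fun Q hQ => ?_
    rcases eq_or_ne Q P with rfl | hne
    · exact Filter.Eventually.of_forall fun _ => le_rfl
    · have c₁ : Filter.Tendsto (fun y => dist y P) (𝓝 x) (𝓝 (dist x P)) :=
        (continuous_id.dist continuous_const).tendsto x
      have c₂ : Filter.Tendsto (fun y => dist y Q) (𝓝 x) (𝓝 (dist x Q)) :=
        (continuous_id.dist continuous_const).tendsto x
      exact (c₁.eventually_lt c₂ (hx Q hQ.1 hne)).mono fun _ h => h.le
  -- Within distance 1/2 of x, a site farther than `dist x P + 1` cannot overtake P, so only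
  -- finitely many sites matter.
  filter_upwards [h₁, Metric.ball_mem_nhds x (half_pos one_pos)] with y hy hyx Q hQ
  by_cases hd : dist x Q ≤ dist x P + 1
  · exact hy Q ⟨hQ, by rwa [Metric.mem_closedBall, dist_comm]⟩
  · rw [Metric.mem_ball] at hyx
    have t₁ := dist_triangle y x P
    have t₂ := dist_triangle x y Q
    rw [dist_comm x y] at t₂
    linarith

theorem dist_sq_sub_dist_sq (x P Q : E3) :
    dist x Q ^ 2 - dist x P ^ 2 = ‖Q‖ ^ 2 - ‖P‖ ^ 2 - 2 * inner ℝ x (Q - P) := by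
  rw [dist_eq_norm, dist_eq_norm, norm_sub_sq_real, norm_sub_sq_real, inner_sub_right]
  ring

/-- The difference of squared distances to two sites is affine in the point. Hence, if a site ties
with P at the midpoint of two points of the region of P, it ties at both ends. -/
theorem dist_sq_sub_dist_sq_midpoint (x y P Q : E3) :
    2 * (dist (midpoint ℝ x y) Q ^ 2 - dist (midpoint ℝ x y) P ^ 2) =
      (dist x Q ^ 2 - dist x P ^ 2) + (dist y Q ^ 2 - dist y P ^ 2) := by
  simp only [dist_sq_sub_dist_sq, midpoint_eq_smul_add, real_inner_smul_left, inner_add_left,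
    invOf_eq_inv]
  ring

/-- Three collinear points at the same distance from `x` cannot be distinct. -/
theorem eq_of_dist_eq_of_mem_span {x P Q R : E3} (hQ : dist x P = dist x Q)
    (hR : dist x P = dist x R) (hRP : R ≠ P) (h : R - P ∈ Submodule.span ℝ {Q - P}) : R = Q := by
  obtain ⟨c, hc⟩ := Submodule.mem_span_singleton.1 h
  have e : ∀ S, dist x P = dist x S → ‖S - P‖ ^ 2 = 2 * inner ℝ (x - P) (S - P) := fun S hS => by
    have : ‖x - P‖ ^ 2 = ‖(x - P) - (S - P)‖ ^ 2 := by
      rw [sub_sub_sub_cancel_right, ← dist_eq_norm, ← dist_eq_norm, hS]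
    rw [norm_sub_sq_real (x - P)] at this
    linarith
  have e₁ := e Q hQ
  have e₂ := e R hR
  rw [← hc, norm_smul, inner_smul_right, mul_pow, Real.norm_eq_abs, sq_abs] at e₂
  have hc0 : c ≠ 0 := by
    rintro rfl
    exact hRP (sub_eq_zero.1 (by rw [← hc, zero_smul]))
  have hv : ‖Q - P‖ ^ 2 ≠ 0 := by
    intro h0
    have : Q - P = 0 := by simpa using h0
    rw [this, smul_zero] at hc
    exact hRP (sub_eq_zero.1 hc.symm)
  have : c * ‖Q - P‖ ^ 2 * (c - 1) = 0 := by linear_combination e₂ - c * e₁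
  have hc1 : c = 1 := by
    rcases mul_eq_zero.1 this with h | h
    · exact absurd h (mul_ne_zero hc0 hv)
    · linarith
  rw [hc1, one_smul] at hc
  exact (sub_left_injective hc).symm

/-- A facet of the Voronoi region of `P` lies on the bisector of `P` and one of its neighbors. -/
theorem exists_neighbor_of_mem_facets {O : Set E3} {P : E3}
    (hfin : ∀ x r, (O ∩ Metric.closedBall x r).Finite) {F : Set E3}
    (hF : F ∈ facets (voronoiRegion O P)) :
    ∃ Q ∈ neighbors O P, F = voronoiRegion O P ∩ {x | dist x P = dist x Q} := by
  obtain ⟨hexp, hrank⟩ := hF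
  have hne : F.Nonempty := by
    by_contra h
    rw [Set.not_nonempty_iff_eq_empty] at h
    rw [h, vectorSpan_empty, finrank_bot] at hrank
    exact two_ne_zero hrank.symm
  obtain ⟨l, hl⟩ := hexp hne
  have hFK : ∀ x ∈ F, x ∈ voronoiRegion O P := fun x hx => by
    rw [hl] at hx
    exact hx.1
  have hconst : ∀ x ∈ F, ∀ y ∈ F, l x = l y := fun x hx y hy => by
    rw [hl] at hx hy
    exact le_antisymm (hy.2 x hx.1) (hx.2 y hy.1)
  have hmem : ∀ x ∈ F, ∀ y ∈ voronoiRegion O P, l y = l x → y ∈ F := fun x hx y hy h => by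
    rw [hl] at hx ⊢
    exact ⟨hy, fun z hz => h ▸ hx.2 z hz⟩
  let active : E3 → Set E3 := fun x => {Q ∈ O | dist x P = dist x Q}
  have hactive : ∀ x, (active x).Finite := fun x =>
    (hfin x (dist x P)).subset fun Q hQ => ⟨hQ.1, by
      rw [Metric.mem_closedBall, dist_comm]
      exact hQ.2.ge⟩
  -- A point of the face with the fewest active sites replaces a relative interior point. The active
  -- sites at a midpoint are active at both ends, so minimality makes the sites active at `x₀`
  -- active on the whole face.
  let x₀ := Function.argminOn (fun x => (active x).ncard) F hne
  have hx₀ : x₀ ∈ F := Function.argminOn_mem _ _ _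
  have hsub : ∀ x ∈ F, active x₀ ⊆ active x := by
    intro x hx
    have hmid : ∀ Q ∈ O, 0 ≤ dist (midpoint ℝ x₀ x) Q ^ 2 - dist (midpoint ℝ x₀ x) P ^ 2 ∧
        (dist (midpoint ℝ x₀ x) P = dist (midpoint ℝ x₀ x) Q →
          dist x₀ P = dist x₀ Q ∧ dist x P = dist x Q) := by
      intro Q hQ
      have h := dist_sq_sub_dist_sq_midpoint x₀ x P Q
      have a₁ := pow_le_pow_left₀ dist_nonneg (hFK x₀ hx₀ Q hQ) 2
      have a₂ := pow_le_pow_left₀ dist_nonneg (hFK x hx Q hQ) 2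
      refine ⟨by linarith, fun e => ?_⟩
      rw [e] at h
      constructor
      · rw [← sq_eq_sq₀ dist_nonneg dist_nonneg]
        linarith
      · rw [← sq_eq_sq₀ dist_nonneg dist_nonneg]
        linarith
    have hmF : midpoint ℝ x₀ x ∈ F := by
      refine hmem x hx _ (fun Q hQ => ?_) ?_
      · rw [← sq_le_sq₀ dist_nonneg dist_nonneg]
        linarith [(hmid Q hQ).1]
      · rw [midpoint_eq_smul_add, map_smul, map_add, hconst x₀ hx₀ x hx]
        simp
        ring
    have hle : (active x₀).ncard ≤ (active (midpoint ℝ x₀ x)).ncard :=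
      Function.argminOn_le (fun x => (active x).ncard) F hmF
    have hss : active (midpoint ℝ x₀ x) ⊆ active x₀ := fun Q hQ =>
      ⟨hQ.1, ((hmid Q hQ.1).2 hQ.2).1⟩
    rw [← Set.eq_of_subset_of_ncard_le hss hle (hactive _)]
    exact fun Q hQ => ⟨hQ.1, ((hmid Q hQ.1).2 hQ.2).2⟩
  -- If only P were active, `x₀` would be an interior point of the region at which `l` has a
  -- maximum. Then `l` = 0 and the face is the whole region, of dimension three.
  obtain ⟨Q, hQ, hQP⟩ : ∃ Q ∈ active x₀, Q ≠ P := by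
    by_contra! h
    have hnhds := voronoiRegion_mem_nhds (hfin x₀) (P := P) fun Q hQ hQP =>
      lt_of_le_of_ne (hFK x₀ hx₀ Q hQ) fun e => hQP (h Q ⟨hQ, e⟩)
    have hmax : IsLocalMax l x₀ := by
      filter_upwards [hnhds] with y hy
      have := hx₀
      rw [hl] at this
      exact this.2 y hy
    have hl0 : l = 0 := by simpa using hmax.fderiv_eq_zero
    have hKF : F = voronoiRegion O P :=
      Set.Subset.antisymm hFK fun y hy => hmem x₀ hx₀ y hy (by simp [hl0])
    have hint : (interior F).Nonempty := ⟨x₀, by rwa [mem_interior_iff_mem_nhds, hKF]⟩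
    have htop := AffineSubspace.vectorSpan_eq_top_of_affineSpan_eq_top ℝ E3 E3
      (affineSpan_eq_top_of_nonempty_interior
        (hint.mono (interior_mono (subset_convexHull ℝ F))))
    rw [htop, finrank_top] at hrank
    simp at hrank
  -- The face lies in the bisector plane of P and R, and both have dimension two. Two active sites
  -- thus determine the same normal line through P, and being equidistant from `x₀` they coincide.
  have hFQ : ∀ R ∈ active x₀, R ≠ P → vectorSpan ℝ F = (Submodule.span ℝ {R - P})ᗮ := by
    intro R hR hRP
    have : Fact (Module.finrank ℝ E3 = 2 + 1) := ⟨by simp⟩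
    refine Submodule.eq_of_le_of_finrank_eq ?_ ?_
    · rw [← vsub_eq_sub, ← AffineSubspace.direction_perpBisector, ← direction_affineSpan]
      refine AffineSubspace.direction_le (affineSpan_le.2 fun x hx => ?_)
      exact AffineSubspace.mem_perpBisector_iff_dist_eq.2 (hsub x hx hR).2
    · rw [hrank]
      exact (Submodule.finrank_orthogonal_span_singleton (n := 2) (sub_ne_zero.2 hRP)).symm
  have hspan := hFQ Q hQ hQP
  refine ⟨Q, ⟨hQ.1, hQP, x₀, hQ.2, fun R hR hRP hRQ => ?_⟩, ?_⟩
  · refine lt_of_le_of_ne (hFK x₀ hx₀ R hR) fun e => hRQ ?_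
    refine eq_of_dist_eq_of_mem_span hQ.2 e hRP ?_
    rw [← Submodule.orthogonal_orthogonal (Submodule.span ℝ {Q - P}), ← hspan,
      hFQ R ⟨hR, e⟩ hRP, Submodule.orthogonal_orthogonal]
    exact Submodule.mem_span_singleton_self _
  · refine Set.Subset.antisymm (fun x hx => ⟨hFK x hx, (hsub x hx hQ).2⟩) fun y hy => ?_
    refine hmem x₀ hx₀ y hy.1 ?_
    -- The functional is constant on the face, hence on its bisector plane, so every point of the
    -- region in this plane is again a maximizer.
    have hker : vectorSpan ℝ F ≤ LinearMap.ker (l : E3 →ₗ[ℝ] ℝ) := by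
      rw [vectorSpan_def, Submodule.span_le]
      rintro _ ⟨a, ha, b, hb, rfl⟩
      simp [hconst a ha b hb]
    have hy' : y - x₀ ∈ vectorSpan ℝ F := by
      rw [hspan, ← vsub_eq_sub Q, ← AffineSubspace.direction_perpBisector]
      exact AffineSubspace.vsub_mem_direction
        (AffineSubspace.mem_perpBisector_iff_dist_eq.2 hy.2)
        (AffineSubspace.mem_perpBisector_iff_dist_eq.2 hQ.2)
    have := hker hy'
    rw [LinearMap.mem_ker] at this
    simpa [sub_eq_zero] using this

theorem encard_facets_le_encard_neighbors {O : Set E3} {P : E3}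
    (hfin : ∀ x r, (O ∩ Metric.closedBall x r).Finite) :
    (facets (voronoiRegion O P)).encard ≤ (neighbors O P).encard := by
  have : facets (voronoiRegion O P) ⊆
      (fun Q => voronoiRegion O P ∩ {x | dist x P = dist x Q}) '' neighbors O P := fun F hF => by
    obtain ⟨Q, hQ, rfl⟩ := exists_neighbor_of_mem_facets hfin hF
    exact ⟨Q, hQ, rfl⟩
  exact (Set.encard_le_encard this).trans (Set.encard_image_le _ _)

/-! ### Orbits and metrics in crystallographic coordinates -/

/-- The map `f` of coordinate triples is one of the affine maps in `S`. -/
def Realizes (S : Set (Coord3 ≃ᵃ[ℝ] Coord3)) (f : Coord3 → Coord3) : Prop :=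
  ∃ h ∈ S, ∀ u, h u = f u

/-- A space group consists of affine bijections, so a coordinate formula must be realized by one
before it can be recognized as an element. The linear part is its own inverse. -/
theorem exists_affineEquiv_axial {a b c : ℝ} (ha : a * a = 1) (hb : b * b = 1) (hc : c * c = 1)
    (s t r : ℝ) : ∃ h : Coord3 ≃ᵃ[ℝ] Coord3,
      ∀ u, h u = ![a * u 0 + s, b * u 1 + t, c * u 2 + r] := by
  let e : Coord3 ≃ₗ[ℝ] Coord3 := LinearEquiv.ofInvolutive
    { toFun := fun u => ![a * u 0, b * u 1, c * u 2]
      map_add' := fun u v => by ext i; fin_cases i <;> simp <;> ring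
      map_smul' := fun k u => by ext i; fin_cases i <;> simp <;> ring }
    (fun u => by
      ext i
      fin_cases i <;> simp [← mul_assoc, ha, hb, hc])
  have he : ∀ u, e u = ![a * u 0, b * u 1, c * u 2] := fun _ => rfl
  refine ⟨e.toAffineEquiv.trans (AffineEquiv.constVAdd ℝ Coord3 ![s, t, r]), fun u => ?_⟩
  ext i
  fin_cases i <;> simp [he, add_comm]

theorem exists_affineEquiv_diagonal {c : ℝ} (hc : c * c = 1) (s t r : ℝ) :
    ∃ h : Coord3 ≃ᵃ[ℝ] Coord3, ∀ u, h u = ![u 1 + s, u 0 + t, c * u 2 + r] := by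
  let e : Coord3 ≃ₗ[ℝ] Coord3 := LinearEquiv.ofInvolutive
    { toFun := fun u => ![u 1, u 0, c * u 2]
      map_add' := fun u v => by ext i; fin_cases i <;> simp <;> ring
      map_smul' := fun k u => by ext i; fin_cases i <;> simp <;> ring }
    (fun u => by
      ext i
      fin_cases i <;> simp [← mul_assoc, hc])
  have he : ∀ u, e u = ![u 1, u 0, c * u 2] := fun _ => rfl
  refine ⟨e.toAffineEquiv.trans (AffineEquiv.constVAdd ℝ Coord3 ![s, t, r]), fun u => ?_⟩
  ext i
  fin_cases i <;> simp [he, add_comm]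

theorem realizes_spaceGroup_axial {reps : Set (Coord3 → Coord3)} {lattice : Set Coord3}
    {f : Coord3 → Coord3} (hf : f ∈ reps) {t : Coord3} (ht : t ∈ lattice) {g : Coord3 → Coord3}
    {a b c s₀ s₁ s₂ : ℝ} (ha : a * a = 1) (hb : b * b = 1) (hc : c * c = 1)
    (hg : ∀ u, g u = ![a * u 0 + s₀, b * u 1 + s₁, c * u 2 + s₂]) (h : ∀ u, g u = f u + t) :
    Realizes (spaceGroup reps lattice) g := by
  obtain ⟨e, he⟩ := exists_affineEquiv_axial ha hb hc s₀ s₁ s₂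
  have : ∀ u, e u = g u := fun u => by rw [he, hg]
  exact ⟨e, ⟨f, hf, t, ht, fun u => (this u).trans (h u)⟩, this⟩

theorem realizes_spaceGroup_diagonal {reps : Set (Coord3 → Coord3)} {lattice : Set Coord3}
    {f : Coord3 → Coord3} (hf : f ∈ reps) {t : Coord3} (ht : t ∈ lattice)
    {c s₀ s₁ s₂ : ℝ} (hc : c * c = 1) (h : ∀ u, ![u 1 + s₀, u 0 + s₁, c * u 2 + s₂] = f u + t) :
    Realizes (spaceGroup reps lattice) fun u => ![u 1 + s₀, u 0 + s₁, c * u 2 + s₂] := by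
  obtain ⟨e, he⟩ := exists_affineEquiv_diagonal hc s₀ s₁ s₂
  exact ⟨e, ⟨f, hf, t, ht, fun u => (he u).trans (h u)⟩, he⟩

section Orbit

variable {G : Subgroup (E3 ≃ᵃⁱ[ℝ] E3)} {P : E3} {φ : E3 ≃ᵃ[ℝ] Coord3}

theorem mem_pointOrbit_of_realizes {S : Set (Coord3 ≃ᵃ[ℝ] Coord3)}
    (hφ : ∀ h : Coord3 ≃ᵃ[ℝ] Coord3, h ∈ S ↔ ∃ g ∈ G, ∀ x, h (φ x) = φ (g x))
    {f : Coord3 → Coord3} (hf : Realizes S f) {Q : E3} (hQ : Q ∈ pointOrbit G P) :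
    φ.symm (f (φ Q)) ∈ pointOrbit G P := by
  obtain ⟨h, hS, hfh⟩ := hf
  obtain ⟨g, hg, hgφ⟩ := (hφ h).1 hS
  obtain ⟨k, hk, rfl⟩ := hQ
  exact ⟨g * k, G.mul_mem hg hk, by rw [← hfh, hgφ, AffineEquiv.symm_apply_apply]; rfl⟩

theorem exists_rep_of_mem_pointOrbit {reps : Set (Coord3 → Coord3)} {lattice : Set Coord3}
    (hφ : ∀ h : Coord3 ≃ᵃ[ℝ] Coord3, h ∈ spaceGroup reps lattice ↔
      ∃ g ∈ G, ∀ x, h (φ x) = φ (g x))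
    {Q : E3} (hQ : Q ∈ pointOrbit G P) : ∃ f ∈ reps, ∃ t ∈ lattice, φ Q = f (φ P) + t := by
  obtain ⟨g, hg, rfl⟩ := hQ
  obtain ⟨f, hf, t, ht, h⟩ := (hφ (φ.symm.trans (g.toAffineEquiv.trans φ))).2
    ⟨g, hg, fun x => by simp⟩
  exact ⟨f, hf, t, ht, by simpa using h (φ P)⟩

/-- Elements of G are isometries, so the linear part of f preserves the norm transported to
coordinates. -/
theorem norm_linear_symm_eq_of_realizes {S : Set (Coord3 ≃ᵃ[ℝ] Coord3)}
    (hφ : ∀ h : Coord3 ≃ᵃ[ℝ] Coord3, h ∈ S ↔ ∃ g ∈ G, ∀ x, h (φ x) = φ (g x))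
    {f : Coord3 → Coord3} (hf : Realizes S f) (u : Coord3) :
    ‖φ.linear.symm (f u - f 0)‖ = ‖φ.linear.symm u‖ := by
  obtain ⟨h, hS, hfh⟩ := hf
  obtain ⟨g, hg, hgφ⟩ := (hφ h).1 hS
  have key : ∀ v w : Coord3, φ.linear.symm (v - w) = φ.symm v - φ.symm w := fun v w =>
    φ.symm.toAffineMap.linearMap_vsub v w
  have e : ∀ v, φ.symm (f v) = g (φ.symm v) := fun v => by
    rw [← hfh, AffineEquiv.symm_apply_eq, ← hgφ, AffineEquiv.apply_symm_apply]
  rw [key, e, e, ← dist_eq_norm, g.dist_map, dist_eq_norm, ← key, sub_zero]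

end Orbit

/-- Invariance under the half-turn and a reflection makes the coordinate axes orthogonal, and
exchanging the first two axes makes their scales equal. -/
theorem exists_metric (L : Coord3 ≃ₗ[ℝ] E3)
    (h₁ : ∀ u : Coord3, ‖L ![-u 0, -u 1, u 2]‖ = ‖L u‖)
    (h₂ : ∀ u : Coord3, ‖L ![u 0, -u 1, u 2]‖ = ‖L u‖)
    {c : ℝ} (h₃ : ∀ u : Coord3, ‖L ![u 1, u 0, c * u 2]‖ = ‖L u‖) :
    ∃ A C : ℝ, 0 < A ∧ 0 < C ∧
      ∀ u : Coord3, ‖L u‖ ^ 2 = A * (u 0 ^ 2 + u 1 ^ 2) + C * u 2 ^ 2 := by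
  set e₀ := L ![1, 0, 0] with he₀
  set e₁ := L ![0, 1, 0] with he₁
  set e₂ := L ![0, 0, 1] with he₂
  have hL : ∀ u : Coord3, L u = u 0 • e₀ + u 1 • e₁ + u 2 • e₂ := fun u => by
    rw [he₀, he₁, he₂, ← map_smul, ← map_smul, ← map_smul, ← map_add, ← map_add]
    congr 1
    ext i
    fin_cases i <;> simp
  have hN : ∀ u : Coord3, ‖L u‖ ^ 2 = u 0 ^ 2 * ‖e₀‖ ^ 2 + u 1 ^ 2 * ‖e₁‖ ^ 2 +
      u 2 ^ 2 * ‖e₂‖ ^ 2 + 2 * (u 0 * u 1 * inner ℝ e₀ e₁ + u 0 * u 2 * inner ℝ e₀ e₂ +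
        u 1 * u 2 * inner ℝ e₁ e₂) := fun u => by
    rw [hL, norm_add_sq_real, norm_add_sq_real, inner_add_left, norm_smul, norm_smul, norm_smul]
    simp only [inner_smul_left, inner_smul_right, mul_pow, Real.norm_eq_abs, sq_abs]
    simp
    ring
  -- The first three test vectors isolate the three inner products. The last has third coordinate
  -- zero, so the value of `c` is irrelevant.
  have k₁ := congrArg (· ^ 2) (h₁ ![1, 0, 1])
  have k₂ := congrArg (· ^ 2) (h₁ ![0, 1, 1])
  have k₃ := congrArg (· ^ 2) (h₂ ![1, 1, 0])
  have k₄ := congrArg (· ^ 2) (h₃ ![1, 0, 0])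
  simp [hN] at k₁ k₂ k₃ k₄
  have i₁ : inner ℝ e₀ e₂ = 0 := by linarith
  have i₂ : inner ℝ e₁ e₂ = 0 := by linarith
  have i₃ : inner ℝ e₀ e₁ = 0 := by linarith
  have pos : ∀ v : Coord3, v ≠ 0 → 0 < ‖L v‖ ^ 2 := fun v hv =>
    pow_pos (norm_pos_iff.2 (by simpa using hv)) 2
  refine ⟨‖e₀‖ ^ 2, ‖e₂‖ ^ 2, pos _ fun h => ?_, pos _ fun h => ?_, fun u => ?_⟩
  · simpa using congrFun h 0
  · simpa using congrFun h 2
  · rw [hN, i₁, i₂, i₃]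
    have : ‖e₁‖ ^ 2 = ‖e₀‖ ^ 2 := by rw [k₄]
    rw [this]
    ring

/-- The coordinates of a point of space with respect to an affine frame, with the origin of the
first two coordinates moved to `(a, b)`, and grouped as a point of the plane and a height. -/
noncomputable def layerCoords (φ : E3 ≃ᵃ[ℝ] Coord3) (a b : ℝ) : E3 ≃ (ℝ × ℝ) × ℝ where
  toFun Q := ((φ Q 0 - a, φ Q 1 - b), φ Q 2)
  invFun w := φ.symm ![w.1.1 + a, w.1.2 + b, w.2]
  left_inv Q := by
    rw [AffineEquiv.symm_apply_eq]
    ext i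
    fin_cases i <;> simp
  right_inv w := by simp

theorem finite_setOf_add_half_mem_closedBall (v : Coord3) (R : ℝ) :
    {w ∈ Metric.closedBall (0 : Coord3) R | ∃ n : Fin 3 → ℤ, ∀ i, w i = v i + n i / 2}.Finite := by
  refine ((Set.finite_Icc (fun i => ⌊2 * (-R - v i)⌋) (fun i => ⌈2 * (R - v i)⌉)).image
    fun n i => v i + (n i : ℝ) / 2).subset ?_
  rintro w ⟨hw, n, hn⟩
  have hb : ∀ i, |v i + n i / 2| ≤ R := fun i => by
    rw [← hn, ← Real.norm_eq_abs]
    exact (norm_le_pi_norm w i).trans (by simpa using hw)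
  refine ⟨n, ⟨fun i => ?_, fun i => ?_⟩, funext fun i => (hn i).symm⟩
  · have := (abs_le.1 (hb i)).1
    exact Int.floor_le_iff.2 (by linarith)
  · have := (abs_le.1 (hb i)).2
    exact Int.le_ceil_iff.2 (by linarith)

theorem finite_pointOrbit_inter_closedBall {G : Subgroup (E3 ≃ᵃⁱ[ℝ] E3)} {P : E3}
    {φ : E3 ≃ᵃ[ℝ] Coord3} {reps : Set (Coord3 → Coord3)} {lattice : Set Coord3}
    (hφ : ∀ h : Coord3 ≃ᵃ[ℝ] Coord3, h ∈ spaceGroup reps lattice ↔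
      ∃ g ∈ G, ∀ x, h (φ x) = φ (g x))
    (hreps : ((fun f => f (φ P)) '' reps).Finite)
    (hlattice : ∀ t ∈ lattice, ∃ n : Fin 3 → ℤ, ∀ i, t i = n i / 2) (x : E3) (r : ℝ) :
    (pointOrbit G P ∩ Metric.closedBall x r).Finite := by
  have hcont : Continuous φ := φ.toAffineMap.continuous_of_finiteDimensional
  obtain ⟨R, hR⟩ :=
    ((isCompact_closedBall x r).image hcont).isBounded.subset_closedBall (0 : Coord3)
  refine Set.Finite.of_finite_image ((hreps.biUnion fun v _ =>
    finite_setOf_add_half_mem_closedBall v R).subset ?_) φ.injective.injOn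
  rintro _ ⟨Q, ⟨hQ, hQr⟩, rfl⟩
  obtain ⟨f, hf, t, ht, hft⟩ := exists_rep_of_mem_pointOrbit hφ hQ
  obtain ⟨n, hn⟩ := hlattice t ht
  refine Set.mem_biUnion ⟨f, hf, rfl⟩ ⟨hR ⟨Q, hQr, rfl⟩, n, fun i => ?_⟩
  rw [hft, Pi.add_apply, hn]

/-- The number of facets of a stereohedron of a group of isometries whose elements map the layer of
the base point, an orbit of a group acting as `pgg` in horizontal planes, to the layers with
representatives `c i` at the heights `ζ i`. -/
theorem encard_facets_dirichletStereohedron_le {G : Subgroup (E3 ≃ᵃⁱ[ℝ] E3)} {P : E3}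
    {φ : E3 ≃ᵃ[ℝ] Coord3} {reps : Set (Coord3 → Coord3)} {lattice : Set Coord3}
    (hφ : ∀ h : Coord3 ≃ᵃ[ℝ] Coord3, h ∈ spaceGroup reps lattice ↔
      ∃ g ∈ G, ∀ x, h (φ x) = φ (g x))
    (hreps : ((fun f => f (φ P)) '' reps).Finite)
    (hlattice : ∀ t ∈ lattice, ∃ n : Fin 3 → ℤ, ∀ i, t i = n i / 2) {x y : ℝ}
    (htranslate : ∀ a b k : ℤ, Realizes (spaceGroup reps lattice)
      fun u => ![u 0 + a, u 1 + b, u 2 + k])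
    (hrotate : ∀ a b k : ℤ, Realizes (spaceGroup reps lattice)
      fun u => ![-u 0 + (2 * x + a), -u 1 + (2 * y + b), u 2 + k])
    (hglide : ∀ a b k : ℤ, Realizes (spaceGroup reps lattice)
      fun u => ![u 0 + (1 / 2 + a), -u 1 + (2 * y + 1 / 2 + b), u 2 + k])
    (hglide' : ∀ a b k : ℤ, Realizes (spaceGroup reps lattice)
      fun u => ![-u 0 + (2 * x + 1 / 2 + a), u 1 + (1 / 2 + b), u 2 + k])
    {γ s₀ s₁ s₂ : ℝ} (hswap : Realizes (spaceGroup reps lattice)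
      fun u => ![u 1 + s₀, u 0 + s₁, γ * u 2 + s₂])
    {ι : Type*} [Fintype ι] (c : ι → ℝ × ℝ) (ζ : ι → ℝ) (N : ι → ℕ)
    (hlayers : ∀ f ∈ reps, ∀ t ∈ lattice,
      (((f (φ P) + t) 0 - x, (f (φ P) + t) 1 - y) ∈ pgg (φ P 0 - x, φ P 1 - y) ∧
        ∃ k : ℤ, (f (φ P) + t) 2 = φ P 2 + k) ∨
      ∃ i, ((f (φ P) + t) 0 - x, (f (φ P) + t) 1 - y) ∈ pgg (c i) ∧
        ∃ k : ℤ, (f (φ P) + t) 2 = ζ i + k)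
    (hN : ∀ i, (overlaps (φ P 0 - x, φ P 1 - y) (c i)).encard ≤ N i) :
    (facets (dirichletStereohedron G P)).encard ≤ ((8 + ∑ i, 2 * N i : ℕ) : ℕ∞) := by
  obtain ⟨A, C, hA, hC, hnorm⟩ := exists_metric φ.linear.symm (c := γ)
    (fun u => by
      rw [← norm_linear_symm_eq_of_realizes hφ (hrotate 0 0 0) u]
      congr 2
      ext i
      fin_cases i <;> simp)
    (fun u => by
      rw [← norm_linear_symm_eq_of_realizes hφ (hglide 0 0 0) u]
      congr 2
      ext i
      fin_cases i <;> simp)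
    (fun u => by
      rw [← norm_linear_symm_eq_of_realizes hφ hswap u]
      congr 2
      ext i
      fin_cases i <;> simp)
  refine (encard_facets_le_encard_neighbors
    (finite_pointOrbit_inter_closedBall hφ hreps hlattice)).trans ?_
  refine encard_neighbors_le (O := pointOrbit G P) ⟨1, G.one_mem, rfl⟩ (layerCoords φ x y) hA hC
    (fun a b => ?_) (fun Q hQ r hr k => ?_) Finset.univ c ζ N (fun Q hQ => ?_) fun i _ => hN i
  · have e : φ.linear.symm (φ a - φ b) = a - b := by
      rw [LinearEquiv.symm_apply_eq]
      exact (φ.toAffineMap.linearMap_vsub a b).symm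
    rw [dist_eq_norm, ← e, hnorm]
    simp [layerCoords, sqd]
  -- Each kind of planar motion, combined with a vertical shift by k, is realized by the group, so
  -- every site carries its whole layer.
  · have transport : ∀ {f : Coord3 → Coord3}, Realizes (spaceGroup reps lattice) f →
        ∀ v, f (φ Q) = v → φ.symm v ∈ pointOrbit G P := fun hf v hv =>
      hv ▸ mem_pointOrbit_of_realizes hφ hf hQ
    obtain ⟨a, b, rfl | rfl | rfl | rfl⟩ := hr
    · refine transport (htranslate a b k) _ ?_
      ext i
      fin_cases i <;> simp [layerCoords] <;> ring
    · refine transport (hrotate a b k) _ ?_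
      ext i
      fin_cases i <;> simp [layerCoords] <;> ring
    · refine transport (hglide a b k) _ ?_
      ext i
      fin_cases i <;> simp [layerCoords] <;> ring
    · refine transport (hglide' a b k) _ ?_
      ext i
      fin_cases i <;> simp [layerCoords] <;> ring
  · obtain ⟨f, hf, t, ht, e⟩ := exists_rep_of_mem_pointOrbit hφ hQ
    simpa [layerCoords, e] using hlayers f hf t ht

/-! ### The three groups. -/

theorem exists_half_of_mem_latticeP {t : Coord3} (ht : t ∈ latticeP) :
    ∃ n : Fin 3 → ℤ, ∀ i, t i = n i / 2 := by
  obtain ⟨n, hn⟩ := ht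
  exact ⟨fun i => 2 * n i, fun i => by rw [hn]; push_cast; ring⟩

theorem exists_half_of_mem_latticeI {t : Coord3} (ht : t ∈ latticeI) :
    ∃ n : Fin 3 → ℤ, ∀ i, t i = n i / 2 := by
  obtain ⟨n, hn | hn⟩ := ht
  · exact ⟨fun i => 2 * n i, fun i => by rw [hn]; push_cast; ring⟩
  · exact ⟨fun i => 2 * n i + 1, fun i => by rw [hn]; push_cast; ring⟩

theorem cast_mem_latticeP (a b k : ℤ) : ![(a : ℝ), b, k] ∈ latticeP :=
  ⟨![a, b, k], fun i => by fin_cases i <;> rfl⟩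

theorem cast_mem_latticeI (a b k : ℤ) : ![(a : ℝ), b, k] ∈ latticeI :=
  ⟨![a, b, k], .inl fun i => by fin_cases i <;> rfl⟩

theorem cast_add_half_mem_latticeI (a b k : ℤ) :
    ![(a : ℝ) + 1 / 2, b + 1 / 2, k + 1 / 2] ∈ latticeI :=
  ⟨![a, b, k], .inr fun i => by fin_cases i <;> rfl⟩

theorem mem_withInversion {reps : Set (Coord3 → Coord3)} {f : Coord3 → Coord3} (hf : f ∈ reps) :
    f ∈ withInversion reps :=
  .inl hf

theorem neg_mem_withInversion {reps : Set (Coord3 → Coord3)} {f : Coord3 → Coord3}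
    (hf : f ∈ reps) : (fun p => -f p) ∈ withInversion reps :=
  .inr ⟨f, hf, fun _ => rfl⟩

theorem finite_withInversion {reps : Set (Coord3 → Coord3)} (h : reps.Finite) :
    (withInversion reps).Finite :=
  h.union ((h.image fun f p => -f p).subset fun _ ⟨r, hr, hf⟩ =>
    ⟨r, hr, funext fun p => (hf p).symm⟩)

/-- The other classes are the body-centered copy of the layer and two copies turned by a quarter at
the opposite height, with N = 4 each. -/
theorem encard_facets_le_of_isOfType_groupI4bar_c2 {G : Subgroup (E3 ≃ᵃⁱ[ℝ] E3)} (P : E3)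
    (hG : IsOfType G groupI4bar_c2) :
    (facets (dirichletStereohedron G P)).encard ≤ 32 := by
  obtain ⟨φ, hφ⟩ := hG
  have h := planarBounds (φ P 0 - 0, φ P 1 - 0)
  refine (encard_facets_dirichletStereohedron_le hφ (Set.Finite.image _ (by simp))
    (fun _ => exists_half_of_mem_latticeI) (x := 0) (y := 0) ?_ ?_ ?_ ?_
    (realizes_spaceGroup_diagonal (.inr (.inr (.inr (.inr (.inr (.inr (.inl rfl)))))))
      (cast_mem_latticeI 0 0 0) (c := (-1)) (s₀ := 0) (s₁ := 0) (s₂ := 1 / 2)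
      (by norm_num) fun u => by
        ext i
        fin_cases i <;> simp)
    ![(φ P 0 - 0 + (1 : ℤ) / 2, φ P 1 - 0 + (1 : ℤ) / 2),
      (φ P 1 - 0 + (0 : ℤ) / 2, -(φ P 0 - 0) + (0 : ℤ) / 2),
      (φ P 1 - 0 + (1 : ℤ) / 2, -(φ P 0 - 0) + (1 : ℤ) / 2)]
    ![φ P 2 + 1 / 2, -φ P 2, -φ P 2 + 1 / 2]
    ![4, 4, 4] ?_ ?_).trans
    (by simp [Fin.sum_univ_succ])
  · exact fun a b k => realizes_spaceGroup_axial (a := 1) (b := 1) (c := 1)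
      (.inl rfl)
      (cast_mem_latticeI a b k)
      (by norm_num) (by norm_num) (by norm_num) (s₀ := a) (s₁ := b) (s₂ := k)
      (fun u => by simp) fun u => by
        ext i
        fin_cases i <;> simp
  · exact fun a b k => realizes_spaceGroup_axial (a := (-1)) (b := (-1)) (c := 1)
      (.inr (.inl rfl))
      (cast_mem_latticeI a b k)
      (by norm_num) (by norm_num) (by norm_num) (s₀ := 2 * 0 + a) (s₁ := 2 * 0 + b) (s₂ := k)
      (fun u => by simp) fun u => by
        ext i
        fin_cases i <;> simp
  · exact fun a b k => realizes_spaceGroup_axial (a := 1) (b := (-1)) (c := 1)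
      (.inr (.inr (.inr (.inr (.inl rfl)))))
      -- The glide of the group raises heights by 1/2. The centering vector adds another 1/2, and
      -- the resulting unit shift is removed here.
      (cast_add_half_mem_latticeI a b (k - 1))
      (by norm_num) (by norm_num) (by norm_num) (s₀ := 1 / 2 + a) (s₁ := 2 * 0 + 1 / 2 + b) (s₂ := k)
      (fun u => by simp) fun u => by
        ext i
        fin_cases i <;> simp <;> ring
  · exact fun a b k => realizes_spaceGroup_axial (a := (-1)) (b := 1) (c := 1)
      (.inr (.inr (.inr (.inr (.inr (.inl rfl))))))
      (cast_add_half_mem_latticeI a b (k - 1))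
      (by norm_num) (by norm_num) (by norm_num) (s₀ := 2 * 0 + 1 / 2 + a) (s₁ := 1 / 2 + b) (s₂ := k)
      (fun u => by simp) fun u => by
        ext i
        fin_cases i <;> simp <;> ring
  · intro f hf t ht
    obtain ⟨n, ht⟩ := ht
    rcases hf with rfl | rfl | rfl | rfl | rfl | rfl | rfl | rfl <;> rcases ht with ht | ht <;>
    -- Each alternative names the class of the image, the kind of `pgg` motion that carries its
    -- representative to the image, and the integer shifts.
    [refine .inl ⟨⟨n 0, n 1, .inl (Prod.ext ?_ ?_)⟩, n 2, ?_⟩;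
      refine .inr ⟨0, ⟨n 0, n 1, .inl (Prod.ext ?_ ?_)⟩, n 2, ?_⟩;
      refine .inl ⟨⟨n 0, n 1, .inr (.inl (Prod.ext ?_ ?_))⟩, n 2, ?_⟩;
      refine .inr ⟨0, ⟨n 0 + 1, n 1 + 1, .inr (.inl (Prod.ext ?_ ?_))⟩, n 2, ?_⟩;
      refine .inr ⟨1, ⟨n 0, n 1, .inl (Prod.ext ?_ ?_)⟩, n 2, ?_⟩;
      refine .inr ⟨2, ⟨n 0, n 1, .inl (Prod.ext ?_ ?_)⟩, n 2, ?_⟩;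
      refine .inr ⟨1, ⟨n 0, n 1, .inr (.inl (Prod.ext ?_ ?_))⟩, n 2, ?_⟩;
      refine .inr ⟨2, ⟨n 0 + 1, n 1 + 1, .inr (.inl (Prod.ext ?_ ?_))⟩, n 2, ?_⟩;
      refine .inr ⟨0, ⟨n 0 - 1, n 1, .inr (.inr (.inl (Prod.ext ?_ ?_)))⟩, n 2, ?_⟩;
      refine .inl ⟨⟨n 0, n 1, .inr (.inr (.inl (Prod.ext ?_ ?_)))⟩, n 2 + 1, ?_⟩;
      refine .inr ⟨0, ⟨n 0, n 1 - 1, .inr (.inr (.inr (Prod.ext ?_ ?_)))⟩, n 2, ?_⟩;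
      refine .inl ⟨⟨n 0, n 1, .inr (.inr (.inr (Prod.ext ?_ ?_)))⟩, n 2 + 1, ?_⟩;
      refine .inr ⟨2, ⟨n 0 - 1, n 1, .inr (.inr (.inl (Prod.ext ?_ ?_)))⟩, n 2, ?_⟩;
      refine .inr ⟨1, ⟨n 0, n 1, .inr (.inr (.inl (Prod.ext ?_ ?_)))⟩, n 2 + 1, ?_⟩;
      refine .inr ⟨2, ⟨n 0, n 1 - 1, .inr (.inr (.inr (Prod.ext ?_ ?_)))⟩, n 2, ?_⟩;
      refine .inr ⟨1, ⟨n 0, n 1, .inr (.inr (.inr (Prod.ext ?_ ?_)))⟩, n 2 + 1, ?_⟩]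
    all_goals simp [ht] <;> ring
  · intro i
    fin_cases i
    · exact h.centered_le 1 1 (by decide) (by decide)
    · exact h.rotated_le 0 0 (by decide)
    · exact h.rotated_le 1 1 (by decide)

theorem encard_facets_le_of_isOfType_groupP42_nbc {G : Subgroup (E3 ≃ᵃⁱ[ℝ] E3)} (P : E3)
    (hG : IsOfType G groupP42_nbc) :
    (facets (dirichletStereohedron G P)).encard ≤ 32 := by
  obtain ⟨φ, hφ⟩ := hG
  -- The vertical half-turn axes pass through (1/4, 1/4), which becomes the origin of the plane.
  have h := planarBounds (φ P 0 - 1 / 4, φ P 1 - 1 / 4)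
  refine (encard_facets_dirichletStereohedron_le hφ
      (Set.Finite.image _ (finite_withInversion (by simp)))
    (fun _ => exists_half_of_mem_latticeP) (x := 1 / 4) (y := 1 / 4) ?_ ?_ ?_ ?_
    (realizes_spaceGroup_diagonal (mem_withInversion (.inr (.inr (.inr (.inr (.inr (.inr (.inl rfl))))))))
      (cast_mem_latticeP 0 0 0) (c := (-1)) (s₀ := 0) (s₁ := 0) (s₂ := 1 / 2)
      (by norm_num) fun u => by
        ext i
        fin_cases i <;> simp)
    ![(φ P 1 - 1 / 4 + (0 : ℤ) / 2, -(φ P 0 - 1 / 4) + (0 : ℤ) / 2),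
      (φ P 0 - 1 / 4 + (1 : ℤ) / 2, φ P 1 - 1 / 4 + (1 : ℤ) / 2),
      (φ P 1 - 1 / 4 + (1 : ℤ) / 2, -(φ P 0 - 1 / 4) + (1 : ℤ) / 2)]
    ![φ P 2 + 1 / 2, -φ P 2, -φ P 2 + 1 / 2]
    ![4, 4, 4] ?_ ?_).trans
    (by simp [Fin.sum_univ_succ])
  · exact fun a b k => realizes_spaceGroup_axial (a := 1) (b := 1) (c := 1)
      (mem_withInversion (.inl rfl))
      (cast_mem_latticeP a b k)
      (by norm_num) (by norm_num) (by norm_num) (s₀ := a) (s₁ := b) (s₂ := k)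
      (fun u => by simp) fun u => by
        ext i
        fin_cases i <;> simp
  · exact fun a b k => realizes_spaceGroup_axial (a := (-1)) (b := (-1)) (c := 1)
      (mem_withInversion (.inr (.inl rfl)))
      (cast_mem_latticeP a b k)
      (by norm_num) (by norm_num) (by norm_num) (s₀ := 2 * (1 / 4) + a) (s₁ := 2 * (1 / 4) + b) (s₂ := k)
      (fun u => by simp) fun u => by
        ext i
        fin_cases i <;> simp <;> ring
  · exact fun a b k => realizes_spaceGroup_axial (a := 1) (b := (-1)) (c := 1)
      -- A half-turn about a horizontal axis followed by the inversion keeps heights and becomes a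
      -- glide of the layer.
      (neg_mem_withInversion (.inr (.inr (.inr (.inr (.inl rfl))))))
      (cast_mem_latticeP (a + 1) (b + 1) k)
      (by norm_num) (by norm_num) (by norm_num) (s₀ := 1 / 2 + a) (s₁ := 2 * (1 / 4) + 1 / 2 + b) (s₂ := k)
      (fun u => by simp) fun u => by
        ext i
        fin_cases i <;> simp <;> ring
  · exact fun a b k => realizes_spaceGroup_axial (a := (-1)) (b := 1) (c := 1)
      (neg_mem_withInversion (.inr (.inr (.inr (.inr (.inr (.inl rfl)))))))
      (cast_mem_latticeP (a + 1) (b + 1) k)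
      (by norm_num) (by norm_num) (by norm_num) (s₀ := 2 * (1 / 4) + 1 / 2 + a) (s₁ := 1 / 2 + b) (s₂ := k)
      (fun u => by simp) fun u => by
        ext i
        fin_cases i <;> simp <;> ring
  · intro f hf t ht
    obtain ⟨n, ht⟩ := ht
    rcases hf with (rfl | rfl | rfl | rfl | rfl | rfl | rfl | rfl) | ⟨r, rfl | rfl | rfl | rfl | rfl | rfl | rfl | rfl, hr⟩ <;>
    [refine .inl ⟨⟨n 0, n 1, .inl (Prod.ext ?_ ?_)⟩, n 2, ?_⟩;
      refine .inl ⟨⟨n 0, n 1, .inr (.inl (Prod.ext ?_ ?_))⟩, n 2, ?_⟩;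
      refine .inr ⟨0, ⟨n 0, n 1, .inr (.inl (Prod.ext ?_ ?_))⟩, n 2, ?_⟩;
      refine .inr ⟨0, ⟨n 0, n 1, .inl (Prod.ext ?_ ?_)⟩, n 2, ?_⟩;
      refine .inr ⟨1, ⟨n 0, n 1 - 1, .inr (.inr (.inr (Prod.ext ?_ ?_)))⟩, n 2, ?_⟩;
      refine .inr ⟨1, ⟨n 0 - 1, n 1, .inr (.inr (.inl (Prod.ext ?_ ?_)))⟩, n 2, ?_⟩;
      refine .inr ⟨2, ⟨n 0 - 1, n 1, .inr (.inr (.inl (Prod.ext ?_ ?_)))⟩, n 2, ?_⟩;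
      refine .inr ⟨2, ⟨n 0, n 1 - 1, .inr (.inr (.inr (Prod.ext ?_ ?_)))⟩, n 2, ?_⟩;
      refine .inr ⟨1, ⟨n 0, n 1, .inr (.inl (Prod.ext ?_ ?_))⟩, n 2, ?_⟩;
      refine .inr ⟨1, ⟨n 0 - 1, n 1 - 1, .inl (Prod.ext ?_ ?_)⟩, n 2, ?_⟩;
      refine .inr ⟨2, ⟨n 0 - 1, n 1 - 1, .inl (Prod.ext ?_ ?_)⟩, n 2 - 1, ?_⟩;
      refine .inr ⟨2, ⟨n 0, n 1, .inr (.inl (Prod.ext ?_ ?_))⟩, n 2 - 1, ?_⟩;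
      refine .inl ⟨⟨n 0 - 1, n 1 - 1, .inr (.inr (.inl (Prod.ext ?_ ?_)))⟩, n 2, ?_⟩;
      refine .inl ⟨⟨n 0 - 1, n 1 - 1, .inr (.inr (.inr (Prod.ext ?_ ?_)))⟩, n 2, ?_⟩;
      refine .inr ⟨0, ⟨n 0 - 1, n 1 - 1, .inr (.inr (.inr (Prod.ext ?_ ?_)))⟩, n 2 - 1, ?_⟩;
      refine .inr ⟨0, ⟨n 0 - 1, n 1 - 1, .inr (.inr (.inl (Prod.ext ?_ ?_)))⟩, n 2 - 1, ?_⟩]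
    all_goals simp [*] <;> ring
  · intro i
    fin_cases i
    · exact h.rotated_le 0 0 (by decide)
    · exact h.centered_le 1 1 (by decide) (by decide)
    · exact h.rotated_le 1 1 (by decide)

/-- Seven further classes occur: the body-centered copy (N = 4), quarter turns at heights shifted by
1/4 and 3/4 (5 each), half displacements along one axis at the opposite height and its shift by 1/2
(7 each), and quarter turns at the opposite height shifted by 1/4 and 3/4 (4 each). -/
theorem encard_facets_le_of_isOfType_groupI41_acd {G : Subgroup (E3 ≃ᵃⁱ[ℝ] E3)} (P : E3)
    (hG : IsOfType G groupI41_acd) :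
    (facets (dirichletStereohedron G P)).encard ≤ 80 := by
  obtain ⟨φ, hφ⟩ := hG
  have h := planarBounds (φ P 0 - 0, φ P 1 - 1 / 4)
  refine (encard_facets_dirichletStereohedron_le hφ
      (Set.Finite.image _ (finite_withInversion (by simp)))
    (fun _ => exists_half_of_mem_latticeI) (x := 0) (y := 1 / 4) ?_ ?_ ?_ ?_
    (realizes_spaceGroup_diagonal (mem_withInversion (.inr (.inr (.inr (.inr (.inr (.inr (.inl rfl))))))))
      (cast_mem_latticeI 0 0 0) (c := (-1)) (s₀ := 1 / 4) (s₁ := 3 / 4) (s₂ := 3 / 4)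
      (by norm_num) fun u => by
        ext i
        fin_cases i <;> simp)
    ![(φ P 0 - 0 + (1 : ℤ) / 2, φ P 1 - 1 / 4 + (1 : ℤ) / 2),
      (φ P 1 - 1 / 4 + (0 : ℤ) / 2, -(φ P 0 - 0) + (1 : ℤ) / 2),
      (φ P 1 - 1 / 4 + (1 : ℤ) / 2, -(φ P 0 - 0) + (0 : ℤ) / 2),
      (φ P 0 - 0 + (0 : ℤ) / 2, φ P 1 - 1 / 4 + (1 : ℤ) / 2),
      (φ P 0 - 0 + (1 : ℤ) / 2, φ P 1 - 1 / 4 + (0 : ℤ) / 2),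
      (φ P 1 - 1 / 4 + (0 : ℤ) / 2, -(φ P 0 - 0) + (0 : ℤ) / 2),
      (φ P 1 - 1 / 4 + (1 : ℤ) / 2, -(φ P 0 - 0) + (1 : ℤ) / 2)]
    ![φ P 2 + 1 / 2, φ P 2 + 1 / 4, φ P 2 + 3 / 4, -φ P 2, -φ P 2 + 1 / 2, -φ P 2 + 3 / 4, -φ P 2 + 1 / 4]
    ![4, 5, 5, 7, 7, 4, 4] ?_ ?_).trans
    (by simp [Fin.sum_univ_succ])
  · exact fun a b k => realizes_spaceGroup_axial (a := 1) (b := 1) (c := 1)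
      (mem_withInversion (.inl rfl))
      (cast_mem_latticeI a b k)
      (by norm_num) (by norm_num) (by norm_num) (s₀ := a) (s₁ := b) (s₂ := k)
      (fun u => by simp) fun u => by
        ext i
        fin_cases i <;> simp
  · exact fun a b k => realizes_spaceGroup_axial (a := (-1)) (b := (-1)) (c := 1)
      (mem_withInversion (.inr (.inl rfl)))
      -- The listed half-turn is a screw motion by 1/2; centering makes the vertical shift integral
      -- and places the axis at (0, 1/4) modulo half translations.
      (cast_add_half_mem_latticeI (a - 1) b (k - 1))
      (by norm_num) (by norm_num) (by norm_num) (s₀ := 2 * 0 + a) (s₁ := 2 * (1 / 4) + b) (s₂ := k)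
      (fun u => by simp) fun u => by
        ext i
        fin_cases i <;> simp <;> ring
  · exact fun a b k => realizes_spaceGroup_axial (a := 1) (b := (-1)) (c := 1)
      (neg_mem_withInversion (.inr (.inr (.inr (.inr (.inl rfl))))))
      (cast_mem_latticeI (a + 1) (b + 1) k)
      (by norm_num) (by norm_num) (by norm_num) (s₀ := 1 / 2 + a) (s₁ := 2 * (1 / 4) + 1 / 2 + b) (s₂ := k)
      (fun u => by simp) fun u => by
        ext i
        fin_cases i <;> simp <;> ring
  · exact fun a b k => realizes_spaceGroup_axial (a := (-1)) (b := 1) (c := 1)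
      (neg_mem_withInversion (.inr (.inr (.inr (.inr (.inr (.inl rfl)))))))
      (cast_add_half_mem_latticeI a b k)
      (by norm_num) (by norm_num) (by norm_num) (s₀ := 2 * 0 + 1 / 2 + a) (s₁ := 1 / 2 + b) (s₂ := k)
      (fun u => by simp) fun u => by
        ext i
        fin_cases i <;> simp <;> ring
  · intro f hf t ht
    obtain ⟨n, ht⟩ := ht
    rcases hf with (rfl | rfl | rfl | rfl | rfl | rfl | rfl | rfl) | ⟨r, rfl | rfl | rfl | rfl | rfl | rfl | rfl | rfl, hr⟩ <;> rcases ht with ht | ht <;>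
    [refine .inl ⟨⟨n 0, n 1, .inl (Prod.ext ?_ ?_)⟩, n 2, ?_⟩;
      refine .inr ⟨0, ⟨n 0, n 1, .inl (Prod.ext ?_ ?_)⟩, n 2, ?_⟩;
      refine .inr ⟨0, ⟨n 0 + 1, n 1, .inr (.inl (Prod.ext ?_ ?_))⟩, n 2, ?_⟩;
      refine .inl ⟨⟨n 0 + 1, n 1, .inr (.inl (Prod.ext ?_ ?_))⟩, n 2 + 1, ?_⟩;
      refine .inr ⟨1, ⟨n 0, n 1 + 1, .inr (.inl (Prod.ext ?_ ?_))⟩, n 2, ?_⟩;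
      refine .inr ⟨2, ⟨n 0 + 1, n 1 + 1, .inr (.inl (Prod.ext ?_ ?_))⟩, n 2, ?_⟩;
      refine .inr ⟨2, ⟨n 0, n 1, .inl (Prod.ext ?_ ?_)⟩, n 2, ?_⟩;
      refine .inr ⟨1, ⟨n 0 + 1, n 1, .inl (Prod.ext ?_ ?_)⟩, n 2 + 1, ?_⟩;
      refine .inr ⟨3, ⟨n 0, n 1 - 1, .inr (.inr (.inr (Prod.ext ?_ ?_)))⟩, n 2, ?_⟩;
      refine .inr ⟨4, ⟨n 0 + 1, n 1, .inr (.inr (.inr (Prod.ext ?_ ?_)))⟩, n 2, ?_⟩;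
      refine .inr ⟨4, ⟨n 0 - 1, n 1 - 1, .inr (.inr (.inl (Prod.ext ?_ ?_)))⟩, n 2, ?_⟩;
      refine .inr ⟨3, ⟨n 0, n 1, .inr (.inr (.inl (Prod.ext ?_ ?_)))⟩, n 2 + 1, ?_⟩;
      refine .inr ⟨5, ⟨n 0, n 1, .inr (.inr (.inl (Prod.ext ?_ ?_)))⟩, n 2, ?_⟩;
      refine .inr ⟨6, ⟨n 0, n 1 + 1, .inr (.inr (.inl (Prod.ext ?_ ?_)))⟩, n 2 + 1, ?_⟩;
      refine .inr ⟨6, ⟨n 0, n 1 - 1, .inr (.inr (.inr (Prod.ext ?_ ?_)))⟩, n 2, ?_⟩;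
      refine .inr ⟨5, ⟨n 0, n 1, .inr (.inr (.inr (Prod.ext ?_ ?_)))⟩, n 2, ?_⟩;
      refine .inr ⟨3, ⟨n 0, n 1, .inr (.inl (Prod.ext ?_ ?_))⟩, n 2, ?_⟩;
      refine .inr ⟨4, ⟨n 0 + 1, n 1, .inr (.inl (Prod.ext ?_ ?_))⟩, n 2, ?_⟩;
      refine .inr ⟨4, ⟨n 0 - 1, n 1, .inl (Prod.ext ?_ ?_)⟩, n 2 - 1, ?_⟩;
      refine .inr ⟨3, ⟨n 0, n 1, .inl (Prod.ext ?_ ?_)⟩, n 2, ?_⟩;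
      refine .inr ⟨5, ⟨n 0, n 1 - 1, .inl (Prod.ext ?_ ?_)⟩, n 2 - 1, ?_⟩;
      refine .inr ⟨6, ⟨n 0, n 1 - 1, .inl (Prod.ext ?_ ?_)⟩, n 2, ?_⟩;
      refine .inr ⟨6, ⟨n 0, n 1, .inr (.inl (Prod.ext ?_ ?_))⟩, n 2 - 1, ?_⟩;
      refine .inr ⟨5, ⟨n 0, n 1, .inr (.inl (Prod.ext ?_ ?_))⟩, n 2 - 1, ?_⟩;
      refine .inl ⟨⟨n 0 - 1, n 1 - 1, .inr (.inr (.inl (Prod.ext ?_ ?_)))⟩, n 2, ?_⟩;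
      refine .inr ⟨0, ⟨n 0 - 1, n 1, .inr (.inr (.inl (Prod.ext ?_ ?_)))⟩, n 2, ?_⟩;
      refine .inr ⟨0, ⟨n 0, n 1 - 1, .inr (.inr (.inr (Prod.ext ?_ ?_)))⟩, n 2 - 1, ?_⟩;
      refine .inl ⟨⟨n 0, n 1, .inr (.inr (.inr (Prod.ext ?_ ?_)))⟩, n 2, ?_⟩;
      refine .inr ⟨1, ⟨n 0 - 1, n 1 - 2, .inr (.inr (.inr (Prod.ext ?_ ?_)))⟩, n 2 - 1, ?_⟩;
      refine .inr ⟨2, ⟨n 0, n 1 - 1, .inr (.inr (.inr (Prod.ext ?_ ?_)))⟩, n 2 - 1, ?_⟩;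
      refine .inr ⟨2, ⟨n 0 - 1, n 1 - 1, .inr (.inr (.inl (Prod.ext ?_ ?_)))⟩, n 2 - 1, ?_⟩;
      refine .inr ⟨1, ⟨n 0, n 1, .inr (.inr (.inl (Prod.ext ?_ ?_)))⟩, n 2, ?_⟩]
    all_goals simp [*] <;> ring
  · intro i
    fin_cases i
    · exact h.centered_le 1 1 (by decide) (by decide)
    · exact h.rotated_shifted_le 0 1 (by decide)
    · exact h.rotated_shifted_le 1 0 (by decide)
    · exact h.shifted_le 0 1 (by decide)
    · exact h.shifted_le 1 0 (by decide)
    · exact h.rotated_le 0 0 (by decide)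
    · exact h.rotated_le 1 1 (by decide)

theorem mainTheorem6 (G : Subgroup (E3 ≃ᵃⁱ[ℝ] E3)) (P : E3) :
    (IsOfType G groupI4bar_c2 → (facets (dirichletStereohedron G P)).encard ≤ 40) ∧
    (IsOfType G groupP42_nbc → (facets (dirichletStereohedron G P)).encard ≤ 40) ∧
    (IsOfType G groupI41_acd → (facets (dirichletStereohedron G P)).encard ≤ 80) :=
  ⟨fun h => (encard_facets_le_of_isOfType_groupI4bar_c2 P h).trans (by norm_num),
    fun h => (encard_facets_le_of_isOfType_groupP42_nbc P h).trans (by norm_num),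
    encard_facets_le_of_isOfType_groupI41_acd P⟩
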